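/- **Setting.** Let $(\mathcal S,\mathcal A,P,c,\gamma)$ be a discounted MDP with finite $\mathcal S,\mathcal A$, costs $c(s,a)\in[0,1]$ and $\gamma\in(0,1)$; let $\mathcal Z=\mathcal S\times\mathcal A$, let $\pi$ be a policy, and let $\Phi\in\mathbb R^{|\mathcal Z|\times d}$, $d\ge 1$, be a feature matrix of full column rank with rows $\phi(z)^T$. Let $s_{or}\in\mathcal S$, $f\in[0,1]$, $m\in\mathbb N$, $\varepsilon^{(\mathcal S)}\in[0,1]$, $\varepsilon^{(\mathcal A)}>0$ and $\iota>0$. Put $$\tilde\pi^{(\mathcal X)}(a|s)=(1-\varepsilon^{(\mathcal X)})\pi(a|s)+\varepsilon^{(\mathcal X)}/|\mathcal A|\quad(\mathcal X\in\{\mathcal S,\mathcal A\}),\qquad \kappa_q(s)=(1-\gamma)\sum_{t\ge0}\gamma^t\Pr{}^\pi(s_t=s\mid s_0=q),$$ $$\kappa(s)=(1-f)\kappa_{s_{or}}(s)+\frac f{|\mathcal S|}\sum_{q\in\mathcal S}\kappa_q(s),\qquad w(s,a)=\kappa(s)\,\tilde\pi^{(\mathcal A)}(a|s),\qquad W=\mathrm{diag}(w),\qquad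 \|u\|_W^2=\sum_{z}w(z)u(z)^2 .$$ Let $P^\pi((s,a),(s',a'))=P(s'|s,a)\pi(a'|s')$, $\Omega=\|\Phi\|_2$ and $\mu=\lambda_{\min}(\Phi^TW\Phi)$. **CTD iteration.** Set $\theta_0=0$, $\theta_{t+1}=\theta_t-\iota\hat F_t(\theta_t)$ and $Q_t=\Phi\theta_t$, where $\hat F_t$ is sampled in iteration $t$ as follows. Draw, independently of the past and of each other, $\tilde t$ with $\Pr(\tilde t=k)=(1-\gamma)\gamma^k$, $k\ge0$, and a state $\tilde s$, equal to $s_{or}$ with probability $1-f$ and uniform on $\mathcal S$ with probability $f$. If $\tilde t\ge m$, put $\hat F_t=0$. If $\tilde t<m$, start from a state determined by the past and generate a trajectory of the MDP: actions follow $\tilde\pi^{(\mathcal S)}$ until $\tilde s$ is first hit, at time $\tau$ (it is assumed that the exploration ends, that is, $\tau<\infty$ almost surely), then $\pi$ for $\tilde t$ steps; at time $t'=\tau+\tilde t$ the action follows $\tilde\pi^{(\mathcal A)}$, and at time $t'+1$ it follows $\pi$. With $z_i=(s_i,a_i)$ put $$\hat F_t(\theta)=\phi(z_{t'})\big[\phi(z_{t'})^T\theta-c(z_{t'})-\gamma\,\phi(z_{t'+1})^T\theta\big].$$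 **Proposition.** Suppose $\min_s\kappa(s)>0$, $\varepsilon^{(\mathcal A)}\le\frac{(1-\gamma)\min_s\kappa(s)}4$, $$m\ge\log_{1/\gamma}\Big(\frac{(\Omega^2+1)|\mathcal S|^{1/2}}{\mu}\Big)\qquad\text{and}\qquad 0<\iota\le\frac{1-\gamma}{512\,\Omega^2},$$ and let $T=\lceil\frac{8}{(1-\gamma)\iota\mu}\rceil$. Then the projected Bellman equation $\bar Q=\Phi[\Phi^TW\Phi]^{-1}\Phi^TW(\gamma P^\pi\bar Q+c)$ has a unique solution $\bar Q$; all $\|Q_n-\bar Q\|_W^2$ are integrable; and for all integers $\ell\ge0$ and $t\ge1$, $$\sum_{i=0}^{t-1}\mathbb E\|Q_{\ell T+i}-\bar Q\|_W^2\;\le\;T\cdot2^{-(\ell+1)}\|Q_0-\bar Q\|_W^2+\frac{10(5T+4t)}{(1-\gamma)^2}.$$ Moreover, $C_2(\iota,m):=\frac{6\iota|\mathcal S|^{1/2}\Omega^2\gamma^m}{\mu}\big(1+2\iota|\mathcal S|^{1/2}\Omega^2\gamma^m\big)$ satisfies $C_2(\iota,m)\le\frac{3(1-\gamma)|\mathcal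 S|^{1/2}\gamma^m}{128\,\mu}$. -/

import Mathlib

open MeasureTheory

namespace CTD

/-- A finite discounted Markov decision process. `cost` is the (regularized) cost, with values in
`[0,1]`, and `P s a s'` is the probability of moving to `s'` when `a` is played in `s`. -/
structure MDP (S A : Type*) [Fintype S] where
  P : S → A → S → ℝ
  P_nonneg : ∀ s a s', 0 ≤ P s a s'
  P_sum : ∀ s a, ∑ s', P s a s' = 1
  cost : S → A → ℝ
  cost_nonneg : ∀ s a, 0 ≤ cost s a
  cost_le_one : ∀ s a, cost s a ≤ 1
  γ : ℝ
  γ_nonneg : 0 ≤ γ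
  γ_lt_one : γ < 1

/-- A feasible (randomized, stationary) policy: `prob s a` is the probability of `a` in `s`. -/
structure Policy (S A : Type*) [Fintype A] where
  prob : S → A → ℝ
  prob_nonneg : ∀ s a, 0 ≤ prob s a
  prob_sum : ∀ s, ∑ a, prob s a = 1

/-- The input parameters of conditional temporal differencing. -/
structure Params (S : Type*) where
  /-- origin state -/
  origin : S
  /-- frequency parameter -/
  f : ℝ
  /-- mixing time -/
  m : ℕ
  /-- state-exploration parameter -/
  εS : ℝ
  /-- action-exploration parameter -/
  εA : ℝ
  /-- stepsize -/
  ι : ℝ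

noncomputable section

variable {S A : Type*} [Fintype S] [Fintype A] [DecidableEq S] [DecidableEq A] {d : ℕ}

/-- Perturbed policy `(1 - ε) π(a|s) + ε / |A|`. -/
def perturb (π : Policy S A) (ε : ℝ) (s : S) (a : A) : ℝ :=
  (1 - ε) * π.prob s a + ε / Fintype.card A

/-- One-step state transition matrix under `π`. -/
def stateMatrix (M : MDP S A) (π : Policy S A) : Matrix S S ℝ :=
  Matrix.of fun s s' => ∑ a, π.prob s a * M.P s a s'

/-- State-action transition matrix under `π`. -/
def pairMatrix (M : MDP S A) (π : Policy S A) : Matrix (S × A) (S × A) ℝ :=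
  Matrix.of fun z z' => M.P z.1 z.2 z'.1 * π.prob z'.1 z'.2

/-- Discounted state visitation distribution from the state `q`. -/
def visitation (M : MDP S A) (π : Policy S A) (q s : S) : ℝ :=
  (1 - M.γ) * ∑' t : ℕ, M.γ ^ t * (stateMatrix M π ^ t) q s

/-- Visitation distribution from the origin state mixed, with weight `f`, with the one from the
uniform distribution. -/
def mixedVisitation (M : MDP S A) (π : Policy S A) (p : Params S) (s : S) : ℝ :=
  (1 - p.f) * visitation M π p.origin s
    + p.f * ∑ q, (Fintype.card S : ℝ)⁻¹ * visitation M π q s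

/-- The weighting distribution on state-action pairs. -/
def weight (M : MDP S A) (π : Policy S A) (p : Params S) (z : S × A) : ℝ :=
  mixedVisitation M π p z.1 * perturb π p.εA z.1 z.2

/-- Squared weighted norm `‖u‖_W²`. -/
def normSqW (M : MDP S A) (π : Policy S A) (p : Params S) (u : S × A → ℝ) : ℝ :=
  ∑ z, weight M π p z * u z ^ 2

/-- The weighted feature matrix `Φᵀ W Φ`. -/
def weightedGram (M : MDP S A) (π : Policy S A) (p : Params S)
    (Φ : Matrix (S × A) (Fin d) ℝ) : Matrix (Fin d) (Fin d) ℝ :=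
  Φ.transpose * Matrix.diagonal (weight M π p) * Φ

theorem weightedGram_isHermitian (M : MDP S A) (π : Policy S A) (p : Params S)
    (Φ : Matrix (S × A) (Fin d) ℝ) : (weightedGram M π p Φ).IsHermitian := by
  unfold weightedGram
  rw [Matrix.IsHermitian, Matrix.conjTranspose_eq_transpose_of_trivial]
  simp [Matrix.transpose_mul, Matrix.mul_assoc]

/-- `μ`, the smallest eigenvalue of `Φᵀ W Φ`. -/
def mu (M : MDP S A) (π : Policy S A) (p : Params S) (Φ : Matrix (S × A) (Fin d) ℝ) : ℝ :=
  ⨅ i, (weightedGram_isHermitian M π p Φ).eigenvalues i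

open scoped Matrix.Norms.L2Operator in
/-- `Ω`, the spectral norm of the feature matrix. -/
def featureNorm (Φ : Matrix (S × A) (Fin d) ℝ) : ℝ := ‖Φ‖

/-- `Q` solves the projected Bellman equation
`Q = Φ (Φᵀ W Φ)⁻¹ Φᵀ W (γ P^π Q + c)`. -/
def ProjectedBellman (M : MDP S A) (π : Policy S A) (p : Params S)
    (Φ : Matrix (S × A) (Fin d) ℝ) (Q : S × A → ℝ) : Prop :=
  Q = (Φ * (weightedGram M π p Φ)⁻¹ * Φ.transpose * Matrix.diagonal (weight M π p)).mulVec
    (M.γ • (pairMatrix M π).mulVec Q + fun z => M.cost z.1 z.2)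

/-- The constant `C₂(ι, m)`. -/
def C2 (M : MDP S A) (π : Policy S A) (p : Params S) (Φ : Matrix (S × A) (Fin d) ℝ) : ℝ :=
  6 * p.ι * √(Fintype.card S) * featureNorm Φ ^ 2 * M.γ ^ p.m / mu M π p Φ *
    (1 + 2 * p.ι * √(Fintype.card S) * featureNorm Φ ^ 2 * M.γ ^ p.m)

/-- Epoch length `T = ⌈8 / ((1 - γ) ι μ)⌉`. -/
def epochLength (M : MDP S A) (π : Policy S A) (p : Params S)
    (Φ : Matrix (S × A) (Fin d) ℝ) : ℕ :=
  ⌈8 / ((1 - M.γ) * p.ι * mu M π p Φ)⌉₊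

/-- Law of the random origin state: `p.origin` with probability `1 - f`, and uniform on `S` with
probability `f`. -/
def originLaw (p : Params S) (q : S) : ℝ :=
  (1 - p.f) * (if q = p.origin then 1 else 0) + p.f / Fintype.card S

/-- First hitting time of `q` by the path `s` (only used for paths that visit `q`). -/
def hittingTime (s : ℕ → S) (q : S) : ℕ := sInf {n | s n = q}

open Classical in
/-- Probability of the action `a` at step `i` of the path `s`, for the target state `q` and the
random length `k`: the state-exploration policy is used until `q` is hit, then `π` for `k` steps,
then once the action-exploration policy, then `π`. It depends on `s 0, …, s i` only. -/
def behavior (π : Policy S A) (p : Params S) (q : S) (k : ℕ) (s : ℕ → S) (i : ℕ) (a : A) : ℝ :=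
  if ∀ j ≤ i, s j ≠ q then perturb π p.εS (s i) a
  else if i = hittingTime s q + k then perturb π p.εA (s i) a
  else π.prob (s i) a

/-- A realization, on a probability space, of the sampling carried out by the iterations
`t = 0, 1, 2, …`. In iteration `t` a length `len t` with the geometric law on `{0, 1, …}` is drawn;
if `len t < m`, a target state `target t` is drawn and a trajectory
`state t 0, action t 0, state t 1, action t 1, …` of the process is generated up to the first step
after time `hittingTime + len t`. Everything is fresh given the past `hist t`, except that the
starting state `state t 0` is determined by the past (for instance, it may be the last state of the
previous trajectory). If `len t ≥ m`, no trajectory is needed and nothing is asked of it. -/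
structure Run (M : MDP S A) (π : Policy S A) (p : Params S)
    {Ω : Type*} [mΩ : MeasurableSpace Ω] (ℙ : Measure Ω) where
  hist : Filtration ℕ mΩ
  len : ℕ → Ω → ℕ
  target : ℕ → Ω → S
  state : ℕ → ℕ → Ω → S
  action : ℕ → ℕ → Ω → A
  start_meas : ∀ t s, MeasurableSet[hist t] {ω | state t 0 ω = s}
  len_meas : ∀ t k, MeasurableSet[hist (t + 1)] {ω | len t ω = k}
  target_meas : ∀ t q, MeasurableSet[hist (t + 1)] {ω | target t ω = q}
  state_meas : ∀ t i s, MeasurableSet[hist (t + 1)] {ω | state t i ω = s}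
  action_meas : ∀ t i a, MeasurableSet[hist (t + 1)] {ω | action t i ω = a}
  len_law : ∀ (t : ℕ) (B : Set Ω), MeasurableSet[hist t] B → ∀ k : ℕ,
    ℙ.real (B ∩ {ω | len t ω = k}) = ℙ.real B * ((1 - M.γ) * M.γ ^ k)
  /-- Conditional law, given the past, of the length, the target and the first `n + 1` states and
  actions, where step `n` is not beyond the step after time `hittingTime + len t`. -/
  path_law : ∀ (t : ℕ) (B : Set Ω), MeasurableSet[hist t] B →
    ∀ (k : ℕ) (q : S) (n : ℕ) (s : ℕ → S) (a : ℕ → A), k < p.m →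
    (∀ j, j + k + 1 < n → s j ≠ q) →
    ℙ.real (B ∩ {ω | len t ω = k ∧ target t ω = q ∧
        ∀ i ≤ n, state t i ω = s i ∧ action t i ω = a i}) =
      ℙ.real (B ∩ {ω | state t 0 ω = s 0}) * ((1 - M.γ) * M.γ ^ k) * originLaw p q *
        (∏ i ∈ Finset.range (n + 1), behavior π p q k s i (a i)) *
        ∏ i ∈ Finset.range n, M.P (s i) (a i) (s (i + 1))
  /-- The exploration phase ends: the target is reached almost surely. -/
  hits : ∀ t, ∀ᵐ ω ∂ℙ, len t ω < p.m → ∃ n, state t n ω = target t ω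

/-- `F̃(θ, ξ) = φ(z) (φ(z)ᵀ θ - c(z) - γ φ(z')ᵀ θ)`. -/
def tdOperator (M : MDP S A) (Φ : Matrix (S × A) (Fin d) ℝ) (z z' : S × A)
    (θ : Fin d → ℝ) : Fin d → ℝ :=
  (Φ z ⬝ᵥ θ - M.cost z.1 z.2 - M.γ * (Φ z' ⬝ᵥ θ)) • Φ z

namespace Run

variable {M : MDP S A} {π : Policy S A} {p : Params S}
  {Ω : Type*} [mΩ : MeasurableSpace Ω] {ℙ : Measure Ω}

/-- The time `t'` of iteration `t` at which the operator is sampled. -/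
def sampleTime (R : Run M π p ℙ) (t : ℕ) (ω : Ω) : ℕ :=
  hittingTime (fun n => R.state t n ω) (R.target t ω) + R.len t ω

/-- The state-action pair at step `i` of the trajectory of iteration `t`. -/
def pair (R : Run M π p ℙ) (t i : ℕ) (ω : Ω) : S × A := (R.state t i ω, R.action t i ω)

/-- The stochastic operator `F̂` of iteration `t`. -/
def stochOperator (R : Run M π p ℙ) (Φ : Matrix (S × A) (Fin d) ℝ) (t : ℕ) (ω : Ω)
    (θ : Fin d → ℝ) : Fin d → ℝ :=
  if R.len t ω < p.m then
    tdOperator M Φ (R.pair t (R.sampleTime t ω) ω) (R.pair t (R.sampleTime t ω + 1) ω) θ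
  else 0

/-- The iterates `θ_0 = 0`, `θ_{t+1} = θ_t - ι F̂(θ_t)`. -/
def theta (R : Run M π p ℙ) (Φ : Matrix (S × A) (Fin d) ℝ) : ℕ → Ω → Fin d → ℝ
  | 0, _ => 0
  | t + 1, ω => R.theta Φ t ω - p.ι • R.stochOperator Φ t ω (R.theta Φ t ω)

/-- `Q_t = Φ θ_t`. -/
def Q (R : Run M π p ℙ) (Φ : Matrix (S × A) (Fin d) ℝ) (t : ℕ) (ω : Ω) : S × A → ℝ :=
  Φ.mulVec (R.theta Φ t ω)

end Run

end

end CTD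

/-! ### The Bellman form: dissipation with a potential, and the effect of action exploration. -/

namespace CTD

set_option linter.unusedSectionVars false

noncomputable section

variable {S A : Type*} [Fintype S] [Fintype A]

/-! The right-hand side leaves room for an error of 40/(1-γ)² per iterate and a start-up term
50T/(1-γ)². This is enough to do without any contraction towards Q̄: the norms of Q_n and Q̄ are
bounded separately, by R/(1-γ) (on average over n, up to the start-up term) and X/(1-γ), and Young's
inequality combines them into (R+X)²/(1-γ)² with (R+X)² ≤ 40. The geometrically decaying term is
simply dropped.

For Q_n the Lyapunov function is E|θ_n|². Given the past, the sampled pair is distributed according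
to the visitation distribution k truncated at m (mass 1-g, with g = γ^m) times the perturbed policy,
followed by one step of P^π (`Run.measureReal_sampled`). With x = Φθ, the expected increment of |θ|²
is therefore at most -2ι(B - L) + ι²Ω²N, where B is the Bellman form, L the cost form and N the
second moment of the temporal difference error, all weighted by k. The core is the inequality
`NoisyDrift`, B - L - (1-γ)N/1024 ≥ ϖ((1-γ)c‖x‖_W² - C/(1-γ)), with numerical c, C; here ϖ = 1,
except that ϖ = 1-g for a single state. Since ‖x‖_W² ≥ μ|θ|² and θ_0 = 0, it keeps μE|θ_n|² bounded,
and its sum over n controls the sum of E‖Q_n‖_W² (`Run.energy_bounds`).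

The lower bound on B rests on the flow identity γkP = k - (1-γ)ρ + (1-γ)gν. Expanding the squares (x
- X')², where X' is the mean value at the next state, gives the classical bound; a potential η
retains part of these squares (`bellmanForm_potential`). It exists because a large value cannot be
reached from small ones without jumps: a chain through j states retains the fraction 1/(2j-1) of X²
(`exists_chain_potential`), and more at the dominant state when the values elsewhere are small
(`exists_extended_potential`). The truncation is harmless because the choice of m gives √n·g|x|² ≤
‖x‖_W² for n states, and the action exploration because ε is at most (1-γ)/4 times the least state
weight. What remains is an inequality in one ratio r ∈ [0,1], verified with rational constants for n
= 2, 3, 4, for 5 ≤ n ≤ 6 and for n ≥ 7 (`Certificate`); n = 1 is direct.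

For Q̄, pairing the projected equation with its solution gives B = L for the untruncated weights,
and the same dissipation with g = 0 bounds ‖Q̄‖_W. It also makes the matrix of the equation
injective, hence existence and uniqueness. -/

/-- Mean of `x` under the policy, as a function of the state. -/
def polMean (π : Policy S A) (x : S × A → ℝ) (s : S) : ℝ := ∑ a, π.prob s a * x (s, a)

/-- Second moment of `x` under the policy, as a function of the state. -/
def polSq (π : Policy S A) (x : S × A → ℝ) (s : S) : ℝ := ∑ a, π.prob s a * x (s, a) ^ 2

/-- Sum of the squares of `x` over the actions. -/
def actSq (x : S × A → ℝ) (s : S) : ℝ := ∑ a, x (s, a) ^ 2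

/-- The function `P^π x`. -/
def nextMean (M : MDP S A) (π : Policy S A) (x : S × A → ℝ) (s : S) (a : A) : ℝ :=
  ∑ s', M.P s a s' * polMean π x s'

/-- The quadratic form `⟨x, (I - γ P^π) x⟩` for the state weights `k` and the action
probabilities `b`. -/
def bellmanForm (M : MDP S A) (π : Policy S A) (k : S → ℝ) (b : S → A → ℝ) (x : S × A → ℝ) : ℝ :=
  ∑ s, k s * ∑ a, b s a * (x (s, a) ^ 2 - M.γ * (x (s, a) * nextMean M π x s a))

/-- The second moment of `x` under `b` in the state `s`, weighted by `k`. -/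
def stateEnergy (k : S → ℝ) (b : S → A → ℝ) (x : S × A → ℝ) (s : S) : ℝ :=
  k s * ∑ a, b s a * x (s, a) ^ 2

/-- The matrix `P^π` on states carries `k` to `k - (1-γ) ρ + (1-γ) g ν`, after discounting. -/
def Flow (M : MDP S A) (π : Policy S A) (k ρ ν : S → ℝ) (g : ℝ) : Prop :=
  ∀ s', M.γ * ∑ s, k s * stateMatrix M π s s' =
    k s' - (1 - M.γ) * ρ s' + (1 - M.γ) * g * ν s'

theorem Policy.prob_le_one (π : Policy S A) (s : S) (a : A) : π.prob s a ≤ 1 := by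
  rw [← π.prob_sum s]
  exact Finset.single_le_sum (fun a _ => π.prob_nonneg s a) (Finset.mem_univ a)

theorem sum_prob_sub_sq (π : Policy S A) (x : S × A → ℝ) (s : S) :
    ∑ a, π.prob s a * (x (s, a) - polMean π x s) ^ 2 = polSq π x s - polMean π x s ^ 2 := by
  have h : ∀ a, π.prob s a * (x (s, a) - polMean π x s) ^ 2 =
      π.prob s a * x (s, a) ^ 2 - 2 * polMean π x s * (π.prob s a * x (s, a)) +
        π.prob s a * polMean π x s ^ 2 := fun a => by ring
  simp_rw [h, Finset.sum_add_distrib, Finset.sum_sub_distrib, ← Finset.mul_sum, ← Finset.sum_mul,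
    π.prob_sum]
  change polSq π x s - 2 * polMean π x s * polMean π x s + _ = _
  ring

theorem polMean_sq_le (π : Policy S A) (x : S × A → ℝ) (s : S) :
    polMean π x s ^ 2 ≤ polSq π x s := by
  have h := sum_prob_sub_sq π x s
  have : 0 ≤ ∑ a, π.prob s a * (x (s, a) - polMean π x s) ^ 2 :=
    Finset.sum_nonneg fun a _ => mul_nonneg (π.prob_nonneg s a) (sq_nonneg _)
  linarith

theorem polSq_le_actSq (π : Policy S A) (x : S × A → ℝ) (s : S) : polSq π x s ≤ actSq x s :=
  Finset.sum_le_sum fun a _ => mul_le_of_le_one_left (sq_nonneg _) (π.prob_le_one s a)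

theorem polSq_nonneg (π : Policy S A) (x : S × A → ℝ) (s : S) : 0 ≤ polSq π x s :=
  Finset.sum_nonneg fun a _ => mul_nonneg (π.prob_nonneg s a) (sq_nonneg _)

theorem actSq_nonneg (x : S × A → ℝ) (s : S) : 0 ≤ actSq x s :=
  Finset.sum_nonneg fun _ _ => sq_nonneg _

/-- Dissipation of the Bellman form in the presence of a potential `η`. -/
theorem bellmanForm_potential (M : MDP S A) (π : Policy S A) {k ρ ν η : S → ℝ} {g : ℝ}
    (x : S × A → ℝ) (hk : ∀ s, 0 ≤ k s) (hρ : ∀ s, 0 ≤ ρ s) (hflow : Flow M π k ρ ν g)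
    (hη : ∀ s, η s ≤ polMean π x s ^ 2)
    (hstep : ∀ s a s', η s' ≤ η s + (x (s, a) - polMean π x s) ^ 2 +
      (x (s, a) - polMean π x s') ^ 2) :
    (1 - M.γ) * ∑ s, k s * (2 * polSq π x s - polMean π x s ^ 2 + η s) -
        (1 - M.γ) * g * ∑ s, ν s * (polMean π x s ^ 2 - η s) ≤
      2 * bellmanForm M π k π.prob x := by
  have hγ := M.γ_lt_one
  set X := polMean π x with hX
  set U := polSq π x with hU
  -- Write 2xX' = x² + X'² - (x - X')² and bound the last square from below by `hstep`; η = 0 would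
  -- discard it.
  have h1 : ∀ s a, 2 * (x (s, a) * nextMean M π x s a) ≤
      η s + (x (s, a) - X s) ^ 2 + x (s, a) ^ 2 + ∑ s', M.P s a s' * (X s' ^ 2 - η s') := by
    intro s a
    have e : η s + (x (s, a) - X s) ^ 2 + x (s, a) ^ 2 =
        ∑ s', M.P s a s' * (η s + (x (s, a) - X s) ^ 2 + x (s, a) ^ 2) := by
      rw [← Finset.sum_mul, M.P_sum, one_mul]
    rw [e, ← Finset.sum_add_distrib, nextMean, Finset.mul_sum, Finset.mul_sum]
    refine Finset.sum_le_sum fun s' _ => ?_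
    have := mul_le_mul_of_nonneg_left (hstep s a s') (M.P_nonneg s a s')
    rw [← hX]
    nlinarith [this]
  have h2 : ∀ s, 2 * ∑ a, π.prob s a * (x (s, a) * nextMean M π x s a) ≤
      η s + (2 * U s - X s ^ 2) + ∑ s', stateMatrix M π s s' * (X s' ^ 2 - η s') := by
    intro s
    have e1 : ∑ s', stateMatrix M π s s' * (X s' ^ 2 - η s') =
        ∑ a, π.prob s a * ∑ s', M.P s a s' * (X s' ^ 2 - η s') := by
      simp_rw [stateMatrix, Matrix.of_apply, Finset.sum_mul, Finset.mul_sum]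
      rw [Finset.sum_comm]
      simp_rw [mul_assoc]
    have e2 : η s + (2 * U s - X s ^ 2) =
        ∑ a, π.prob s a * (η s + (x (s, a) - X s) ^ 2 + x (s, a) ^ 2) := by
      simp_rw [mul_add, Finset.sum_add_distrib, ← Finset.sum_mul, π.prob_sum]
      rw [sum_prob_sub_sq]
      change _ = _ + U s
      ring
    rw [e1, e2, ← Finset.sum_add_distrib, Finset.mul_sum]
    refine Finset.sum_le_sum fun a _ => ?_
    have := mul_le_mul_of_nonneg_left (h1 s a) (π.prob_nonneg s a)
    nlinarith [this]
  -- The flow identity moves the sum over next states back to the weights k, so that everything but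
  -- a factor 1-γ cancels.
  have h3 : ∑ s, k s * (M.γ * ∑ s', stateMatrix M π s s' * (X s' ^ 2 - η s')) =
      ∑ s', (k s' - (1 - M.γ) * ρ s' + (1 - M.γ) * g * ν s') * (X s' ^ 2 - η s') := by
    simp_rw [Finset.mul_sum]
    rw [Finset.sum_comm]
    refine Finset.sum_congr rfl fun s' _ => ?_
    rw [← hflow s', Finset.mul_sum, Finset.sum_mul]
    exact Finset.sum_congr rfl fun s _ => by ring
  have h4 : ∑ s, k s * (2 * U s - M.γ * (η s + (2 * U s - X s ^ 2))) -
      ∑ s, k s * (M.γ * ∑ s', stateMatrix M π s s' * (X s' ^ 2 - η s')) ≤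
      2 * bellmanForm M π k π.prob x := by
    rw [← Finset.sum_sub_distrib, bellmanForm, Finset.mul_sum]
    refine Finset.sum_le_sum fun s _ => ?_
    have e : ∑ a, π.prob s a * (x (s, a) ^ 2 - M.γ * (x (s, a) * nextMean M π x s a)) =
        U s - M.γ * ∑ a, π.prob s a * (x (s, a) * nextMean M π x s a) := by
      rw [hU, polSq, Finset.mul_sum, ← Finset.sum_sub_distrib]
      exact Finset.sum_congr rfl fun a _ => by ring
    rw [e]
    have := mul_le_mul_of_nonneg_left (mul_le_mul_of_nonneg_left (h2 s) M.γ_nonneg) (hk s)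
    nlinarith [this]
  have h5 : 0 ≤ (1 - M.γ) * ∑ s, ρ s * (X s ^ 2 - η s) :=
    mul_nonneg (by linarith) (Finset.sum_nonneg fun s _ => mul_nonneg (hρ s) (by linarith [hη s]))
  rw [h3] at h4
  refine le_trans ?_ h4
  rw [Finset.mul_sum, Finset.mul_sum, ← Finset.sum_sub_distrib, ← Finset.sum_sub_distrib]
  rw [Finset.mul_sum] at h5
  rw [← sub_nonneg, ← Finset.sum_sub_distrib]
  refine h5.trans (Finset.sum_le_sum fun s _ => le_of_eq ?_)
  ring

/-- For 0 ≤ ε ≤ 1 both coefficients are nonnegative, so the on-policy part inherits the dissipation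
of π and only the part weighted by 1-π needs a separate bound. -/
theorem perturb_eq (π : Policy S A) (ε : ℝ) (s : S) (a : A) :
    perturb π ε s a = (1 - ε * (1 - (Fintype.card A : ℝ)⁻¹)) * π.prob s a +
      ε * (Fintype.card A : ℝ)⁻¹ * (1 - π.prob s a) := by
  rw [perturb]; ring

/-- Sum over the off-policy part of the action-exploration. -/
def offSum (π : Policy S A) (k : S → ℝ) (y : S × A → ℝ) : ℝ :=
  (Fintype.card A : ℝ)⁻¹ * ∑ s, k s * ∑ a, (1 - π.prob s a) * y (s, a)

/-- With U the second moment and X the mean under π, X² ≤ U, e ≤ 1 and eX² ≤ η give (1+e)U ≤ 2U - X²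
+ η, so η becomes an extra rate e on the energy. The off-policy squares enter with factor 2 ≥ 1+e;
the offset for γ < 1 is the subtracted loss. -/
theorem bellmanForm_perturb (M : MDP S A) (π : Policy S A) {k ρ ν η e : S → ℝ} {g ε : ℝ}
    (x : S × A → ℝ) (hk : ∀ s, 0 ≤ k s) (hρ : ∀ s, 0 ≤ ρ s) (hν : ∀ s, 0 ≤ ν s) (hg : 0 ≤ g)
    (hflow : Flow M π k ρ ν g)
    (hη : ∀ s, η s ≤ polMean π x s ^ 2)
    (hstep : ∀ s a s', η s' ≤ η s + (x (s, a) - polMean π x s) ^ 2 +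
      (x (s, a) - polMean π x s') ^ 2)
    (he1 : ∀ s, e s ≤ 1) (heη : ∀ s, e s * polMean π x s ^ 2 ≤ η s)
    (hε0 : 0 ≤ ε) (hε1 : ε ≤ 1) :
    (1 - M.γ) * (∑ s, (1 + e s) * stateEnergy k (perturb π ε) x s -
        g * ∑ s, ν s * (polMean π x s ^ 2 - η s)) -
      2 * ε * M.γ * (offSum π k (fun z => x z * nextMean M π x z.1 z.2) -
        offSum π k (fun z => x z ^ 2)) ≤
      2 * bellmanForm M π k (perturb π ε) x := by
  have hγ := M.γ_lt_one
  have hpot := bellmanForm_potential M π x hk hρ hflow hη hstep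
  set r := (Fintype.card A : ℝ)⁻¹ with hr
  have hr0 : 0 ≤ r := by positivity
  have hr1 : r ≤ 1 := Nat.cast_inv_le_one _
  have hε' : 0 ≤ 1 - ε * (1 - r) := by nlinarith
  have hε'1 : 1 - ε * (1 - r) ≤ 1 := by nlinarith
  set Sx : S → ℝ := fun s => r * (k s * ∑ a, (1 - π.prob s a) * x (s, a) ^ 2) with hSx
  have hSx0 : ∀ s, 0 ≤ Sx s := fun s => mul_nonneg hr0 (mul_nonneg (hk s)
    (Finset.sum_nonneg fun a _ => mul_nonneg (by linarith [π.prob_le_one s a]) (sq_nonneg _)))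
  have hE : ∀ s, stateEnergy k (perturb π ε) x s =
      (1 - ε * (1 - r)) * (k s * polSq π x s) + ε * Sx s := by
    intro s
    simp only [stateEnergy, polSq, hSx, Finset.mul_sum, ← Finset.sum_add_distrib]
    refine Finset.sum_congr rfl fun a _ => ?_
    rw [perturb_eq, ← hr]; ring
  have hB : bellmanForm M π k (perturb π ε) x =
      (1 - ε * (1 - r)) * bellmanForm M π k π.prob x +
        ε * (offSum π k (fun z => x z ^ 2) -
          M.γ * offSum π k (fun z => x z * nextMean M π x z.1 z.2)) := by
    simp only [bellmanForm, offSum, Finset.mul_sum, ← Finset.sum_add_distrib,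
      ← Finset.sum_sub_distrib, ← hr]
    refine Finset.sum_congr rfl fun s _ => Finset.sum_congr rfl fun a _ => ?_
    rw [perturb_eq, ← hr]; ring
  have hS : offSum π k (fun z => x z ^ 2) = ∑ s, Sx s := by
    simp only [offSum, hSx, ← hr, Finset.mul_sum]
  have hB1 : 0 ≤ ∑ s, ν s * (polMean π x s ^ 2 - η s) :=
    Finset.sum_nonneg fun s _ => mul_nonneg (hν s) (by linarith [hη s])
  have h1 : ∑ s, (1 + e s) * stateEnergy k (perturb π ε) x s ≤
      (1 - ε * (1 - r)) * ∑ s, k s * (2 * polSq π x s - polMean π x s ^ 2 + η s) +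
        2 * ε * ∑ s, Sx s := by
    rw [Finset.mul_sum, Finset.mul_sum, ← Finset.sum_add_distrib]
    refine Finset.sum_le_sum fun s _ => ?_
    rw [hE]
    have a1 := polMean_sq_le π x s
    have a2 : (1 + e s) * polSq π x s ≤ 2 * polSq π x s - polMean π x s ^ 2 + η s := by
      nlinarith [he1 s, heη s]
    have a3 := mul_le_mul_of_nonneg_left (mul_le_mul_of_nonneg_left a2 (hk s)) hε'
    have a4 : ε * Sx s * (1 + e s) ≤ ε * Sx s * 2 :=
      mul_le_mul_of_nonneg_left (by linarith [he1 s]) (mul_nonneg hε0 (hSx0 s))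
    nlinarith [a3, a4]
  have h2 := mul_le_mul_of_nonneg_left hpot hε'
  have h3 := mul_le_mul_of_nonneg_left h1 (by linarith : (0:ℝ) ≤ 1 - M.γ)
  have h4 : (1 - ε * (1 - r)) * ((1 - M.γ) * g * ∑ s, ν s * (polMean π x s ^ 2 - η s)) ≤
      (1 - M.γ) * g * ∑ s, ν s * (polMean π x s ^ 2 - η s) :=
    mul_le_of_le_one_left (mul_nonneg (mul_nonneg (by linarith) hg) hB1) hε'1
  rw [hB, hS]
  linarith [h2, h3, h4]

theorem nextMean_sq_le (M : MDP S A) (π : Policy S A) (x : S × A → ℝ) {u : ℝ}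
    (hu : ∀ s, polMean π x s ^ 2 ≤ u) (s : S) (a : A) : nextMean M π x s a ^ 2 ≤ u := by
  have h := Finset.sum_mul_sq_le_sq_mul_sq Finset.univ (fun s' => √(M.P s a s'))
    (fun s' => √(M.P s a s') * polMean π x s')
  have e1 : ∀ s', √(M.P s a s') * (√(M.P s a s') * polMean π x s') =
      M.P s a s' * polMean π x s' := fun s' => by
    rw [← mul_assoc, Real.mul_self_sqrt (M.P_nonneg s a s')]
  have e2 : ∀ s', √(M.P s a s') ^ 2 = M.P s a s' := fun s' => Real.sq_sqrt (M.P_nonneg s a s')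
  simp_rw [e1, mul_pow, e2, M.P_sum, one_mul] at h
  refine h.trans ?_
  calc ∑ s', M.P s a s' * polMean π x s' ^ 2 ≤ ∑ s', M.P s a s' * u :=
        Finset.sum_le_sum fun s' _ => mul_le_mul_of_nonneg_left (hu s') (M.P_nonneg s a s')
    _ = u := by rw [← Finset.sum_mul, M.P_sum, one_mul]

/-- Young's inequality xy ≤ tx² + y²/(4t), with y² ≤ u. One unit of tx² is cancelled by the
subtracted squares; the excess t-1 is paid by v. The weights 1-π sum to |A|-1, whence the factor 1 -
1/|A|. -/
theorem offSum_sub_le [Nonempty A] (M : MDP S A) (π : Policy S A) {k : S → ℝ} {p u v t : ℝ}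
    (x : S × A → ℝ)
    (hk : ∀ s, 0 ≤ k s) (hp : ∑ s, k s = p) (hu : ∀ s, polMean π x s ^ 2 ≤ u)
    (hv : ∀ s, actSq x s - polSq π x s ≤ v) (ht : 1 ≤ t) :
    offSum π k (fun z => x z * nextMean M π x z.1 z.2) - offSum π k (fun z => x z ^ 2) ≤
      p * ((t - 1) * (Fintype.card A : ℝ)⁻¹ * v +
        (1 - (Fintype.card A : ℝ)⁻¹) * u / (4 * t)) := by
  set r := (Fintype.card A : ℝ)⁻¹ with hr
  have hA : (0 : ℝ) < Fintype.card A := by exact_mod_cast Fintype.card_pos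
  have hr0 : 0 ≤ r := by positivity
  have hrA : r * Fintype.card A = 1 := inv_mul_cancel₀ hA.ne'
  have h1 : ∀ s, ∑ a, (1 - π.prob s a) * (x (s, a) * nextMean M π x s a) -
      ∑ a, (1 - π.prob s a) * x (s, a) ^ 2 ≤
      (t - 1) * v + (Fintype.card A - 1) * (u / (4 * t)) := by
    intro s
    have b : ∀ a, (1 - π.prob s a) * (x (s, a) * nextMean M π x s a) -
        (1 - π.prob s a) * x (s, a) ^ 2 ≤
        (t - 1) * (x (s, a) ^ 2 - π.prob s a * x (s, a) ^ 2) +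
          (1 - π.prob s a) * (u / (4 * t)) := by
      intro a
      have c1 : x (s, a) * nextMean M π x s a ≤ t * x (s, a) ^ 2 + u / (4 * t) := by
        have c2 := nextMean_sq_le M π x hu s a
        have c3 : nextMean M π x s a ^ 2 / (4 * t) ≤ u / (4 * t) := by gcongr
        have c4 : t * x (s, a) ^ 2 + nextMean M π x s a ^ 2 / (4 * t) -
            x (s, a) * nextMean M π x s a =
            (2 * t * x (s, a) - nextMean M π x s a) ^ 2 / (4 * t) := by
          field_simp; ring
        have c5 : 0 ≤ (2 * t * x (s, a) - nextMean M π x s a) ^ 2 / (4 * t) := by positivity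
        linarith
      have := mul_le_mul_of_nonneg_left c1 (by linarith [π.prob_le_one s a] :
        (0:ℝ) ≤ 1 - π.prob s a)
      linarith
    rw [← Finset.sum_sub_distrib]
    refine (Finset.sum_le_sum fun a _ => b a).trans ?_
    rw [Finset.sum_add_distrib, ← Finset.mul_sum, ← Finset.sum_mul, Finset.sum_sub_distrib,
      Finset.sum_sub_distrib, π.prob_sum, Finset.sum_const, Finset.card_univ, nsmul_eq_mul, mul_one]
    have := mul_le_mul_of_nonneg_left (hv s) (by linarith : 0 ≤ t - 1)
    unfold actSq polSq at this
    linarith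
  rw [offSum, offSum, ← mul_sub, ← Finset.sum_sub_distrib]
  calc r * ∑ s, (k s * ∑ a, (1 - π.prob s a) * (x (s, a) * nextMean M π x s a) -
        k s * ∑ a, (1 - π.prob s a) * x (s, a) ^ 2)
      ≤ r * ∑ s, k s * ((t - 1) * v + (Fintype.card A - 1) * (u / (4 * t))) := by
        refine mul_le_mul_of_nonneg_left (Finset.sum_le_sum fun s _ => ?_) hr0
        rw [← mul_sub]
        exact mul_le_mul_of_nonneg_left (h1 s) (hk s)
    _ = p * ((t - 1) * r * v + (r * Fintype.card A - r) * u / (4 * t)) := by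
        rw [← Finset.sum_mul, hp]; ring
    _ = _ := by rw [hrA]

end

end CTD

/-! ### Construction of the potentials. -/

namespace CTD

set_option linter.unusedSectionVars false

noncomputable section

variable {S A : Type*} [Fintype S] [Fintype A]

/-- The potential is the least cost of climbing to y(s) along a chain of states, paying the square
of the first value and half the square of each later increment. Like resistances in series, a chain
of j states costs at least y²/(1 + 2(j-1)). The states are inserted by increasing y. -/
theorem exists_chain_potential (y : S → ℝ) (hy : ∀ s, 0 ≤ y s) (F : Finset S) :
    ∃ η : S → ℝ, ∀ s ∈ F, 0 ≤ η s ∧ η s ≤ y s ^ 2 ∧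
      (2 * (F.card : ℝ) - 1)⁻¹ * y s ^ 2 ≤ η s ∧
      ∀ s' ∈ F, η s' ≤ η s + (y s - y s') ^ 2 / 2 := by
  classical
  induction F using Finset.induction_on_max_value y with
  | empty => exact ⟨0, by simp⟩
  | insert a F ha hmax ih =>
    obtain ⟨η, hη⟩ := ih
    -- `none` stands for the chain that starts at a, `some s` for a chain whose previous state is s;
    -- the minimiser o gives the potential at a.
    set v : Option S → ℝ := fun o => o.elim (y a ^ 2) fun s => η s + (y a - y s) ^ 2 / 2 with hv
    obtain ⟨o, ho, hmin⟩ := (Finset.insertNone F).exists_min_image v ⟨none, by simp⟩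
    have hmin1 : v o ≤ y a ^ 2 := hmin none (by simp)
    have hmin2 : ∀ s ∈ F, v o ≤ η s + (y a - y s) ^ 2 / 2 := fun s hs => hmin (some s) (by simpa)
    have hn : ∀ s ∈ F, s ≠ a := fun s hs h => ha (h ▸ hs)
    have hcard : ((insert a F).card : ℝ) = F.card + 1 := by
      rw [Finset.card_insert_of_notMem ha]; push_cast; ring
    set j : ℝ := (F.card : ℝ) with hj
    have hj0 : 0 ≤ j := by positivity
    have hinv : (2 * (j + 1) - 1)⁻¹ ≤ 1 := inv_le_one_of_one_le₀ (by linarith)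
    have hinv0 : 0 ≤ (2 * (j + 1) - 1)⁻¹ := inv_nonneg.2 (by linarith)
    have hvo : 0 ≤ v o ∧ (2 * (j + 1) - 1)⁻¹ * y a ^ 2 ≤ v o ∧
        ∀ s ∈ F, η s ≤ v o + (y a - y s) ^ 2 / 2 := by
      cases o with
      | none =>
        refine ⟨sq_nonneg _, mul_le_of_le_one_left (sq_nonneg _) hinv, fun s hs => ?_⟩
        have h1 := (hη s hs).2.1
        have h2 := pow_le_pow_left₀ (hy s) (hmax s hs) 2
        have h3 := sq_nonneg (y a - y s)
        simp only [hv, Option.elim]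
        linarith
      | some s0 =>
        have hs0 : s0 ∈ F := by simpa using ho
        have hj1 : 1 ≤ j := by
          rw [hj]; exact_mod_cast Finset.card_pos.2 ⟨s0, hs0⟩
        obtain ⟨b0, b1, b2, b3⟩ := hη s0 hs0
        simp only [hv, Option.elim]
        refine ⟨by positivity, ?_, fun s hs => ?_⟩
        · refine le_trans ?_ (add_le_add_left b2 _)
          have e1 : 2 * (j + 1) - 1 = 2 * j + 1 := by ring
          have p1 : 0 < 2 * j - 1 := by linarith
          have p2 : 0 < 2 * j + 1 := by linarith
          rw [e1, ← sub_nonneg]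
          -- Minimise over y(s0): the resistances 2j-1 and 2 add up to 2j+1.
          have : (2 * j - 1)⁻¹ * y s0 ^ 2 + (y a - y s0) ^ 2 / 2 - (2 * j + 1)⁻¹ * y a ^ 2 =
              ((2 * j - 1) * y a - (2 * j + 1) * y s0) ^ 2 / (2 * (2 * j - 1) * (2 * j + 1)) := by
            field_simp; ring
          rw [this]; positivity
        -- Both y(s) and y(s0) lie below y(a), so the square of their difference is at most the sum
        -- of the squares of their distances to y(a).
        · have c1 := b3 s hs
          have c2 := hmax s hs
          have c3 := hmax s0 hs0
          nlinarith [mul_nonneg (sub_nonneg.2 c2) (sub_nonneg.2 c3), sq_nonneg (y a - y s0),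
            sq_nonneg (y a - y s)]
    obtain ⟨w1, w2, w3⟩ := hvo
    refine ⟨fun s => if s = a then v o else η s, fun s hs => ?_⟩
    rw [hcard]
    rcases Finset.mem_insert.1 hs with rfl | hsF
    · refine ⟨by simpa using w1, by simpa using hmin1, by simpa using w2, fun s' hs' => ?_⟩
      rcases Finset.mem_insert.1 hs' with rfl | hs'
      · simp
      · simpa [hn s' hs'] using w3 s' hs'
    · obtain ⟨b0, b1, b2, b3⟩ := hη s hsF
      have hj1 : 1 ≤ j := by
        rw [hj]; exact_mod_cast Finset.card_pos.2 ⟨s, hsF⟩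
      have b4 : (2 * (j + 1) - 1)⁻¹ * y s ^ 2 ≤ (2 * j - 1)⁻¹ * y s ^ 2 :=
        mul_le_mul_of_nonneg_right (inv_anti₀ (by linarith) (by linarith)) (sq_nonneg _)
      simp only [hn s hsF, if_false]
      refine ⟨b0, b1, b4.trans b2, fun s' hs' => ?_⟩
      rcases Finset.mem_insert.1 hs' with rfl | hs'
      · simp only [if_true]
        refine (hmin2 s hsF).trans (le_of_eq ?_)
        ring
      · simpa [hn s' hs'] using b3 s' hs'

/-- The right side is least at the midpoint of a and b. This is how a potential built from the means
|X| alone serves every action value x. -/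
theorem half_abs_sub_sq_le (x a b : ℝ) :
    (|a| - |b|) ^ 2 / 2 ≤ (x - a) ^ 2 + (x - b) ^ 2 := by
  have h1 : (|a| - |b|) ^ 2 ≤ (a - b) ^ 2 := sq_le_sq.2 (abs_abs_sub_abs_le_abs_sub a b)
  nlinarith [sq_nonneg (2 * x - a - b)]

/-- The dominant state s₀ is added to a potential on the other states. Its value is again a minimum
over predecessors, but over pairs (s, a) with the actual value x(s, a), instead of the worst
midpoint. If these values are far from X(s₀), the retained fraction β is much better than that of a
chain. -/
theorem exists_extended_potential (π : Policy S A) (x : S × A → ℝ) (s₀ : S) {c β : ℝ}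
    {η : S → ℝ} (hmax : ∀ s, polMean π x s ^ 2 ≤ polMean π x s₀ ^ 2)
    (hη : ∀ s ≠ s₀, η s ≤ polMean π x s ^ 2)
    (hc0 : 0 ≤ c) (hcη : ∀ s ≠ s₀, c * polMean π x s ^ 2 ≤ η s)
    (hstep : ∀ s ≠ s₀, ∀ s' ≠ s₀,
      η s' ≤ η s + (|polMean π x s| - |polMean π x s'|) ^ 2 / 2)
    (hβ1 : β ≤ 1)
    (hβ : ∀ s ≠ s₀, ∀ a, β * polMean π x s₀ ^ 2 ≤
      c / (1 + c) * x (s, a) ^ 2 + (x (s, a) - polMean π x s₀) ^ 2) :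
    ∃ η' : S → ℝ, (∀ s ≠ s₀, η' s = η s) ∧ (∀ s, η' s ≤ polMean π x s ^ 2) ∧
      (∀ s a s', η' s' ≤ η' s + (x (s, a) - polMean π x s) ^ 2 +
        (x (s, a) - polMean π x s') ^ 2) ∧
      β * polMean π x s₀ ^ 2 ≤ η' s₀ := by
  classical
  set X := polMean π x with hX
  set v : Option (S × A) → ℝ := fun o => o.elim (X s₀ ^ 2) fun z =>
    η z.1 + (x z - X z.1) ^ 2 + (x z - X s₀) ^ 2 with hv
  set F : Finset (S × A) := Finset.univ.filter fun z => z.1 ≠ s₀ with hF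
  obtain ⟨o, ho, hmin⟩ := (Finset.insertNone F).exists_min_image v ⟨none, by simp⟩
  have hmin1 : v o ≤ X s₀ ^ 2 := hmin none (by simp)
  have hmin2 : ∀ s ≠ s₀, ∀ a, v o ≤ η s + (x (s, a) - X s) ^ 2 + (x (s, a) - X s₀) ^ 2 :=
    fun s hs a => hmin (some (s, a)) (by simpa [hF] using hs)
  have hvo : β * X s₀ ^ 2 ≤ v o ∧ ∀ s ≠ s₀, η s ≤ v o + (|X s₀| - |X s|) ^ 2 / 2 := by
    cases o with
    | none =>
      refine ⟨mul_le_of_le_one_left (sq_nonneg _) hβ1, fun s hs => ?_⟩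
      have h1 := (hη s hs).trans (hmax s)
      have h2 := sq_nonneg (|X s₀| - |X s|)
      simp only [hv, Option.elim]
      linarith
    | some z =>
      obtain ⟨s1, a1⟩ := z
      have hz : s1 ≠ s₀ := by simpa [hF] using ho
      simp only [hv, Option.elim]
      constructor
      · refine (hβ s1 hz a1).trans ?_
        have h1 := hcη s1 hz
        -- Minimisation over the mean X(s1), which turns the coefficient c into c/(1+c).
        have : c * X s1 ^ 2 + (x (s1, a1) - X s1) ^ 2 - c / (1 + c) * x (s1, a1) ^ 2 =
            ((1 + c) * X s1 - x (s1, a1)) ^ 2 / (1 + c) := by field_simp; ring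
        have : 0 ≤ ((1 + c) * X s1 - x (s1, a1)) ^ 2 / (1 + c) := by positivity
        linarith
      · intro s hs
        have h1 := hstep s1 hz s hs
        have h2 := half_abs_sub_sq_le (x (s1, a1)) (X s1) (X s₀)
        have h3 : |X s1| ≤ |X s₀| := sq_le_sq.1 (hmax s1)
        have h4 : |X s| ≤ |X s₀| := sq_le_sq.1 (hmax s)
        nlinarith [mul_nonneg (sub_nonneg.2 h3) (sub_nonneg.2 h4), sq_nonneg (|X s₀| - |X s|),
          sq_nonneg (|X s₀| - |X s1|)]
  refine ⟨fun s => if s = s₀ then v o else η s, fun s hs => by simp [hs], fun s => ?_, ?_, ?_⟩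
  · by_cases hs : s = s₀
    · subst hs; simpa using hmin1
    · simpa [hs] using hη s hs
  · intro s a s'
    by_cases hs : s = s₀ <;> by_cases hs' : s' = s₀
    · subst hs; subst hs'
      simp only [if_true]
      nlinarith [sq_nonneg (x (s', a) - X s')]
    · subst hs
      simp only [if_true, hs', if_false]
      have h1 := hvo.2 s' hs'
      have h2 := half_abs_sub_sq_le (x (s, a)) (X s) (X s')
      linarith
    · subst hs'
      simp only [if_true, hs, if_false]
      exact hmin2 s hs a
    · simp only [hs, hs', if_false]
      have h1 := hstep s hs s' hs'
      have h2 := half_abs_sub_sq_le (x (s, a)) (X s) (X s')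
      linarith
  · simpa using hvo.1

end

end CTD

/-! ### Splittings of the state weights, and the loss due to action exploration. -/

namespace CTD

set_option linter.unusedSectionVars false

noncomputable section

variable {S A : Type*} [Fintype S] [Fintype A]

/-- A splitting `κ = k + g κ'` of a distribution on the states into a truncated discounted
visitation `k` and a remainder of mass `g`, together with an exploration parameter `ε`. -/
structure Splitting (M : MDP S A) (π : Policy S A) (ε : ℝ) where
  k : S → ℝ
  ρ : S → ℝ
  ν : S → ℝ
  rest : S → ℝ
  g : ℝ
  α : ℝ
  k_nonneg : ∀ s, 0 ≤ k s
  ρ_nonneg : ∀ s, 0 ≤ ρ s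
  ν_nonneg : ∀ s, 0 ≤ ν s
  rest_nonneg : ∀ s, 0 ≤ rest s
  k_sum : ∑ s, k s = 1 - g
  ν_sum : ∑ s, ν s = 1
  rest_sum : ∑ s, rest s = 1
  flow : Flow M π k ρ ν g
  g_nonneg : 0 ≤ g
  α_le : ∀ s, α ≤ k s + g * rest s
  ε_nonneg : 0 ≤ ε
  ε_le : ε ≤ (1 - M.γ) * α / 4

/-- The optimal constant `β` with `β ≤ c y² + (1 - y)²` for all `|y| ≤ r`. -/
def betaFn (c r : ℝ) : ℝ := if r ≤ 1 / (1 + c) then (1 - r) ^ 2 + c * r ^ 2 else c / (1 + c)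

/-- Bound on the relative cost of the action-exploration. -/
def phiFn (r : ℝ) : ℝ := min (1 / 4) (12 / 125 + r ^ 2 / 4)

theorem phiFn_nonneg (r : ℝ) : 0 ≤ phiFn r := le_min (by norm_num) (by positivity)

theorem betaFn_le_one {c r : ℝ} (hc : 0 ≤ c) (hr : 0 ≤ r) : betaFn c r ≤ 1 := by
  unfold betaFn
  split_ifs with h
  · rw [le_div_iff₀ (by linarith)] at h
    nlinarith
  · rw [div_le_one (by linarith)]; linarith

theorem betaFn_mul_le {c r x X : ℝ} (hc : 0 ≤ c) (hr : 0 ≤ r) (h : x ^ 2 ≤ r ^ 2 * X ^ 2 ∨ r = 1) :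
    betaFn c r * X ^ 2 ≤ c * x ^ 2 + (x - X) ^ 2 := by
  have key : c / (1 + c) * X ^ 2 ≤ c * x ^ 2 + (x - X) ^ 2 := by
    have e : c * x ^ 2 + (x - X) ^ 2 - c / (1 + c) * X ^ 2 =
        ((1 + c) * x - X) ^ 2 / (1 + c) := by field_simp; ring
    have : 0 ≤ ((1 + c) * x - X) ^ 2 / (1 + c) := by positivity
    linarith
  unfold betaFn
  split_ifs with h1
  · rw [le_div_iff₀ (by linarith)] at h1
    rcases h with h | h
    · have h2 : |x| ≤ r * |X| := by
        rw [← abs_of_nonneg hr, ← abs_mul]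
        exact sq_le_sq.1 (by rw [mul_pow]; exact h)
      have h3 : x * X ≤ |x| * |X| := by rw [← abs_mul]; exact le_abs_self _
      have h4 : 0 ≤ (r * |X| - |x|) * (2 * |X| - (1 + c) * (|x| + r * |X|)) := by
        refine mul_nonneg (by linarith) ?_
        nlinarith [abs_nonneg X, abs_nonneg x]
      have e : c * x ^ 2 + (x - X) ^ 2 = (1 + c) * |x| ^ 2 - 2 * (x * X) + |X| ^ 2 := by
        rw [sq_abs, sq_abs]; ring
      rw [e, ← sq_abs X]
      linarith
    -- For r = 1 nothing is known about x, but this branch of the definition then forces c = 0.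
    · subst h
      have : c = 0 := by linarith
      subst this
      nlinarith [sq_nonneg (x - X)]
  · exact key

/-- Compares the defects X² - η: away from the dominant state the defect is at most (1-c)r²X(s₀)²,
so the bound (1-β)X(s₀)² valid at s₀ holds everywhere. -/
theorem one_sub_mul_sq_le_one_sub_betaFn {c r : ℝ} (hc : 0 ≤ c) (hr : 0 ≤ r) (hr1 : r ≤ 1) :
    (1 - c) * r ^ 2 ≤ 1 - betaFn (c / (1 + c)) r := by
  unfold betaFn
  have hd : c / (1 + c) * (1 + c) = c := div_mul_cancel₀ _ (by linarith)
  have hd0 : 0 ≤ c / (1 + c) := by positivity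
  set d := c / (1 + c) with hdd
  have hdc : d ≤ c := by nlinarith
  split_ifs with h
  · rw [le_div_iff₀ (by linarith)] at h
    nlinarith [mul_nonneg hr (sub_nonneg.2 hr1), mul_nonneg hr hc, mul_nonneg hr hd0,
      mul_nonneg (mul_nonneg hr hc) hr]
  · have e : 1 - d / (1 + d) = 1 / (1 + d) := by field_simp; ring
    rw [e, le_div_iff₀ (by linarith)]
    have h1 : r ^ 2 ≤ 1 := by nlinarith
    by_cases h2 : c ≤ 1
    · have : (1 - c) * r ^ 2 ≤ 1 - c := mul_le_of_le_one_right (by linarith) h1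
      nlinarith
    · nlinarith [sq_nonneg r]

namespace Splitting

variable {M : MDP S A} {π : Policy S A} {ε : ℝ} (D : Splitting M π ε)
include D

theorem card_mul_α_le : Fintype.card S * D.α ≤ 1 := by
  have h : ∑ _s : S, D.α ≤ ∑ s, (D.k s + D.g * D.rest s) := Finset.sum_le_sum fun s _ => D.α_le s
  rw [Finset.sum_add_distrib, ← Finset.mul_sum, D.k_sum, D.rest_sum, Finset.sum_const,
    Finset.card_univ, nsmul_eq_mul] at h
  linarith

theorem α_nonneg : 0 ≤ D.α := by
  have h1 := D.ε_nonneg.trans D.ε_le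
  have h2 : 0 < 1 - M.γ := sub_pos.2 M.γ_lt_one
  by_contra h
  push Not at h
  nlinarith

theorem rest_le_one (s : S) : D.rest s ≤ 1 := by
  rw [← D.rest_sum]
  exact Finset.single_le_sum (fun s _ => D.rest_nonneg s) (Finset.mem_univ s)

end Splitting

theorem perturb_nonneg (π : Policy S A) {ε : ℝ} (h0 : 0 ≤ ε) (h1 : ε ≤ 1) (s : S) (a : A) :
    0 ≤ perturb π ε s a :=
  add_nonneg (mul_nonneg (by linarith) (π.prob_nonneg s a)) (by positivity)

theorem sum_perturb [Nonempty A] (π : Policy S A) (ε : ℝ) (s : S) :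
    ∑ a, perturb π ε s a = 1 := by
  have : (Fintype.card A : ℝ) ≠ 0 := by exact_mod_cast Fintype.card_ne_zero
  simp only [perturb, Finset.sum_add_distrib, ← Finset.mul_sum, π.prob_sum, Finset.sum_const,
    Finset.card_univ, nsmul_eq_mul]
  field_simp
  ring

theorem sum_perturb_sq (π : Policy S A) (ε : ℝ) (x : S × A → ℝ) (s : S) :
    ∑ a, perturb π ε s a * x (s, a) ^ 2 =
      (1 - ε) * polSq π x s + ε * (Fintype.card A : ℝ)⁻¹ * actSq x s := by
  simp only [perturb, polSq, actSq, Finset.mul_sum, ← Finset.sum_add_distrib]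
  exact Finset.sum_congr rfl fun a _ => by ring

theorem sum_perturb_sq_ge (π : Policy S A) {ε : ℝ} (h0 : 0 ≤ ε) (x : S × A → ℝ) (s : S) :
    (1 - ε) * polSq π x s ≤ ∑ a, perturb π ε s a * x (s, a) ^ 2 := by
  rw [sum_perturb_sq]
  have := actSq_nonneg x s
  have : 0 ≤ ε * (Fintype.card A : ℝ)⁻¹ * actSq x s := by positivity
  linarith

theorem sum_perturb_sq_le_actSq [Nonempty A] (π : Policy S A) {ε : ℝ} (h0 : 0 ≤ ε) (h1 : ε ≤ 1)
    (x : S × A → ℝ) (s : S) : ∑ a, perturb π ε s a * x (s, a) ^ 2 ≤ actSq x s :=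
  Finset.sum_le_sum fun a _ => mul_le_of_le_one_left (sq_nonneg _) <| by
    rw [← sum_perturb π ε s]
    exact Finset.single_le_sum (fun a _ => perturb_nonneg π h0 h1 s a) (Finset.mem_univ a)

theorem polSq_eq_actSq_of_card_le_one (hA : Fintype.card A ≤ 1) (π : Policy S A) (x : S × A → ℝ)
    (s : S) : polSq π x s = actSq x s := by
  have := Fintype.card_le_one_iff_subsingleton.1 hA
  refine Finset.sum_congr rfl fun a _ => ?_
  have h : π.prob s a = 1 := by
    rw [← π.prob_sum s]
    exact (Fintype.sum_subsingleton _ a).symm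
  rw [h, one_mul]

/-- With one action the perturbation does nothing. With at least two, 1/|A| ≤ 1/2, and the second
moment lost by mixing pays for the explored squares up to the excess of v over u. -/
theorem sum_perturb_sq_le [Nonempty A] (π : Policy S A) {ε : ℝ} (h0 : 0 ≤ ε) (h1 : ε ≤ 1)
    (x : S × A → ℝ) (s : S) {u v : ℝ} (hu : u ≤ polSq π x s) (hv : actSq x s - polSq π x s ≤ v) :
    ∑ a, perturb π ε s a * x (s, a) ^ 2 ≤ polSq π x s + max (v - u) 0 := by
  rw [sum_perturb_sq]
  set r := (Fintype.card A : ℝ)⁻¹ with hr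
  have hr0 : 0 ≤ r := by positivity
  by_cases hA : Fintype.card A ≤ 1
  · have hA1 : Fintype.card A = 1 := le_antisymm hA Fintype.card_pos
    rw [← polSq_eq_actSq_of_card_le_one hA, hr, hA1]
    have := le_max_right (v - u) 0
    norm_num
    nlinarith
  · have hr2 : r ≤ 1 / 2 := by
      rw [hr, one_div]
      exact inv_anti₀ (by norm_num) (by exact_mod_cast (by omega : 2 ≤ Fintype.card A))
    have h2 := le_max_left (v - u) 0
    have h3 := le_max_right (v - u) 0
    have h4 : ε * r * (v - u) ≤ max (v - u) 0 := by
      have : ε * r * (v - u) ≤ ε * r * max (v - u) 0 := by gcongr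
      have : ε * r * max (v - u) 0 ≤ 1 * max (v - u) 0 := by
        gcongr; nlinarith
      linarith
    have h5 := polSq_nonneg π x s
    have h6 : ε * r * (actSq x s - polSq π x s) ≤ ε * r * v := by gcongr
    have h7 : ε * r * u ≤ ε * r * polSq π x s := by gcongr
    have h8 : 0 ≤ ε * polSq π x s * (1 - 2 * r) := by
      apply mul_nonneg (mul_nonneg h0 h5); linarith
    linarith

namespace Splitting

variable {M : MDP S A} {π : Policy S A} {ε : ℝ} (D : Splitting M π ε)

/-- The full distribution on the states. -/
def κ (s : S) : ℝ := D.k s + D.g * D.rest s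

include D in
theorem ε_le_quarter [Nonempty S] : 4 * Fintype.card S * ε ≤ 1 - M.γ := by
  have h1 := D.ε_le
  have h2 := D.card_mul_α_le
  have h3 : 0 < 1 - M.γ := sub_pos.2 M.γ_lt_one
  have hn : (1 : ℝ) ≤ Fintype.card S := by exact_mod_cast Fintype.card_pos
  have h4 : Fintype.card S * ε ≤ Fintype.card S * ((1 - M.γ) * D.α / 4) := by gcongr
  nlinarith

include D in
theorem ε_le_one_sub [Nonempty S] : 4 * ε ≤ 1 - M.γ := by
  have h1 := D.ε_le_quarter
  have hn : (1 : ℝ) ≤ Fintype.card S := by exact_mod_cast Fintype.card_pos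
  nlinarith [D.ε_nonneg]

include D in
theorem ε_le_one [Nonempty S] : ε ≤ 1 / 4 := by
  have h1 := D.ε_le_one_sub
  have h2 := M.γ_nonneg
  linarith

include D in
theorem γ_mul_le_sum_perturb_sq [Nonempty S] (x : S × A → ℝ) (s : S) :
    M.γ * polSq π x s ≤ ∑ a, perturb π ε s a * x (s, a) ^ 2 := by
  refine le_trans ?_ (sum_perturb_sq_ge π D.ε_nonneg x s)
  have := D.ε_le_one_sub
  have := D.ε_nonneg
  exact mul_le_mul_of_nonneg_right (by linarith) (polSq_nonneg π x s)

/-- The loss due to the action-exploration. -/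
theorem loss_le_α (x : S × A → ℝ) (s₀ : S) {φ : ℝ}
    (h : offSum π D.k (fun z => x z * nextMean M π x z.1 z.2) -
      offSum π D.k (fun z => x z ^ 2) ≤ (1 - D.g) * (φ * polMean π x s₀ ^ 2))
    (hφ : 0 ≤ (1 - D.g) * φ) :
    2 * ε * M.γ * (offSum π D.k (fun z => x z * nextMean M π x z.1 z.2) -
      offSum π D.k (fun z => x z ^ 2)) ≤
      (1 - M.γ) * ((1 - D.g) * φ / 2 * (D.α * (M.γ * polMean π x s₀ ^ 2))) := by
  have hγ := M.γ_nonneg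
  have hε := D.ε_nonneg
  have hu0 : 0 ≤ polMean π x s₀ ^ 2 := sq_nonneg _
  have h1 := mul_le_mul_of_nonneg_left h (by positivity : 0 ≤ 2 * ε * M.γ)
  have := mul_le_mul_of_nonneg_right D.ε_le (mul_nonneg hγ (mul_nonneg hφ hu0))
  linarith

/-- The least weight α is at most the full weight of s₀, and γ ≤ 1-ε, so α·γX(s₀)² is dominated by
the energy at s₀ plus the split-off mass. -/
theorem loss_le [Nonempty S] [Nonempty A] (x : S × A → ℝ) (s₀ : S) {φ : ℝ} (hφ0 : 0 ≤ φ)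
    (hg1 : D.g ≤ 1)
    (h : offSum π D.k (fun z => x z * nextMean M π x z.1 z.2) -
      offSum π D.k (fun z => x z ^ 2) ≤ (1 - D.g) * (φ * polMean π x s₀ ^ 2)) :
    2 * ε * M.γ * (offSum π D.k (fun z => x z * nextMean M π x z.1 z.2) -
      offSum π D.k (fun z => x z ^ 2)) ≤
      (1 - M.γ) * ((1 - D.g) * φ / 2 * (stateEnergy D.k (perturb π ε) x s₀ +
        D.g * polMean π x s₀ ^ 2)) := by
  have hγ := M.γ_nonneg
  have hG : 0 < 1 - M.γ := sub_pos.2 M.γ_lt_one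
  have hpφ : 0 ≤ (1 - D.g) * φ := mul_nonneg (by linarith) hφ0
  refine (D.loss_le_α x s₀ h hpφ).trans ?_
  set u := polMean π x s₀ ^ 2 with hu
  have hu0 : 0 ≤ u := sq_nonneg _
  have h3 : D.α * (M.γ * u) ≤ stateEnergy D.k (perturb π ε) x s₀ + D.g * u := by
    have a3 : M.γ * u ≤ ∑ a, perturb π ε s₀ a * x (s₀, a) ^ 2 :=
      (mul_le_mul_of_nonneg_left (polMean_sq_le π x s₀) hγ).trans (D.γ_mul_le_sum_perturb_sq x s₀)
    have a4 := mul_le_mul_of_nonneg_left a3 (D.k_nonneg s₀)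
    have a5 := mul_le_mul_of_nonneg_right (D.α_le s₀) (mul_nonneg hγ hu0)
    have a6 : D.g * D.rest s₀ * (M.γ * u) ≤ D.g * 1 * (1 * u) := by
      have := D.g_nonneg
      have := D.rest_le_one s₀
      have := D.rest_nonneg s₀
      have := M.γ_lt_one.le
      gcongr
    rw [stateEnergy]
    linarith
  have h4 := mul_le_mul_of_nonneg_left h3 (mul_nonneg hG.le hpφ)
  linarith

theorem offSum_sub_le_quarter [Nonempty A] (x : S × A → ℝ) (s₀ : S) (hg1 : D.g ≤ 1)
    (hmax : ∀ s, polMean π x s ^ 2 ≤ polMean π x s₀ ^ 2) :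
    offSum π D.k (fun z => x z * nextMean M π x z.1 z.2) -
      offSum π D.k (fun z => x z ^ 2) ≤ (1 - D.g) * (1 / 4 * polMean π x s₀ ^ 2) := by
  have hv : ∀ s, actSq x s - polSq π x s ≤ ∑ s, actSq x s := fun s => by
    have h1 := Finset.single_le_sum (fun s _ => actSq_nonneg x s) (Finset.mem_univ s)
    have h2 := polSq_nonneg π x s
    linarith
  refine (offSum_sub_le M π x D.k_nonneg D.k_sum hmax hv le_rfl).trans ?_
  refine mul_le_mul_of_nonneg_left ?_ (by linarith)
  have : 0 ≤ (Fintype.card A : ℝ)⁻¹ := by positivity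
  nlinarith [sq_nonneg (polMean π x s₀)]

/-- The uniform bound 1/4 is Young's inequality with t = 1. When the remaining squares v are small,
a larger t shifts the loss from u to v. -/
theorem offSum_sub_le_phi [Nonempty A] (x : S × A → ℝ) (s₀ : S) (hg1 : D.g ≤ 1) {r v : ℝ}
    (hmax : ∀ s, polMean π x s ^ 2 ≤ polMean π x s₀ ^ 2)
    (hv : ∀ s, actSq x s - polSq π x s ≤ v)
    (hr : r ^ 2 * polMean π x s₀ ^ 2 = min v (polMean π x s₀ ^ 2)) :
    offSum π D.k (fun z => x z * nextMean M π x z.1 z.2) -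
      offSum π D.k (fun z => x z ^ 2) ≤ (1 - D.g) * (phiFn r * polMean π x s₀ ^ 2) := by
  have h4 := D.offSum_sub_le_quarter x s₀ hg1 hmax
  set u := polMean π x s₀ ^ 2 with hu
  have hu0 : 0 ≤ u := sq_nonneg _
  have hp : 0 ≤ 1 - D.g := by linarith
  have hv0 : 0 ≤ v := (sub_nonneg.2 (polSq_le_actSq π x s₀)).trans (hv s₀)
  rw [phiFn, min_mul_of_nonneg _ _ hu0, mul_min_of_nonneg _ _ hp]
  refine le_min h4 ?_
  rcases le_total u v with h | h
  · rw [min_eq_right h] at hr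
    refine h4.trans (mul_le_mul_of_nonneg_left ?_ hp)
    nlinarith
  · rw [min_eq_left h] at hr
    set q := (Fintype.card A : ℝ)⁻¹ with hq
    have hq0 : 0 ≤ q := by positivity
    have hq1 : q ≤ 1 := Nat.cast_inv_le_one _
    have e : (12 / 125 + r ^ 2 / 4) * u = 12 / 125 * u + v / 4 := by linarith
    rw [e]
    -- The parameter t = (1-q)/(48/125) makes the u-part exactly 12/125. The v-part is then at most
    -- 1/4, its coefficient being largest at q = 77/250. If this t is below 1, already t = 1 gives a
    -- u-part of at most 12/125.
    by_cases hqs : (1 - q) / (48 / 125) ≤ 1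
    · refine (offSum_sub_le M π x D.k_nonneg D.k_sum hmax hv le_rfl).trans
        (mul_le_mul_of_nonneg_left ?_ hp)
      rw [← hq]
      rw [div_le_one (by norm_num)] at hqs
      nlinarith
    · push Not at hqs
      refine (offSum_sub_le M π x D.k_nonneg D.k_sum hmax hv hqs.le).trans
        (mul_le_mul_of_nonneg_left ?_ hp)
      rw [← hq]
      have hne : 1 - q ≠ 0 := fun h => by rw [h] at hqs; norm_num at hqs
      have e2 : (1 - q) * u / (4 * ((1 - q) / (48 / 125))) = 12 / 125 * u := by
        field_simp; ring
      rw [e2]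
      have : ((1 - q) / (48 / 125) - 1) * q ≤ 1 / 4 := by nlinarith [sq_nonneg (q - 77 / 250)]
      nlinarith

end Splitting

end

end CTD

/-! ### Dissipation around the dominant state, and the numerical criterion. -/

namespace CTD

set_option linter.unusedSectionVars false

noncomputable section

variable {S A : Type*} [Fintype S] [Fintype A]

theorem sum_ite_eq_mul_add [DecidableEq S] (f : S → ℝ) (s₀ : S) (a b : ℝ) :
    ∑ s, (1 + if s = s₀ then b else a) * f s = (1 + a) * ∑ s, f s + (b - a) * f s₀ := by
  have h : ∀ s, (1 + if s = s₀ then b else a) * f s =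
      (1 + a) * f s + if s = s₀ then (b - a) * f s else 0 := fun s => by
    split_ifs <;> ring
  simp_rw [h, Finset.sum_add_distrib, ← Finset.mul_sum]
  simp

theorem stateEnergy_nonneg {k : S → ℝ} (hk : ∀ s, 0 ≤ k s) (π : Policy S A) {ε : ℝ} (h0 : 0 ≤ ε)
    (h1 : ε ≤ 1) (x : S × A → ℝ) (s : S) : 0 ≤ stateEnergy k (perturb π ε) x s :=
  mul_nonneg (hk s) (Finset.sum_nonneg fun a _ =>
    mul_nonneg (perturb_nonneg π h0 h1 s a) (sq_nonneg _))

namespace Splitting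

variable {M : MDP S A} {π : Policy S A} {ε : ℝ} (D : Splitting M π ε)

/-- Here s₀ maximises X², and r compares the squares outside X(s₀)² with X(s₀)². A chain through the
other n-1 states gives the extra rate c ≤ 1/(2(n-1)-1) there; the extended potential gives β(r) at
s₀. The mixing hypothesis `hσ` enters only by bounding the mass g from above in terms of the
truncated energy. -/
theorem exists_dissipation [Nonempty A] (hn : 2 ≤ Fintype.card S) (hg1 : D.g ≤ 1)
    (x : S × A → ℝ) {c σ : ℝ} (hc0 : 0 ≤ c) (hc1 : c ≤ 1)
    (hc : c ≤ (2 * (Fintype.card S : ℝ) - 3)⁻¹)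
    (hσ : σ * D.g * ∑ s, actSq x s ≤ ∑ s, stateEnergy D.κ (perturb π ε) x s) :
    ∃ s₀ : S, ∃ r τ : ℝ, 0 ≤ r ∧ r ≤ 1 ∧ 0 ≤ τ ∧
      (1 - M.γ) * ((1 + c) * (∑ s, stateEnergy D.k (perturb π ε) x s -
            stateEnergy D.k (perturb π ε) x s₀) +
          (1 + betaFn (c / (1 + c)) r) * stateEnergy D.k (perturb π ε) x s₀ -
          D.g * (1 - betaFn (c / (1 + c)) r) * polMean π x s₀ ^ 2 -
          (1 - D.g) * phiFn r / 2 * (stateEnergy D.k (perturb π ε) x s₀ +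
            D.g * polMean π x s₀ ^ 2)) ≤ 2 * bellmanForm M π D.k (perturb π ε) x ∧
      D.g * ((σ * (1 + r ^ 2) - 1) * polMean π x s₀ ^ 2 + (σ - 1) * τ) ≤
        ∑ s, stateEnergy D.k (perturb π ε) x s ∧
      ∑ s, stateEnergy D.κ (perturb π ε) x s ≤ ∑ s, stateEnergy D.k (perturb π ε) x s +
        D.g * (polMean π x s₀ ^ 2 + τ) ∧
      (1 - 1 / (4 * (Fintype.card S : ℝ))) * (D.k s₀ * polMean π x s₀ ^ 2) ≤
        stateEnergy D.k (perturb π ε) x s₀ := by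
  classical
  have : Nonempty S := Fintype.card_pos_iff.1 (by omega)
  have hε0 := D.ε_nonneg
  have hε1 : ε ≤ 1 := D.ε_le_one.trans (by norm_num)
  have hG : 0 < 1 - M.γ := sub_pos.2 M.γ_lt_one
  obtain ⟨s₀, -, hs₀⟩ := Finset.exists_max_image Finset.univ (fun s => polMean π x s ^ 2)
    Finset.univ_nonempty
  have hmax : ∀ s, polMean π x s ^ 2 ≤ polMean π x s₀ ^ 2 := fun s => hs₀ s (Finset.mem_univ s)
  set u := polMean π x s₀ ^ 2 with hu
  have hu0 : 0 ≤ u := sq_nonneg _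
  set v := ∑ s, actSq x s - polSq π x s₀ with hv
  have hv1 : ∀ s ≠ s₀, actSq x s ≤ v := by
    intro s hs
    have h1 := Finset.add_le_sum (fun s _ => actSq_nonneg x s) (Finset.mem_univ s)
      (Finset.mem_univ s₀) hs
    have h2 := polSq_le_actSq π x s₀
    linarith
  have hv2 : ∀ s, actSq x s - polSq π x s ≤ v := by
    intro s
    by_cases hs : s = s₀
    · subst hs
      have := Finset.single_le_sum (fun s _ => actSq_nonneg x s) (Finset.mem_univ s)
      linarith
    · linarith [hv1 s hs, polSq_nonneg π x s]
  have hv0 : 0 ≤ v := (sub_nonneg.2 (polSq_le_actSq π x s₀)).trans (hv2 s₀)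
  -- r = √(v/u) cut off at 1; when u vanishes, r = 1 is taken, for which `betaFn` makes no
  -- assumption on the other values.
  obtain ⟨r, hr0, hr1, hru, hr⟩ : ∃ r : ℝ, 0 ≤ r ∧ r ≤ 1 ∧ r ^ 2 * u = min v u ∧
      (v ≤ r ^ 2 * u ∨ r = 1) := by
    rcases hu0.eq_or_lt with h | h
    · refine ⟨1, zero_le_one, le_rfl, ?_, Or.inr rfl⟩
      rw [← h, min_eq_right hv0]; simp
    · rcases le_total u v with h1 | h1
      · exact ⟨1, zero_le_one, le_rfl, by rw [min_eq_right h1]; ring, Or.inr rfl⟩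
      · have e : √(v / u) ^ 2 * u = v := by
          rw [Real.sq_sqrt (by positivity)]; field_simp
        exact ⟨√(v / u), Real.sqrt_nonneg _, Real.sqrt_le_one.2 ((div_le_one h).2 h1),
          by rw [min_eq_left h1, e], Or.inl e.ge⟩
  obtain ⟨η₀, hη₀⟩ := exists_chain_potential (fun s => |polMean π x s|) (fun s => abs_nonneg _)
    (Finset.univ.erase s₀)
  have hcard : ((Finset.univ.erase s₀).card : ℝ) = Fintype.card S - 1 := by
    rw [Finset.card_erase_of_mem (Finset.mem_univ _), Finset.card_univ,
      Nat.cast_sub (by omega), Nat.cast_one]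
  have hmem : ∀ s ≠ s₀, s ∈ Finset.univ.erase s₀ := fun s hs => by simp [hs]
  simp only [sq_abs, hcard] at hη₀
  set b := betaFn (c / (1 + c)) r with hb
  have hd0 : 0 ≤ c / (1 + c) := by positivity
  have hb1 : b ≤ 1 := betaFn_le_one hd0 hr0
  have hXr : ∀ s ≠ s₀, polMean π x s ^ 2 ≤ r ^ 2 * u := by
    intro s hs
    rw [hru]
    exact le_min (((polMean_sq_le π x s).trans (polSq_le_actSq π x s)).trans (hv1 s hs)) (hmax s)
  have hcη : ∀ s ≠ s₀, c * polMean π x s ^ 2 ≤ η₀ s := fun s hs => by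
    refine le_trans (mul_le_mul_of_nonneg_right ?_ (sq_nonneg _)) (hη₀ s (hmem s hs)).2.2.1
    refine hc.trans (le_of_eq ?_)
    congr 1; ring
  obtain ⟨η, hη1, hη2, hη3, hη4⟩ := exists_extended_potential π x s₀ (c := c) (β := b) hmax
    (fun s hs => (hη₀ s (hmem s hs)).2.1) hc0 hcη
    (fun s hs s' hs' => (hη₀ s (hmem s hs)).2.2.2 s' (hmem s' hs')) hb1
    (fun s hs a => betaFn_mul_le hd0 hr0 (hr.imp_left fun h =>
      ((Finset.single_le_sum (f := fun a => x (s, a) ^ 2) (fun a _ => sq_nonneg _)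
        (Finset.mem_univ a)).trans (hv1 s hs)).trans h))
  have hmain := bellmanForm_perturb M π (e := fun s => if s = s₀ then b else c) (ε := ε) x
    D.k_nonneg D.ρ_nonneg D.ν_nonneg D.g_nonneg D.flow hη2 hη3
    (fun s => by split_ifs; exacts [hb1, hc1])
    (fun s => by
      split_ifs with h
      · rw [h]; exact hη4
      · rw [hη1 s h]; exact hcη s h) hε0 hε1
  rw [sum_ite_eq_mul_add] at hmain
  have hloss := D.loss_le x s₀ (phiFn_nonneg r) hg1 (D.offSum_sub_le_phi x s₀ hg1 hmax hv2 hru)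
  have hνsum : ∑ s, D.ν s * (polMean π x s ^ 2 - η s) ≤ (1 - b) * u := by
    have h1 : ∀ s, polMean π x s ^ 2 - η s ≤ (1 - b) * u := by
      intro s
      by_cases hs : s = s₀
      · rw [hs]; linarith
      · have h2 := one_sub_mul_sq_le_one_sub_betaFn hc0 hr0 hr1
        have h3 := mul_le_mul_of_nonneg_left (hXr s hs) (sub_nonneg.2 hc1)
        have h4 := mul_le_mul_of_nonneg_right h2 hu0
        rw [hη1 s hs]
        linarith [hcη s hs]
    calc _ ≤ ∑ s, D.ν s * ((1 - b) * u) :=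
          Finset.sum_le_sum fun s _ => mul_le_mul_of_nonneg_left (h1 s) (D.ν_nonneg s)
      _ = _ := by rw [← Finset.sum_mul, D.ν_sum, one_mul]
  set K := stateEnergy D.k (perturb π ε) x s₀ with hK
  set H := ∑ s, stateEnergy D.k (perturb π ε) x s with hH
  set Z := ∑ s, stateEnergy D.κ (perturb π ε) x s with hZ
  -- Chosen so that the sum of all squares is u + τ + r²u, while u + τ bounds the second moment
  -- under the perturbed policy in every state.
  set τ := polSq π x s₀ - u + max (v - u) 0 with hτ
  have hU := polMean_sq_le π x s₀
  have hτ0 : 0 ≤ τ := add_nonneg (sub_nonneg.2 hU) (le_max_right _ _)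
  have hN : ∑ s, actSq x s = u + τ + r ^ 2 * u := by
    rw [hru, hτ]
    rcases le_total u v with h | h
    · rw [min_eq_right h, max_eq_left (sub_nonneg.2 h)]; linarith
    · rw [min_eq_left h, max_eq_right (sub_nonpos.2 h)]; linarith
  have hZ1 : Z ≤ H + D.g * (u + τ) := by
    have h1 : ∀ s, ∑ a, perturb π ε s a * x (s, a) ^ 2 ≤ u + τ := by
      intro s
      by_cases hs : s = s₀
      · rw [hs]
        refine (sum_perturb_sq_le π hε0 hε1 x s₀ hU (hv2 s₀)).trans (le_of_eq ?_)
        rw [hτ]; ring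
      · refine (sum_perturb_sq_le_actSq π hε0 hε1 x s).trans ((hv1 s hs).trans ?_)
        linarith [le_max_left (v - u) 0]
    have h2 : Z = H + D.g * ∑ s, D.rest s * ∑ a, perturb π ε s a * x (s, a) ^ 2 := by
      simp only [hZ, hH, stateEnergy, κ, add_mul, Finset.sum_add_distrib, mul_assoc,
        Finset.mul_sum]
    have h3 : ∑ s, D.rest s * ∑ a, perturb π ε s a * x (s, a) ^ 2 ≤ u + τ := by
      calc _ ≤ ∑ s, D.rest s * (u + τ) :=
            Finset.sum_le_sum fun s _ => mul_le_mul_of_nonneg_left (h1 s) (D.rest_nonneg s)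
        _ = _ := by rw [← Finset.sum_mul, D.rest_sum, one_mul]
    rw [h2]
    linarith [mul_le_mul_of_nonneg_left h3 D.g_nonneg]
  refine ⟨s₀, r, τ, hr0, hr1, hτ0, ?_, ?_, hZ1, ?_⟩
  · have h1 := mul_le_mul_of_nonneg_left (mul_le_mul_of_nonneg_left hνsum D.g_nonneg) hG.le
    linarith
  · rw [hN] at hσ
    linarith
  · have h1 := D.ε_le_quarter
    have hn0 : (0 : ℝ) < Fintype.card S := by exact_mod_cast (by omega : 0 < Fintype.card S)
    have h2 : ε ≤ 1 / (4 * (Fintype.card S : ℝ)) := by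
      rw [le_div_iff₀ (by positivity)]
      linarith [M.γ_nonneg]
    have h3 := sum_perturb_sq_ge π hε0 x s₀
    have h4 : (1 - 1 / (4 * (Fintype.card S : ℝ))) * u ≤
        ∑ a, perturb π ε s₀ a * x (s₀, a) ^ 2 :=
      (mul_le_mul (by linarith) hU hu0 (by linarith)).trans h3
    have := mul_le_mul_of_nonneg_left h4 (D.k_nonneg s₀)
    rw [stateEnergy]
    linarith

end Splitting

/-- The numerical conditions under which the drift dominates. -/
structure Certificate (s c c₁ f σ σ' ρ₀ β φ D θ : ℝ) : Prop where
  s_gt : 1 < s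
  c₁_nonneg : 0 ≤ c₁
  σ_nonneg : 0 ≤ σ
  σ'_nonneg : 0 ≤ σ'
  ρ₀_nonneg : 0 ≤ ρ₀
  D_pos : 0 < D
  θ_pos : 0 < θ
  φ_nonneg : 0 ≤ φ
  lam : 2 * c₁ ≤ (1 + c - 2 * c₁ - θ) * (s - 1)
  start : 0 ≤ (1 + c - 2 * c₁ - θ) * D - (1 - β) - 2 * c₁ - f * φ / 2
  last : 0 ≤ ((1 + c - 2 * c₁ - θ) * D - (1 - β) - 2 * c₁ - f * φ / 2) +
    D * (θ * ((1 + σ') / (1 + σ' + ρ₀ * D)) + β - c - f * φ / 2)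
  slope : 0 ≤ 1 + β - 2 * c₁ - 2 * c₁ / (s - 1) - θ - f * φ / 2

/-- K is the energy at the dominant state and W the energy elsewhere. Once W is replaced by its
least value allowed by `hH`, and the fraction k/(σ+g+k) by a bound, the claim is affine in K on [0,
guD]: `start` and `last` are its two endpoints, `slope` its growth beyond, and `lam` pays for τ. -/
theorem Certificate.lower_bound {s c c₁ f σ σ' ρ₀ β φ D θ : ℝ}
    (h : Certificate s c c₁ f σ σ' ρ₀ β φ D θ) {g u τ k K W p Z : ℝ} (hg : 0 < g)
    (hσg : σ' * g ≤ σ) (hu : 0 ≤ u) (hτ : 0 ≤ τ) (hk : 0 ≤ k) (hK : 0 ≤ K) (hW : 0 ≤ W)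
    (hp : p ≤ f)
    (hkK : k * u ≤ ρ₀ * K) (hH : g * (D * u + (s - 1) * τ) ≤ K + W)
    (hZ : Z ≤ K + W + g * (u + τ)) :
    θ * (k / (σ + g + k)) * K + θ * W ≤
      (1 + c) * W + (1 + β) * K - g * (1 - β) * u - p * φ / 2 * (K + g * u) - 2 * c₁ * Z := by
  obtain ⟨hs, hc₁, hσ0, hσ'0, hρ0, hD, hθ, hφ, hlam, hstart, hlast, hslope⟩ := h
  set lam := 1 + c - 2 * c₁ - θ with hlamd
  have hs1 : 0 < s - 1 := by linarith
  have hlam0 : 0 ≤ lam := by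
    by_contra hneg
    push Not at hneg
    nlinarith
  set ψ := ρ₀ * D / (1 + σ' + ρ₀ * D) with hψ
  have hden : 0 < 1 + σ' + ρ₀ * D := by positivity
  have hψ1 : (1 + σ') / (1 + σ' + ρ₀ * D) = 1 - ψ := by rw [hψ]; field_simp; ring
  rw [hψ1] at hlast
  have hden2 : 0 < σ + g + k := by positivity
  have hB : (1 + σ') * g ≤ σ + g := by linarith
  -- it suffices to bound the following
  have hφp : p * φ / 2 * (K + g * u) ≤ f * φ / 2 * (K + g * u) := by
    have : 0 ≤ K + g * u := by positivity
    gcongr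
  have hZ' := mul_le_mul_of_nonneg_left hZ (by linarith : 0 ≤ 2 * c₁)
  suffices hmain : θ * (k / (σ + g + k)) * K ≤ lam * W +
      (1 + β - 2 * c₁ - f * φ / 2) * K - g * u * ((1 - β) + 2 * c₁ + f * φ / 2) -
        2 * c₁ * (g * τ) by
    rw [hlamd] at hmain
    linarith
  have hgτ : 0 ≤ g * τ := by positivity
  have hgu : 0 ≤ g * u := by positivity
  rcases le_total K (g * u * D) with hcase | hcase
  · have hθ1 : k / (σ + g + k) * K ≤ ψ * K := by
      rcases hu.eq_or_lt with hu0 | hu0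
      · have : K = 0 := le_antisymm (by rw [← hu0] at hcase; simpa using hcase) hK
        simp [this]
      · refine mul_le_mul_of_nonneg_right ?_ hK
        have hk2 : k ≤ ρ₀ * D * g := by
          have : k * u ≤ ρ₀ * D * g * u := by
            refine hkK.trans ?_
            calc ρ₀ * K ≤ ρ₀ * (g * u * D) := by gcongr
              _ = _ := by ring
          exact le_of_mul_le_mul_right this hu0
        rw [hψ, div_le_div_iff₀ hden2 hden]
        nlinarith [mul_le_mul_of_nonneg_left hB (mul_nonneg hρ0 hD.le),
          mul_le_mul_of_nonneg_right hk2 (by linarith : 0 ≤ 1 + σ')]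
    have h1 := mul_le_mul_of_nonneg_left hθ1 hθ.le
    have h2 : lam * (g * u * D - K) + lam * (s - 1) * (g * τ) ≤ lam * W := by
      have := mul_le_mul_of_nonneg_left hH hlam0
      linarith
    have h3 := mul_le_mul_of_nonneg_right hlam hgτ
    set E := 1 + β - 2 * c₁ - f * φ / 2 - θ * ψ - lam with hE
    have h4 : 0 ≤ g * u * (lam * D - (1 - β) - 2 * c₁ - f * φ / 2) + K * E := by
      rcases le_total 0 E with hE0 | hE0
      · exact add_nonneg (mul_nonneg hgu hstart) (mul_nonneg hK hE0)
      · have h5 := mul_le_mul_of_nonpos_right hcase hE0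
        have h6 := mul_nonneg hgu hlast
        have e : θ * (1 - ψ) + β - c - f * φ / 2 = E := by rw [hE, hlamd]; ring
        rw [e] at h6
        linarith
    have e : lam * (g * u * D - K) + (1 + β - 2 * c₁ - f * φ / 2) * K -
        g * u * ((1 - β) + 2 * c₁ + f * φ / 2) - θ * (ψ * K) =
        g * u * (lam * D - (1 - β) - 2 * c₁ - f * φ / 2) + K * E := by rw [hE]; ring
    linarith
  · have hθ1 : k / (σ + g + k) * K ≤ K - (1 - ψ) * (g * u * D) := by
      have e1 : k / (σ + g + k) * K = K - (σ + g) / (σ + g + k) * K := by field_simp; ring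
      rw [e1]
      suffices (1 - ψ) * (g * u * D) ≤ (σ + g) / (σ + g + k) * K by linarith
      rw [← hψ1, div_mul_eq_mul_div, div_mul_eq_mul_div, div_le_div_iff₀ hden hden2]
      have a1 : ((1 + σ') * g) * (g * u * D) ≤ (σ + g) * K := by gcongr
      have a2 : (1 + σ') * g * (k * u) * D ≤ (σ + g) * (ρ₀ * K) * D := by gcongr
      have a3 : (1 + σ') * (g * u * D) * (σ + g) ≤ (1 + σ') * K * (σ + g) := by gcongr
      linarith
    have h1 := mul_le_mul_of_nonneg_left hθ1 hθ.le
    -- Beyond guD it suffices to use the part e2 ≤ lam of the energy W, just enough to absorb τ.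
    set e2 := 2 * c₁ / (s - 1) with he2
    have he20 : 0 ≤ e2 := by positivity
    have he2l : e2 ≤ lam := (div_le_iff₀ hs1).2 hlam
    have he2s : e2 * (s - 1) = 2 * c₁ := div_mul_cancel₀ _ hs1.ne'
    have h2 : e2 * (g * u * D - K) + 2 * c₁ * (g * τ) ≤ lam * W := by
      have a1 := mul_le_mul_of_nonneg_left hH he20
      have a2 : e2 * W ≤ lam * W := by gcongr
      have a3 : e2 * (g * ((s - 1) * τ)) = 2 * c₁ * (g * τ) := by rw [← he2s]; ring
      linarith
    have h3 := mul_nonneg (sub_nonneg.2 hcase) hslope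
    have h4 := mul_nonneg hgu hlast
    have e : θ * (1 - ψ) + β - c - f * φ / 2 =
        1 + β - 2 * c₁ - f * φ / 2 - θ * ψ - lam := by rw [hlamd]; ring
    rw [e] at h4
    linarith

end

end CTD

/-! ### The cost term and the drift inequality. -/

namespace CTD

set_option linter.unusedSectionVars false

noncomputable section

variable {S A : Type*} [Fintype S] [Fintype A]

/-- The mean of `c x` for the state weights `k` and the action probabilities `b`. -/
def costForm (M : MDP S A) (k : S → ℝ) (b : S → A → ℝ) (x : S × A → ℝ) : ℝ :=
  ∑ s, k s * ∑ a, b s a * (M.cost s a * x (s, a))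

theorem two_mul_cost_le [Nonempty A] (M : MDP S A) (π : Policy S A) {ε : ℝ} (h0 : 0 ≤ ε)
    (h1 : ε ≤ 1) (x : S × A → ℝ) (s : S) {t : ℝ} (ht : 0 < t) (b : ℝ) :
    2 * b * ∑ a, perturb π ε s a * (M.cost s a * x (s, a)) ≤
      t * ∑ a, perturb π ε s a * x (s, a) ^ 2 + b ^ 2 / t := by
  have e : b ^ 2 / t = ∑ a, perturb π ε s a * (b ^ 2 / t) := by
    rw [← Finset.sum_mul, sum_perturb, one_mul]
  rw [e, Finset.mul_sum, Finset.mul_sum, ← Finset.sum_add_distrib]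
  refine Finset.sum_le_sum fun a _ => ?_
  have h2 := perturb_nonneg π h0 h1 s a
  have h3 : 2 * b * (M.cost s a * x (s, a)) ≤ t * x (s, a) ^ 2 + b ^ 2 / t := by
    have c0 := M.cost_nonneg s a
    have c1 := M.cost_le_one s a
    have h4 : t * x (s, a) ^ 2 + b ^ 2 / t - 2 * b * (M.cost s a * x (s, a)) =
        (t * x (s, a) - b * M.cost s a) ^ 2 / t + b ^ 2 * (1 - M.cost s a ^ 2) / t := by
      field_simp; ring
    have h5 : 0 ≤ 1 - M.cost s a ^ 2 := by nlinarith
    have : 0 ≤ (t * x (s, a) - b * M.cost s a) ^ 2 / t + b ^ 2 * (1 - M.cost s a ^ 2) / t := by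
      positivity
    linarith
  have := mul_le_mul_of_nonneg_left h3 h2
  linarith

namespace Splitting

variable {M : MDP S A} {π : Policy S A} {ε : ℝ} (D : Splitting M π ε)

/-- Young's inequality state by state, with parameter θ except at s₀, where θk(s₀)/q with q = σ + g
+ k(s₀) is used. The remainders (1-g-k(s₀))/θ and q/θ add up to (1+σ)/θ: σ + g is what may be spent
to reduce the energy used at s₀. -/
theorem two_mul_costForm_le [Nonempty A] [Nonempty S] (x : S × A → ℝ) (s₀ : S) {θ σ : ℝ}
    (hθ : 0 < θ) (hσ : 0 ≤ σ) (hg : 0 < D.g) (b : ℝ) :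
    2 * b * costForm M D.k (perturb π ε) x ≤
      θ * (D.k s₀ / (σ + D.g + D.k s₀)) * stateEnergy D.k (perturb π ε) x s₀ +
        θ * (∑ s, stateEnergy D.k (perturb π ε) x s - stateEnergy D.k (perturb π ε) x s₀) +
        b ^ 2 * ((1 + σ) / θ) := by
  classical
  have hε0 := D.ε_nonneg
  have hε1 : ε ≤ 1 := D.ε_le_one.trans (by norm_num)
  have hk0 := D.k_nonneg s₀
  set q := σ + D.g + D.k s₀ with hq
  have hq0 : 0 < q := by positivity
  have h1 : ∀ s, D.k s * (2 * b * ∑ a, perturb π ε s a * (M.cost s a * x (s, a))) ≤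
      θ * stateEnergy D.k (perturb π ε) x s + b ^ 2 / θ * D.k s +
        if s = s₀ then θ * (D.k s₀ / q - 1) * stateEnergy D.k (perturb π ε) x s₀ +
          b ^ 2 / θ * (q - D.k s₀) else 0 := by
    intro s
    split_ifs with hs
    · subst hs
      rcases hk0.eq_or_lt with h | h
      · rw [stateEnergy, ← h]
        have : 0 ≤ b ^ 2 / θ * q := by positivity
        simpa using this
      · have h2 := mul_le_mul_of_nonneg_left (two_mul_cost_le M π hε0 hε1 x s
          (t := θ * (D.k s / q)) (by positivity) b) (D.k_nonneg s)
        refine h2.trans (le_of_eq ?_)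
        rw [stateEnergy]
        field_simp
        ring
    · have h2 := mul_le_mul_of_nonneg_left (two_mul_cost_le M π hε0 hε1 x s hθ b) (D.k_nonneg s)
      refine h2.trans (le_of_eq ?_)
      rw [stateEnergy]; ring
  have h2 := Finset.sum_le_sum fun s (_ : s ∈ Finset.univ) => h1 s
  rw [Finset.sum_add_distrib, Finset.sum_add_distrib, ← Finset.mul_sum, ← Finset.mul_sum, D.k_sum,
    Finset.sum_ite_eq' Finset.univ s₀, if_pos (Finset.mem_univ _)] at h2
  have e : 2 * b * costForm M D.k (perturb π ε) x =
      ∑ s, D.k s * (2 * b * ∑ a, perturb π ε s a * (M.cost s a * x (s, a))) := by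
    rw [costForm, Finset.mul_sum]
    exact Finset.sum_congr rfl fun s _ => by ring
  rw [e]
  refine h2.trans (le_of_eq ?_)
  rw [hq]
  ring

/-- The drift inequality with the constants `c₁` and `C₀` and the rate `ϖ`. -/
def Drift (ϖ c₁ C₀ : ℝ) (x : S × A → ℝ) : Prop :=
  ∀ b : ℝ, 2 * b * costForm M D.k (perturb π ε) x * (1 - M.γ) ≤
    2 * bellmanForm M π D.k (perturb π ε) x +
      (1 - M.γ) * ϖ * (2 * C₀ * b ^ 2 - 2 * c₁ * ∑ s, stateEnergy D.κ (perturb π ε) x s)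

theorem drift_of_certificate [Nonempty A] (hn : 2 ≤ Fintype.card S) (hg0 : 0 < D.g)
    (hg1 : D.g ≤ 1) (x : S × A → ℝ) {s c c₁ C₀ f σ σ' ρ₀ : ℝ} (hc0 : 0 ≤ c) (hc1 : c ≤ 1)
    (hc : c ≤ (2 * (Fintype.card S : ℝ) - 3)⁻¹) (hC₀ : 0 < C₀)
    (hs : s * D.g * ∑ s, actSq x s ≤ ∑ s, stateEnergy D.κ (perturb π ε) x s)
    (hf : 1 - D.g ≤ f) (hσ : σ' * D.g ≤ σ) (hρ : 1 ≤ ρ₀ * (1 - 1 / (4 * (Fintype.card S : ℝ))))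
    (hcert : ∀ r : ℝ, 0 ≤ r → r ≤ 1 → Certificate s c c₁ f σ σ' ρ₀ (betaFn (c / (1 + c)) r)
      (phiFn r) (s * (1 + r ^ 2) - 1) ((1 + σ) / (2 * C₀))) :
    D.Drift 1 c₁ C₀ x := by
  have : Nonempty S := Fintype.card_pos_iff.1 (by omega)
  intro b
  have hε0 := D.ε_nonneg
  have hε1 : ε ≤ 1 := D.ε_le_one.trans (by norm_num)
  have hG : 0 < 1 - M.γ := sub_pos.2 M.γ_lt_one
  obtain ⟨s₀, r, τ, hr0, hr1, hτ, h1, h2, h3, h4⟩ := D.exists_dissipation hn hg1 x hc0 hc1 hc hs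
  have hC := hcert r hr0 hr1
  have hE := stateEnergy_nonneg D.k_nonneg π hε0 hε1 x
  have hW := Finset.single_le_sum (fun s _ => hE s) (Finset.mem_univ s₀)
  have h5 := hC.lower_bound hg0 hσ (sq_nonneg (polMean π x s₀)) hτ (D.k_nonneg s₀) (hE s₀)
    (sub_nonneg.2 hW) hf (by
      have hku : 0 ≤ D.k s₀ * polMean π x s₀ ^ 2 := mul_nonneg (D.k_nonneg s₀) (sq_nonneg _)
      calc D.k s₀ * polMean π x s₀ ^ 2 ≤
          ρ₀ * (1 - 1 / (4 * (Fintype.card S : ℝ))) * (D.k s₀ * polMean π x s₀ ^ 2) :=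
            le_mul_of_one_le_left hku hρ
        _ = ρ₀ * ((1 - 1 / (4 * (Fintype.card S : ℝ))) * (D.k s₀ * polMean π x s₀ ^ 2)) := by ring
        _ ≤ _ := mul_le_mul_of_nonneg_left h4 hC.ρ₀_nonneg)
    (by linarith) (h3.trans (by linarith))
  have h6 := D.two_mul_costForm_le x s₀ hC.θ_pos hC.σ_nonneg hg0 b
  have hσ0 := hC.σ_nonneg
  -- θ was chosen to make the remainder of Young's inequality exactly 2C₀b².
  have e : (1 + σ) / ((1 + σ) / (2 * C₀)) = 2 * C₀ := by field_simp
  rw [e] at h6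
  have h7 := mul_le_mul_of_nonneg_right (h6.trans (add_le_add_left h5 _)) hG.le
  linarith

end Splitting

theorem Certificate.mono_phi {s c c₁ f σ σ' ρ₀ β φ φ' D θ : ℝ}
    (h : Certificate s c c₁ f σ σ' ρ₀ β φ' D θ) (hf : 0 ≤ f) (hφ0 : 0 ≤ φ) (hφ : φ ≤ φ') :
    Certificate s c c₁ f σ σ' ρ₀ β φ D θ := by
  have h1 : f * φ ≤ f * φ' := by gcongr
  have h2 := mul_le_mul_of_nonneg_left h1 h.D_pos.le
  exact ⟨h.s_gt, h.c₁_nonneg, h.σ_nonneg, h.σ'_nonneg, h.ρ₀_nonneg, h.D_pos, h.θ_pos, hφ0, h.lam,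
    by linarith [h.start], by linarith [h.last], by linarith [h.slope]⟩

/-- (1+σ')/(1+σ'+ρ₀D) is convex in D, so it lies above its tangent a - bD at D₀. The substitution
makes `last` polynomial in r. -/
theorem Certificate.of_tangent {s c c₁ f σ σ' ρ₀ β φ D θ : ℝ} (D₀ a b : ℝ) (s_gt : 1 < s)
    (c₁_nonneg : 0 ≤ c₁) (σ_nonneg : 0 ≤ σ) (σ'_nonneg : 0 ≤ σ') (ρ₀_nonneg : 0 ≤ ρ₀)
    (θ_pos : 0 < θ) (hD₀ : 0 < D₀) (lam : 2 * c₁ ≤ (1 + c - 2 * c₁ - θ) * (s - 1))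
    (ha : a = (1 + σ') * (1 + σ' + 2 * ρ₀ * D₀) / (1 + σ' + ρ₀ * D₀) ^ 2)
    (hb : b = (1 + σ') * ρ₀ / (1 + σ' + ρ₀ * D₀) ^ 2)
    (D_pos : 0 < D) (φ_nonneg : 0 ≤ φ)
    (start : 0 ≤ (1 + c - 2 * c₁ - θ) * D - (1 - β) - 2 * c₁ - f * φ / 2)
    (last : 0 ≤ ((1 + c - 2 * c₁ - θ) * D - (1 - β) - 2 * c₁ - f * φ / 2) +
      D * (θ * (a - b * D) + β - c - f * φ / 2))
    (slope : 0 ≤ 1 + β - 2 * c₁ - 2 * c₁ / (s - 1) - θ - f * φ / 2) :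
    Certificate s c c₁ f σ σ' ρ₀ β φ D θ := by
  refine ⟨s_gt, c₁_nonneg, σ_nonneg, σ'_nonneg, ρ₀_nonneg, D_pos, θ_pos, φ_nonneg, lam, start,
    last.trans ?_, slope⟩
  have h : a - b * D ≤ (1 + σ') / (1 + σ' + ρ₀ * D) := by
    have e : a - b * D =
        (1 + σ') * (1 + σ' + 2 * ρ₀ * D₀ - ρ₀ * D) / (1 + σ' + ρ₀ * D₀) ^ 2 := by
      rw [ha, hb]; ring
    rw [e]
    rw [div_le_div_iff₀ (by positivity) (by positivity)]
    have : 0 ≤ (1 + σ') * (ρ₀ * (D - D₀)) ^ 2 := by positivity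
    linarith
  gcongr

/-- Reduces to pieces on which β and φ are polynomials in r: β changes its form at e, and the two
bounds for φ cross near 157/200. -/
theorem certificate_betaFn_phiFn {s c c₁ f σ σ' ρ₀ θ : ℝ} (c' e : ℝ) (hc' : c / (1 + c) = c')
    (he : 1 / (1 + c') = e) (hf : 0 ≤ f)
    (h₁ : ∀ r, 0 ≤ r → r ≤ e → r ≤ 157 / 200 → Certificate s c c₁ f σ σ' ρ₀
      ((1 - r) ^ 2 + c' * r ^ 2) (12 / 125 + r ^ 2 / 4) (s * (1 + r ^ 2) - 1) θ)
    (h₂ : ∀ r, 157 / 200 ≤ r → r ≤ e → r ≤ 1 → Certificate s c c₁ f σ σ' ρ₀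
      ((1 - r) ^ 2 + c' * r ^ 2) (1 / 4) (s * (1 + r ^ 2) - 1) θ)
    (h₃ : ∀ r, e ≤ r → r ≤ 157 / 200 → Certificate s c c₁ f σ σ' ρ₀
      (c' / (1 + c')) (12 / 125 + r ^ 2 / 4) (s * (1 + r ^ 2) - 1) θ)
    (h₄ : ∀ r, 157 / 200 ≤ r → e ≤ r → r ≤ 1 → Certificate s c c₁ f σ σ' ρ₀
      (c' / (1 + c')) (1 / 4) (s * (1 + r ^ 2) - 1) θ) (r : ℝ) (hr0 : 0 ≤ r) (hr1 : r ≤ 1) :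
    Certificate s c c₁ f σ σ' ρ₀ (betaFn (c / (1 + c)) r) (phiFn r) (s * (1 + r ^ 2) - 1) θ := by
  have p1 : phiFn r ≤ 12 / 125 + r ^ 2 / 4 := min_le_right _ _
  have p2 : phiFn r ≤ 1 / 4 := min_le_left _ _
  rw [hc', betaFn, he]
  rcases le_total r (157 / 200) with h | h <;> split_ifs with h'
  · exact (h₁ r hr0 h' h).mono_phi hf (phiFn_nonneg r) p1
  · exact (h₃ r (not_le.1 h').le h).mono_phi hf (phiFn_nonneg r) p1
  · exact (h₂ r h h' hr1).mono_phi hf (phiFn_nonneg r) p2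
  · exact (h₄ r h (not_le.1 h').le hr1).mono_phi hf (phiFn_nonneg r) p2

end

end CTD

/-! ### Numerical certificates for the different numbers of states. -/

namespace CTD
set_option linter.unusedSectionVars false

/-- The pattern for n states, here n = 3: s is a rational number at most √n, c = 1/(2n-3), ρ₀ = 1/(1
- 1/(4n)), θ = 1/(2C₀) with C₀ = 171/100. The tangent is taken at the value of D for r² = 1/12. -/
theorem certificate_three (r : ℝ) (hr0 : 0 ≤ r) (hr1 : r ≤ 1) :
    Certificate (433 / 250) (1 / 3) (19 / 200) 1 0 0 (12 / 11) (betaFn ((1 / 3) / (1 + (1 / 3))) r) (phiFn r)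
      ((433 / 250) * (1 + r ^ 2) - 1) (50 / 171) := by
  refine certificate_betaFn_phiFn (1 / 4) (4 / 5) (by norm_num) (by norm_num) (by norm_num)
    ?_ ?_ ?_ ?_ r hr0 hr1
  · intro r h0 h1 h2
    have l : 0 ≤ r - 0 := by linarith
    have h : 0 ≤ (157 / 200) - r := by linarith
    have l2 := mul_nonneg l l
    have lh := mul_nonneg l h
    have hh := mul_nonneg h h
    refine Certificate.of_tangent (2629 / 3000) (182000 / 239121) (250000 / 876777) (by norm_num) (by norm_num) (by norm_num)
      (by norm_num) (by norm_num) (by norm_num) (by norm_num) (by norm_num) (by norm_num) (by norm_num) (by nlinarith) (by positivity)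
      ?_ ?_ ?_
    · linarith [sq_nonneg (r - (339 / 881)), l2, lh, hh]
    -- A quartic in r: positivity follows from products of the distances l, h to the ends of the
    -- interval and from a square centred inside.
    · have w := sq_nonneg (r - (194 / 307))
      linarith [mul_nonneg l2 l2, mul_nonneg l2 lh, mul_nonneg l2 hh, mul_nonneg lh hh,
        mul_nonneg hh hh, w, mul_nonneg l w, mul_nonneg h w, mul_nonneg l2 w, mul_nonneg lh w,
        mul_nonneg hh w]
    · linarith [l2, lh, hh]
  · intro r h0 h1 h2
    have l : 0 ≤ r - (157 / 200) := by linarith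
    have h : 0 ≤ (4 / 5) - r := by linarith
    have l2 := mul_nonneg l l
    have lh := mul_nonneg l h
    have hh := mul_nonneg h h
    refine Certificate.of_tangent (2629 / 3000) (182000 / 239121) (250000 / 876777) (by norm_num) (by norm_num) (by norm_num)
      (by norm_num) (by norm_num) (by norm_num) (by norm_num) (by norm_num) (by norm_num) (by norm_num) (by nlinarith) (by positivity)
      ?_ ?_ ?_
    · linarith [l2, lh, hh]
    · linarith [mul_nonneg l2 l2, mul_nonneg l2 lh, mul_nonneg l2 hh, mul_nonneg lh hh,
        mul_nonneg hh hh]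
    · linarith [l2, lh, hh]
  · intro r h0 h1
    linarith
  · intro r h0 h1 h2
    have l : 0 ≤ r - (4 / 5) := by linarith
    have h : 0 ≤ 1 - r := by linarith
    have l2 := mul_nonneg l l
    have lh := mul_nonneg l h
    have hh := mul_nonneg h h
    refine Certificate.of_tangent (2629 / 3000) (182000 / 239121) (250000 / 876777) (by norm_num) (by norm_num) (by norm_num)
      (by norm_num) (by norm_num) (by norm_num) (by norm_num) (by norm_num) (by norm_num) (by norm_num) (by nlinarith) (by positivity)
      ?_ ?_ ?_
    · linarith [l2, lh, hh]
    · linarith [mul_nonneg l2 l2, mul_nonneg l2 lh, mul_nonneg l2 hh, mul_nonneg lh hh,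
        mul_nonneg hh hh]
    · linarith [l2, lh, hh]

theorem certificate_four (r : ℝ) (hr0 : 0 ≤ r) (hr1 : r ≤ 1) :
    Certificate 2 (1 / 5) (11 / 100) 1 0 0 (16 / 15) (betaFn ((1 / 5) / (1 + (1 / 5))) r) (phiFn r)
      (2 * (1 + r ^ 2) - 1) (100 / 341) := by
  refine certificate_betaFn_phiFn (1 / 6) (6 / 7) (by norm_num) (by norm_num) (by norm_num)
    ?_ ?_ ?_ ?_ r hr0 hr1
  · intro r h0 h1 h2
    have l : 0 ≤ r - 0 := by linarith
    have h : 0 ≤ (157 / 200) - r := by linarith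
    have l2 := mul_nonneg l l
    have lh := mul_nonneg l h
    have hh := mul_nonneg h h
    refine Certificate.of_tangent (7 / 6) (7065 / 10201) (2160 / 10201) (by norm_num) (by norm_num) (by norm_num)
      (by norm_num) (by norm_num) (by norm_num) (by norm_num) (by norm_num) (by norm_num) (by norm_num) (by nlinarith) (by positivity)
      ?_ ?_ ?_
    · linarith [sq_nonneg (r - (330 / 797)), l2, lh, hh]
    · have w := sq_nonneg (r - (309 / 415))
      linarith [mul_nonneg l2 l2, mul_nonneg l2 lh, mul_nonneg l2 hh, mul_nonneg lh hh,
        mul_nonneg hh hh, w, mul_nonneg l w, mul_nonneg h w, mul_nonneg l2 w, mul_nonneg lh w,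
        mul_nonneg hh w]
    · linarith [l2, lh, hh]
  · intro r h0 h1 h2
    have l : 0 ≤ r - (157 / 200) := by linarith
    have h : 0 ≤ (6 / 7) - r := by linarith
    have l2 := mul_nonneg l l
    have lh := mul_nonneg l h
    have hh := mul_nonneg h h
    refine Certificate.of_tangent (7 / 6) (7065 / 10201) (2160 / 10201) (by norm_num) (by norm_num) (by norm_num)
      (by norm_num) (by norm_num) (by norm_num) (by norm_num) (by norm_num) (by norm_num) (by norm_num) (by nlinarith) (by positivity)
      ?_ ?_ ?_
    · linarith [l2, lh, hh]
    · linarith [mul_nonneg l2 l2, mul_nonneg l2 lh, mul_nonneg l2 hh, mul_nonneg lh hh,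
        mul_nonneg hh hh]
    · linarith [l2, lh, hh]
  · intro r h0 h1
    linarith
  · intro r h0 h1 h2
    have l : 0 ≤ r - (6 / 7) := by linarith
    have h : 0 ≤ 1 - r := by linarith
    have l2 := mul_nonneg l l
    have lh := mul_nonneg l h
    have hh := mul_nonneg h h
    refine Certificate.of_tangent (7 / 6) (7065 / 10201) (2160 / 10201) (by norm_num) (by norm_num) (by norm_num)
      (by norm_num) (by norm_num) (by norm_num) (by norm_num) (by norm_num) (by norm_num) (by norm_num) (by nlinarith) (by positivity)
      ?_ ?_ ?_
    · linarith [l2, lh, hh]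
    · linarith [mul_nonneg l2 l2, mul_nonneg l2 lh, mul_nonneg l2 hh, mul_nonneg lh hh,
        mul_nonneg hh hh]
    · linarith [l2, lh, hh]

theorem certificate_five (r : ℝ) (hr0 : 0 ≤ r) (hr1 : r ≤ 1) :
    Certificate (559 / 250) (1 / 9) (23 / 200) 1 0 0 (20 / 19) (betaFn ((1 / 9) / (1 + (1 / 9))) r) (phiFn r)
      ((559 / 250) * (1 + r ^ 2) - 1) (200 / 667) := by
  refine certificate_betaFn_phiFn (1 / 10) (10 / 11) (by norm_num) (by norm_num) (by norm_num)
    ?_ ?_ ?_ ?_ r hr0 hr1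
  · intro r h0 h1 h2
    have l : 0 ≤ r - 0 := by linarith
    have h : 0 ≤ (157 / 200) - r := by linarith
    have l2 := mul_nonneg l l
    have lh := mul_nonneg l h
    have hh := mul_nonneg h h
    refine Certificate.of_tangent (4267 / 3000) (32444400 / 50651689) (8550000 / 50651689) (by norm_num) (by norm_num) (by norm_num)
      (by norm_num) (by norm_num) (by norm_num) (by norm_num) (by norm_num) (by norm_num) (by norm_num) (by nlinarith) (by positivity)
      ?_ ?_ ?_
    · linarith [sq_nonneg (r - (415 / 944)), l2, lh, hh]
    · have w := sq_nonneg (r - (157 / 200))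
      linarith [mul_nonneg l2 l2, mul_nonneg l2 lh, mul_nonneg l2 hh, mul_nonneg lh hh,
        mul_nonneg hh hh, w, mul_nonneg l w, mul_nonneg h w, mul_nonneg l2 w, mul_nonneg lh w,
        mul_nonneg hh w]
    · linarith [l2, lh, hh]
  · intro r h0 h1 h2
    have l : 0 ≤ r - (157 / 200) := by linarith
    have h : 0 ≤ (10 / 11) - r := by linarith
    have l2 := mul_nonneg l l
    have lh := mul_nonneg l h
    have hh := mul_nonneg h h
    refine Certificate.of_tangent (4267 / 3000) (32444400 / 50651689) (8550000 / 50651689) (by norm_num) (by norm_num) (by norm_num)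
      (by norm_num) (by norm_num) (by norm_num) (by norm_num) (by norm_num) (by norm_num) (by norm_num) (by nlinarith) (by positivity)
      ?_ ?_ ?_
    · linarith [l2, lh, hh]
    · linarith [mul_nonneg l2 l2, mul_nonneg l2 lh, mul_nonneg l2 hh, mul_nonneg lh hh,
        mul_nonneg hh hh]
    · linarith [l2, lh, hh]
  · intro r h0 h1
    linarith
  · intro r h0 h1 h2
    have l : 0 ≤ r - (10 / 11) := by linarith
    have h : 0 ≤ 1 - r := by linarith
    have l2 := mul_nonneg l l
    have lh := mul_nonneg l h
    have hh := mul_nonneg h h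
    refine Certificate.of_tangent (4267 / 3000) (32444400 / 50651689) (8550000 / 50651689) (by norm_num) (by norm_num) (by norm_num)
      (by norm_num) (by norm_num) (by norm_num) (by norm_num) (by norm_num) (by norm_num) (by norm_num) (by nlinarith) (by positivity)
      ?_ ?_ ?_
    · linarith [l2, lh, hh]
    · linarith [mul_nonneg l2 l2, mul_nonneg l2 lh, mul_nonneg l2 hh, mul_nonneg lh hh,
        mul_nonneg hh hh]
    · linarith [l2, lh, hh]

/-- Serves all n ≥ 7 at once, hence c = 0: no gain from the chain is used, and s close to √7
suffices. -/
theorem certificate_seven (r : ℝ) (hr0 : 0 ≤ r) (hr1 : r ≤ 1) :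
    Certificate (26457 / 10000) 0 (11 / 100) 1 0 0 (28 / 27) (betaFn (0 / (1 + 0)) r) (phiFn r)
      ((26457 / 10000) * (1 + r ^ 2) - 1) (25 / 77) := by
  refine certificate_betaFn_phiFn 0 1 (by norm_num) (by norm_num) (by norm_num)
    ?_ ?_ ?_ ?_ r hr0 hr1
  · intro r h0 h1 h2
    have l : 0 ≤ r - 0 := by linarith
    have h : 0 ≤ (157 / 200) - r := by linarith
    have l2 := mul_nonneg l l
    have lh := mul_nonneg l h
    have hh := mul_nonneg h h
    refine Certificate.of_tangent (74647 / 40000) (355065660000 / 628102215841) (75600000000 / 628102215841) (by norm_num) (by norm_num) (by norm_num)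
      (by norm_num) (by norm_num) (by norm_num) (by norm_num) (by norm_num) (by norm_num) (by norm_num) (by nlinarith) (by positivity)
      ?_ ?_ ?_
    · linarith [sq_nonneg (r - (113 / 235)), l2, lh, hh]
    · have w := sq_nonneg (r - (157 / 200))
      linarith [mul_nonneg l2 l2, mul_nonneg l2 lh, mul_nonneg l2 hh, mul_nonneg lh hh,
        mul_nonneg hh hh, w, mul_nonneg l w, mul_nonneg h w, mul_nonneg l2 w, mul_nonneg lh w,
        mul_nonneg hh w]
    · linarith [l2, lh, hh]
  · intro r h0 h1 h2
    have l : 0 ≤ r - (157 / 200) := by linarith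
    have h : 0 ≤ 1 - r := by linarith
    have l2 := mul_nonneg l l
    have lh := mul_nonneg l h
    have hh := mul_nonneg h h
    refine Certificate.of_tangent (74647 / 40000) (355065660000 / 628102215841) (75600000000 / 628102215841) (by norm_num) (by norm_num) (by norm_num)
      (by norm_num) (by norm_num) (by norm_num) (by norm_num) (by norm_num) (by norm_num) (by norm_num) (by nlinarith) (by positivity)
      ?_ ?_ ?_
    · linarith [l2, lh, hh]
    · linarith [mul_nonneg l2 l2, mul_nonneg l2 lh, mul_nonneg l2 hh, mul_nonneg lh hh,
        mul_nonneg hh hh]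
    · linarith [l2, lh, hh]
  · intro r h0 h1
    linarith
  · intro r h0 h1 h2
    obtain rfl : r = 1 := le_antisymm h2 h1
    refine Certificate.of_tangent (74647 / 40000) (355065660000 / 628102215841) (75600000000 / 628102215841) ?_ ?_ ?_ ?_ ?_ ?_ ?_ ?_ ?_ ?_ ?_ ?_ ?_ ?_ ?_ <;>
      norm_num

/-- For two states the range of g is cut at 11/50, 9/25 and 1/2. On each piece f is one minus the
left end; on the first three σ' is σ divided by the right end, and on the last both vanish. -/
theorem certificate_two_1 (r : ℝ) (hr0 : 0 ≤ r) (hr1 : r ≤ 1) :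
    Certificate (7071 / 5000) 1 (1 / 20) 1 (3 / 5) (30 / 11) (8 / 7) (betaFn (1 / (1 + 1)) r) (phiFn r)
      ((7071 / 5000) * (1 + r ^ 2) - 1) (8 / 11) := by
  refine certificate_betaFn_phiFn (1 / 2) (2 / 3) (by norm_num) (by norm_num) (by norm_num)
    ?_ ?_ ?_ ?_ r hr0 hr1
  · intro r h0 h1 h2
    have l : 0 ≤ r - 0 := by linarith
    have h : 0 ≤ (2 / 3) - r := by linarith
    have l2 := mul_nonneg l l
    have lh := mul_nonneg l h
    have hh := mul_nonneg h h
    refine Certificate.of_tangent (6499 / 10000) (179994920000 / 185105597121) (39462500000 / 185105597121) (by norm_num) (by norm_num) (by norm_num)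
      (by norm_num) (by norm_num) (by norm_num) (by norm_num) (by norm_num) (by norm_num) (by norm_num) (by nlinarith) (by positivity)
      ?_ ?_ ?_
    · linarith [sq_nonneg (r - (239 / 725)), l2, lh, hh]
    · have w := sq_nonneg (r - (209 / 458))
      linarith [mul_nonneg l2 l2, mul_nonneg l2 lh, mul_nonneg l2 hh, mul_nonneg lh hh,
        mul_nonneg hh hh, w, mul_nonneg l w, mul_nonneg h w, mul_nonneg l2 w, mul_nonneg lh w,
        mul_nonneg hh w]
    · linarith [l2, lh, hh]
  · intro r h0 h1 h2
    linarith
  · intro r h0 h1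
    have l : 0 ≤ r - (2 / 3) := by linarith
    have h : 0 ≤ (157 / 200) - r := by linarith
    have l2 := mul_nonneg l l
    have lh := mul_nonneg l h
    have hh := mul_nonneg h h
    refine Certificate.of_tangent (6499 / 10000) (179994920000 / 185105597121) (39462500000 / 185105597121) (by norm_num) (by norm_num) (by norm_num)
      (by norm_num) (by norm_num) (by norm_num) (by norm_num) (by norm_num) (by norm_num) (by norm_num) (by nlinarith) (by positivity)
      ?_ ?_ ?_
    · linarith [l2, lh, hh]
    · linarith [mul_nonneg l2 l2, mul_nonneg l2 lh, mul_nonneg l2 hh, mul_nonneg lh hh,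
        mul_nonneg hh hh]
    · linarith [l2, lh, hh]
  · intro r h0 h1 h2
    have l : 0 ≤ r - (157 / 200) := by linarith
    have h : 0 ≤ 1 - r := by linarith
    have l2 := mul_nonneg l l
    have lh := mul_nonneg l h
    have hh := mul_nonneg h h
    refine Certificate.of_tangent (6499 / 10000) (179994920000 / 185105597121) (39462500000 / 185105597121) (by norm_num) (by norm_num) (by norm_num)
      (by norm_num) (by norm_num) (by norm_num) (by norm_num) (by norm_num) (by norm_num) (by norm_num) (by nlinarith) (by positivity)
      ?_ ?_ ?_
    · linarith [l2, lh, hh]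
    · linarith [mul_nonneg l2 l2, mul_nonneg l2 lh, mul_nonneg l2 hh, mul_nonneg lh hh,
        mul_nonneg hh hh]
    · linarith [l2, lh, hh]

theorem certificate_two_2 (r : ℝ) (hr0 : 0 ≤ r) (hr1 : r ≤ 1) :
    Certificate (7071 / 5000) 1 (1 / 20) (39 / 50) (3 / 5) (5 / 3) (8 / 7) (betaFn (1 / (1 + 1)) r) (phiFn r)
      ((7071 / 5000) * (1 + r ^ 2) - 1) (8 / 11) := by
  refine certificate_betaFn_phiFn (1 / 2) (2 / 3) (by norm_num) (by norm_num) (by norm_num)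
    ?_ ?_ ?_ ?_ r hr0 hr1
  · intro r h0 h1 h2
    have l : 0 ≤ r - 0 := by linarith
    have h : 0 ≤ (2 / 3) - r := by linarith
    have l2 := mul_nonneg l l
    have lh := mul_nonneg l h
    have hh := mul_nonneg h h
    refine Certificate.of_tangent (6499 / 10000) (7629580000 / 8009713009) (2100000000 / 8009713009) (by norm_num) (by norm_num) (by norm_num)
      (by norm_num) (by norm_num) (by norm_num) (by norm_num) (by norm_num) (by norm_num) (by norm_num) (by nlinarith) (by positivity)
      ?_ ?_ ?_
    · linarith [sq_nonneg (r - (82 / 251)), l2, lh, hh]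
    · have w := sq_nonneg (r - (41 / 89))
      linarith [mul_nonneg l2 l2, mul_nonneg l2 lh, mul_nonneg l2 hh, mul_nonneg lh hh,
        mul_nonneg hh hh, w, mul_nonneg l w, mul_nonneg h w, mul_nonneg l2 w, mul_nonneg lh w,
        mul_nonneg hh w]
    · linarith [l2, lh, hh]
  · intro r h0 h1 h2
    linarith
  · intro r h0 h1
    have l : 0 ≤ r - (2 / 3) := by linarith
    have h : 0 ≤ (157 / 200) - r := by linarith
    have l2 := mul_nonneg l l
    have lh := mul_nonneg l h
    have hh := mul_nonneg h h
    refine Certificate.of_tangent (6499 / 10000) (7629580000 / 8009713009) (2100000000 / 8009713009) (by norm_num) (by norm_num) (by norm_num)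
      (by norm_num) (by norm_num) (by norm_num) (by norm_num) (by norm_num) (by norm_num) (by norm_num) (by nlinarith) (by positivity)
      ?_ ?_ ?_
    · linarith [l2, lh, hh]
    · linarith [mul_nonneg l2 l2, mul_nonneg l2 lh, mul_nonneg l2 hh, mul_nonneg lh hh,
        mul_nonneg hh hh]
    · linarith [l2, lh, hh]
  · intro r h0 h1 h2
    have l : 0 ≤ r - (157 / 200) := by linarith
    have h : 0 ≤ 1 - r := by linarith
    have l2 := mul_nonneg l l
    have lh := mul_nonneg l h
    have hh := mul_nonneg h h
    refine Certificate.of_tangent (6499 / 10000) (7629580000 / 8009713009) (2100000000 / 8009713009) (by norm_num) (by norm_num) (by norm_num)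
      (by norm_num) (by norm_num) (by norm_num) (by norm_num) (by norm_num) (by norm_num) (by norm_num) (by nlinarith) (by positivity)
      ?_ ?_ ?_
    · linarith [l2, lh, hh]
    · linarith [mul_nonneg l2 l2, mul_nonneg l2 lh, mul_nonneg l2 hh, mul_nonneg lh hh,
        mul_nonneg hh hh]
    · linarith [l2, lh, hh]

theorem certificate_two_3 (r : ℝ) (hr0 : 0 ≤ r) (hr1 : r ≤ 1) :
    Certificate (7071 / 5000) 1 (1 / 20) (16 / 25) (1 / 2) 1 (8 / 7) (betaFn (1 / (1 + 1)) r) (phiFn r)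
      ((7071 / 5000) * (1 + r ^ 2) - 1) (15 / 22) := by
  refine certificate_betaFn_phiFn (1 / 2) (2 / 3) (by norm_num) (by norm_num) (by norm_num)
    ?_ ?_ ?_ ?_ r hr0 hr1
  · intro r h0 h1 h2
    have l : 0 ≤ r - 0 := by linarith
    have h : 0 ≤ (2 / 3) - r := by linarith
    have l2 := mul_nonneg l l
    have lh := mul_nonneg l h
    have hh := mul_nonneg h h
    refine Certificate.of_tangent (6499 / 10000) (533715000 / 575952001) (175000000 / 575952001) (by norm_num) (by norm_num) (by norm_num)
      (by norm_num) (by norm_num) (by norm_num) (by norm_num) (by norm_num) (by norm_num) (by norm_num) (by nlinarith) (by positivity)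
      ?_ ?_ ?_
    · linarith [sq_nonneg (r - (7 / 22)), l2, lh, hh]
    · have w := sq_nonneg (r - (178 / 385))
      linarith [mul_nonneg l2 l2, mul_nonneg l2 lh, mul_nonneg l2 hh, mul_nonneg lh hh,
        mul_nonneg hh hh, w, mul_nonneg l w, mul_nonneg h w, mul_nonneg l2 w, mul_nonneg lh w,
        mul_nonneg hh w]
    · linarith [l2, lh, hh]
  · intro r h0 h1 h2
    linarith
  · intro r h0 h1
    have l : 0 ≤ r - (2 / 3) := by linarith
    have h : 0 ≤ (157 / 200) - r := by linarith
    have l2 := mul_nonneg l l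
    have lh := mul_nonneg l h
    have hh := mul_nonneg h h
    refine Certificate.of_tangent (6499 / 10000) (533715000 / 575952001) (175000000 / 575952001) (by norm_num) (by norm_num) (by norm_num)
      (by norm_num) (by norm_num) (by norm_num) (by norm_num) (by norm_num) (by norm_num) (by norm_num) (by nlinarith) (by positivity)
      ?_ ?_ ?_
    · linarith [l2, lh, hh]
    · linarith [mul_nonneg l2 l2, mul_nonneg l2 lh, mul_nonneg l2 hh, mul_nonneg lh hh,
        mul_nonneg hh hh]
    · linarith [l2, lh, hh]
  · intro r h0 h1 h2
    have l : 0 ≤ r - (157 / 200) := by linarith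
    have h : 0 ≤ 1 - r := by linarith
    have l2 := mul_nonneg l l
    have lh := mul_nonneg l h
    have hh := mul_nonneg h h
    refine Certificate.of_tangent (6499 / 10000) (533715000 / 575952001) (175000000 / 575952001) (by norm_num) (by norm_num) (by norm_num)
      (by norm_num) (by norm_num) (by norm_num) (by norm_num) (by norm_num) (by norm_num) (by norm_num) (by nlinarith) (by positivity)
      ?_ ?_ ?_
    · linarith [l2, lh, hh]
    · linarith [mul_nonneg l2 l2, mul_nonneg l2 lh, mul_nonneg l2 hh, mul_nonneg lh hh,
        mul_nonneg hh hh]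
    · linarith [l2, lh, hh]

theorem certificate_two_4 (r : ℝ) (hr0 : 0 ≤ r) (hr1 : r ≤ 1) :
    Certificate (7071 / 5000) 1 (1 / 20) (1 / 2) 0 0 (8 / 7) (betaFn (1 / (1 + 1)) r) (phiFn r)
      ((7071 / 5000) * (1 + r ^ 2) - 1) (5 / 11) := by
  refine certificate_betaFn_phiFn (1 / 2) (2 / 3) (by norm_num) (by norm_num) (by norm_num)
    ?_ ?_ ?_ ?_ r hr0 hr1
  · intro r h0 h1 h2
    have l : 0 ≤ r - 0 := by linarith
    have h : 0 ≤ (2 / 3) - r := by linarith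
    have l2 := mul_nonneg l l
    have lh := mul_nonneg l h
    have hh := mul_nonneg h h
    refine Certificate.of_tangent (10641 / 20000) (678685000 / 791915881) (350000000 / 791915881) (by norm_num) (by norm_num) (by norm_num)
      (by norm_num) (by norm_num) (by norm_num) (by norm_num) (by norm_num) (by norm_num) (by norm_num) (by nlinarith) (by positivity)
      ?_ ?_ ?_
    · linarith [sq_nonneg (r - (218 / 759)), l2, lh, hh]
    · have w := sq_nonneg (r - (185 / 406))
      linarith [mul_nonneg l2 l2, mul_nonneg l2 lh, mul_nonneg l2 hh, mul_nonneg lh hh,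
        mul_nonneg hh hh, w, mul_nonneg l w, mul_nonneg h w, mul_nonneg l2 w, mul_nonneg lh w,
        mul_nonneg hh w]
    · linarith [l2, lh, hh]
  · intro r h0 h1 h2
    linarith
  · intro r h0 h1
    have l : 0 ≤ r - (2 / 3) := by linarith
    have h : 0 ≤ (157 / 200) - r := by linarith
    have l2 := mul_nonneg l l
    have lh := mul_nonneg l h
    have hh := mul_nonneg h h
    refine Certificate.of_tangent (10641 / 20000) (678685000 / 791915881) (350000000 / 791915881) (by norm_num) (by norm_num) (by norm_num)
      (by norm_num) (by norm_num) (by norm_num) (by norm_num) (by norm_num) (by norm_num) (by norm_num) (by nlinarith) (by positivity)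
      ?_ ?_ ?_
    · linarith [l2, lh, hh]
    · linarith [mul_nonneg l2 l2, mul_nonneg l2 lh, mul_nonneg l2 hh, mul_nonneg lh hh,
        mul_nonneg hh hh]
    · linarith [l2, lh, hh]
  · intro r h0 h1 h2
    have l : 0 ≤ r - (157 / 200) := by linarith
    have h : 0 ≤ 1 - r := by linarith
    have l2 := mul_nonneg l l
    have lh := mul_nonneg l h
    have hh := mul_nonneg h h
    refine Certificate.of_tangent (10641 / 20000) (678685000 / 791915881) (350000000 / 791915881) (by norm_num) (by norm_num) (by norm_num)
      (by norm_num) (by norm_num) (by norm_num) (by norm_num) (by norm_num) (by norm_num) (by norm_num) (by nlinarith) (by positivity)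
      ?_ ?_ ?_
    · linarith [l2, lh, hh]
    · linarith [mul_nonneg l2 l2, mul_nonneg l2 lh, mul_nonneg l2 hh, mul_nonneg lh hh,
        mul_nonneg hh hh]
    · linarith [l2, lh, hh]

end CTD

/-! ### The norm of the solution of the projected equation. -/

namespace CTD

set_option linter.unusedSectionVars false

noncomputable section

variable {S A : Type*} [Fintype S] [Fintype A]

/-- The final inequality for two states with weight ratio m. Equality holds at m = 0, which is what
fixes the constant 3/2 there. -/
theorem two_state_bound {m : ℝ} (h0 : 0 ≤ m) (h1 : m ≤ 1) :
    0 ≤ 9 / 4 * (1 + m) * (4 / 3 - m / 8) ^ 2 - 2 * m * (4 / 3 - m / 8) - 4 := by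
  linarith [mul_nonneg h0 (sub_nonneg.2 h1), pow_nonneg h0 3]

namespace Splitting

variable {M : MDP S A} {π : Policy S A} {ε : ℝ} (D : Splitting M π ε)

include D in
theorem exists_max_polMean [Nonempty S] (x : S × A → ℝ) :
    ∃ s₀, ∀ s, polMean π x s ^ 2 ≤ polMean π x s₀ ^ 2 := by
  obtain ⟨s₀, -, hs₀⟩ := Finset.exists_max_image Finset.univ (fun s => polMean π x s ^ 2)
    Finset.univ_nonempty
  exact ⟨s₀, fun s => hs₀ s (Finset.mem_univ s)⟩

theorem two_mul_costForm_le_uniform [Nonempty A] [Nonempty S] (x : S × A → ℝ) {t : ℝ}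
    (ht : 0 < t) (b : ℝ) :
    2 * b * costForm M D.k (perturb π ε) x ≤
      t * ∑ s, stateEnergy D.k (perturb π ε) x s + b ^ 2 / t * (1 - D.g) := by
  have hε1 : ε ≤ 1 := D.ε_le_one.trans (by norm_num)
  rw [← D.k_sum, Finset.mul_sum, Finset.mul_sum, ← Finset.sum_add_distrib, costForm,
    Finset.mul_sum]
  refine Finset.sum_le_sum fun s _ => ?_
  have := mul_le_mul_of_nonneg_left (two_mul_cost_le M π D.ε_nonneg hε1 x s ht b) (D.k_nonneg s)
  rw [stateEnergy]
  linarith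

/-- The chain potential on all n states gives the uniform extra rate 1/(2n-1). The exploration loss
is kept in terms of α, to be compared with an energy later. -/
theorem dissipation_chain [Nonempty A] [Nonempty S] (hg1 : D.g ≤ 1) (x : S × A → ℝ) :
    ∃ s₀, (∀ s, polMean π x s ^ 2 ≤ polMean π x s₀ ^ 2) ∧
      (1 - M.γ) * ((1 + (2 * (Fintype.card S : ℝ) - 1)⁻¹) *
        ∑ s, stateEnergy D.k (perturb π ε) x s -
        D.g * (1 - (2 * (Fintype.card S : ℝ) - 1)⁻¹) * polMean π x s₀ ^ 2 -
        (1 - D.g) / 8 * (D.α * (M.γ * polMean π x s₀ ^ 2))) ≤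
      2 * bellmanForm M π D.k (perturb π ε) x := by
  have hε0 := D.ε_nonneg
  have hε1 : ε ≤ 1 := D.ε_le_one.trans (by norm_num)
  have hG : 0 < 1 - M.γ := sub_pos.2 M.γ_lt_one
  obtain ⟨s₀, hmax⟩ := D.exists_max_polMean x
  obtain ⟨η, hη⟩ := exists_chain_potential (fun s => |polMean π x s|) (fun s => abs_nonneg _)
    Finset.univ
  simp only [sq_abs, Finset.card_univ, Finset.mem_univ, true_implies] at hη
  have hn : (1 : ℝ) ≤ Fintype.card S := by exact_mod_cast Fintype.card_pos
  set c := (2 * (Fintype.card S : ℝ) - 1)⁻¹ with hc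
  have hc1 : c ≤ 1 := inv_le_one_of_one_le₀ (by linarith)
  have hmain := bellmanForm_perturb M π (e := fun _ => c) (ε := ε) x
    D.k_nonneg D.ρ_nonneg D.ν_nonneg D.g_nonneg D.flow (fun s => (hη s).2.1)
    (fun s a s' => by
      have h1 := (hη s).2.2.2 s'
      have h2 := half_abs_sub_sq_le (x (s, a)) (polMean π x s) (polMean π x s')
      linarith)
    (fun s => hc1) (fun s => (hη s).2.2.1) hε0 hε1
  have hloss := D.loss_le_α x s₀ (φ := 1 / 4) (D.offSum_sub_le_quarter x s₀ hg1 hmax)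
    (by nlinarith)
  rw [← Finset.mul_sum] at hmain
  have hν : ∑ s, D.ν s * (polMean π x s ^ 2 - η s) ≤ (1 - c) * polMean π x s₀ ^ 2 := by
    calc _ ≤ ∑ s, D.ν s * ((1 - c) * polMean π x s₀ ^ 2) :=
          Finset.sum_le_sum fun s _ => mul_le_mul_of_nonneg_left (by
            have h1 := (hη s).2.2.1
            have h2 := mul_le_mul_of_nonneg_left (hmax s) (sub_nonneg.2 hc1)
            linarith) (D.ν_nonneg s)
      _ = _ := by rw [← Finset.sum_mul, D.ν_sum, one_mul]
  refine ⟨s₀, hmax, ?_⟩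
  have h1 := mul_le_mul_of_nonneg_left (mul_le_mul_of_nonneg_left hν D.g_nonneg) hG.le
  linarith

/-- A solution of the projected equation has a norm of order `1 / (1 - γ)`. -/
theorem energy_le_of_eq [Nonempty A] [Nonempty S] (hg : D.g = 0) (x : S × A → ℝ)
    (hx : bellmanForm M π D.k (perturb π ε) x ≤ costForm M D.k (perturb π ε) x) :
    (1 - M.γ) ^ 2 * ∑ s, stateEnergy D.k (perturb π ε) x s ≤
      (2 / (7 / 8 + (2 * (Fintype.card S : ℝ) - 1)⁻¹)) ^ 2 := by
  have hε0 := D.ε_nonneg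
  have hε1 : ε ≤ 1 := D.ε_le_one.trans (by norm_num)
  have hG : 0 < 1 - M.γ := sub_pos.2 M.γ_lt_one
  have hn : (1 : ℝ) ≤ Fintype.card S := by exact_mod_cast Fintype.card_pos
  obtain ⟨s₀, hmax, h⟩ := D.dissipation_chain (by rw [hg]; norm_num) x
  set c := (2 * (Fintype.card S : ℝ) - 1)⁻¹ with hc
  have hc0 : 0 ≤ c := inv_nonneg.2 (by linarith)
  have hE := stateEnergy_nonneg D.k_nonneg π hε0 hε1 x
  have hW := Finset.single_le_sum (fun s _ => hE s) (Finset.mem_univ s₀)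
  set Z := ∑ s, stateEnergy D.k (perturb π ε) x s with hZ
  have h1 : D.α * (M.γ * polMean π x s₀ ^ 2) ≤ Z := by
    refine le_trans ?_ hW
    have h2 := D.α_le s₀
    rw [hg, zero_mul, add_zero] at h2
    have h3 := (mul_le_mul_of_nonneg_left (polMean_sq_le π x s₀) M.γ_nonneg).trans
      (D.γ_mul_le_sum_perturb_sq x s₀)
    exact mul_le_mul h2 h3 (mul_nonneg M.γ_nonneg (sq_nonneg _)) (D.k_nonneg s₀)
  have ha : 0 < 7 / 8 + c := by linarith
  -- Half the dissipation rate, where 7/8 = 1 - 1/8 accounts for the exploration loss.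
  have h4 := D.two_mul_costForm_le_uniform x (t := (1 - M.γ) * (7 / 8 + c) / 2)
    (by positivity) 1
  rw [hg] at h h4
  have h5 : (1 - M.γ) * ((7 / 8 + c) * Z) ≤
      (1 - M.γ) * (7 / 8 + c) / 2 * Z + 2 / ((1 - M.γ) * (7 / 8 + c)) := by
    have e : (1:ℝ) ^ 2 / ((1 - M.γ) * (7 / 8 + c) / 2) * (1 - 0) =
      2 / ((1 - M.γ) * (7 / 8 + c)) := by field_simp; norm_num
    rw [e] at h4
    have := mul_le_mul_of_nonneg_left h1 hG.le
    linarith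
  have h6 : (1 - M.γ) * (7 / 8 + c) / 2 * Z ≤ 2 / ((1 - M.γ) * (7 / 8 + c)) := by linarith
  rw [le_div_iff₀ (by positivity)] at h6
  rw [div_pow, le_div_iff₀ (by positivity)]
  linarith

/-- Improves the general constant 48/29 to 3/2. The other state keeps its full potential X², hence
rate 2; the dominant one keeps 1/3, the minimum of y²/2 + (1-y)², hence rate 4/3 before the
exploration loss. -/
theorem energy_le_of_eq_of_card_eq_two [Nonempty A] (hn : Fintype.card S = 2) (hg : D.g = 0)
    (x : S × A → ℝ)
    (hx : bellmanForm M π D.k (perturb π ε) x ≤ costForm M D.k (perturb π ε) x) :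
    (1 - M.γ) ^ 2 * ∑ s, stateEnergy D.k (perturb π ε) x s ≤ (3 / 2) ^ 2 := by
  classical
  have : Nonempty S := Fintype.card_pos_iff.1 (by omega)
  have hε0 := D.ε_nonneg
  have hε1 : ε ≤ 1 := D.ε_le_one.trans (by norm_num)
  have hG : 0 < 1 - M.γ := sub_pos.2 M.γ_lt_one
  obtain ⟨s₀, hmax⟩ := D.exists_max_polMean x
  obtain ⟨s₁, hs₁, huniv⟩ : ∃ s₁, s₁ ≠ s₀ ∧ ∀ s ≠ s₀, s = s₁ := by
    obtain ⟨s₁, h1⟩ := Finset.card_eq_one.1 (by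
      rw [Finset.card_erase_of_mem (Finset.mem_univ s₀), Finset.card_univ, hn] :
      (Finset.univ.erase s₀).card = 1)
    have h2 : s₁ ∈ Finset.univ.erase s₀ := by rw [h1]; simp
    exact ⟨s₁, Finset.ne_of_mem_erase h2, fun s hs => by
      have : s ∈ Finset.univ.erase s₀ := by simp [hs]
      rw [h1] at this
      simpa using this⟩
  have hsum : ∀ f : S → ℝ, ∑ s, f s = f s₀ + f s₁ := by
    intro f
    have : (Finset.univ : Finset S) = {s₀, s₁} := by
      ext s
      by_cases hs : s = s₀
      · simp [hs]
      · simp [huniv s hs]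
    rw [this, Finset.sum_pair hs₁.symm]
  obtain ⟨η, hη1, hη2, hη3, hη4⟩ := exists_extended_potential π x s₀ (c := 1) (β := 1 / 3)
    (η := fun s => polMean π x s ^ 2) hmax (fun s _ => le_rfl) zero_le_one
    (fun s _ => by rw [one_mul])
    (fun s hs s' hs' => by
      rw [huniv s hs, huniv s' hs']
      have := sq_nonneg (|polMean π x s₁| - |polMean π x s₁|)
      linarith)
    (by norm_num)
    (fun s _ a => by nlinarith [sq_nonneg (3 * x (s, a) - 2 * polMean π x s₀)])
  have hmain := bellmanForm_perturb M π (e := fun s => if s = s₀ then 1 / 3 else 1) (ε := ε) x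
    D.k_nonneg D.ρ_nonneg D.ν_nonneg D.g_nonneg D.flow hη2 hη3
    (fun s => by split_ifs <;> norm_num)
    (fun s => by
      split_ifs with h
      · rw [h]; exact hη4
      · rw [hη1 s h, one_mul]) hε0 hε1
  rw [sum_ite_eq_mul_add, hsum, hg] at hmain
  have hg1 : D.g ≤ 1 := by rw [hg]; norm_num
  have hloss := D.loss_le_α x s₀ (φ := 1 / 4) (D.offSum_sub_le_quarter x s₀ hg1 hmax)
    (by rw [hg]; norm_num)
  rw [hg] at hloss
  have hksum := D.k_sum
  rw [hsum, hg] at hksum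
  have hα0 := D.α_le s₀
  have hα1 := D.α_le s₁
  rw [hg, zero_mul, add_zero] at hα0 hα1
  have hE := stateEnergy_nonneg D.k_nonneg π hε0 hε1 x
  have hE0 := hE s₀
  have hE1 := hE s₁
  have hγu : M.γ * polMean π x s₀ ^ 2 ≤ ∑ a, perturb π ε s₀ a * x (s₀, a) ^ 2 :=
    (mul_le_mul_of_nonneg_left (polMean_sq_le π x s₀) M.γ_nonneg).trans
      (D.γ_mul_le_sum_perturb_sq x s₀)
  have hγu0 : 0 ≤ M.γ * polMean π x s₀ ^ 2 := mul_nonneg M.γ_nonneg (sq_nonneg _)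
  have hcost : ∀ t₀ t₁ : ℝ, 0 < t₀ → 0 < t₁ → 2 * costForm M D.k (perturb π ε) x ≤
      t₀ * stateEnergy D.k (perturb π ε) x s₀ + D.k s₀ / t₀ +
        (t₁ * stateEnergy D.k (perturb π ε) x s₁ + D.k s₁ / t₁) := by
    intro t₀ t₁ ht₀ ht₁
    have h1 := mul_le_mul_of_nonneg_left (two_mul_cost_le M π hε0 hε1 x s₀ ht₀ 1) (D.k_nonneg s₀)
    have h2 := mul_le_mul_of_nonneg_left (two_mul_cost_le M π hε0 hε1 x s₁ ht₁ 1) (D.k_nonneg s₁)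
    rw [costForm, hsum, stateEnergy, stateEnergy]
    have e : ∀ k t : ℝ, k / t = k * (1 / t) := fun k t => by ring
    rw [one_pow] at h1 h2
    rw [e _ t₀, e _ t₁]
    linarith
  rw [hsum]
  have hk0 := D.k_nonneg s₀
  have hk1 := D.k_nonneg s₁
  have hαn := D.α_nonneg
  -- the loss is at most `m / 8` times the energy of the dominant state
  obtain ⟨m, hm0, hm1, hmα, hmk⟩ : ∃ m : ℝ, 0 ≤ m ∧ m ≤ 1 ∧ D.α * (M.γ * polMean π x s₀ ^ 2) ≤
      m * stateEnergy D.k (perturb π ε) x s₀ ∧ m * D.k s₀ ≤ D.k s₁ ∧ (m = 1 ∨ m * D.k s₀ = D.k s₁) := by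
    rcases le_total (D.k s₀) (D.k s₁) with h | h
    · refine ⟨1, zero_le_one, le_rfl, ?_, by linarith, Or.inl rfl⟩
      rw [one_mul]
      exact mul_le_mul hα0 hγu hγu0 hk0
    · have hk0' : 0 < D.k s₀ := by linarith
      refine ⟨D.k s₁ / D.k s₀, by positivity, (div_le_one hk0').2 h, ?_,
        (div_mul_cancel₀ _ hk0'.ne').le, Or.inr (div_mul_cancel₀ _ hk0'.ne')⟩
      rw [stateEnergy, ← mul_assoc (D.k s₁ / D.k s₀), div_mul_cancel₀ _ hk0'.ne']
      exact mul_le_mul hα1 hγu hγu0 hk1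
  obtain ⟨hmk, hmk'⟩ := hmk
  set a : ℝ := 4 / 3 - m / 8 with ha
  have ha0 : 0 < a := by rw [ha]; linarith
  -- In each state half of its own dissipation rate, a at the dominant state and 2 at the other.
  have h1 := hcost ((1 - M.γ) * a / 2) (1 - M.γ) (by positivity) hG
  set E₀ := stateEnergy D.k (perturb π ε) x s₀ with hE₀
  set E₁ := stateEnergy D.k (perturb π ε) x s₁ with hE₁
  have h2 : (1 - M.γ) * (a * E₀ + 2 * E₁) ≤ (1 - M.γ) * a / 2 * E₀ +
      D.k s₀ / ((1 - M.γ) * a / 2) + ((1 - M.γ) * E₁ + D.k s₁ / (1 - M.γ)) := by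
    have h3 := mul_le_mul_of_nonneg_left hmα hG.le
    have e : (1 - M.γ) * (a * E₀) = (1 - M.γ) * (4 / 3 * E₀ - m * E₀ / 8) := by rw [ha]; ring
    linarith
  have h3 : (1 - M.γ) ^ 2 * (a * E₀ + 2 * E₁) ≤ 4 * D.k s₀ / a + 2 * D.k s₁ := by
    have h4 : (1 - M.γ) * (a * E₀ + 2 * E₁) / 2 ≤
        D.k s₀ / ((1 - M.γ) * a / 2) + D.k s₁ / (1 - M.γ) := by linarith
    have h5 := mul_le_mul_of_nonneg_left h4 (by positivity : 0 ≤ 2 * (1 - M.γ))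
    have e : 2 * (1 - M.γ) * (D.k s₀ / ((1 - M.γ) * a / 2) + D.k s₁ / (1 - M.γ)) =
        4 * D.k s₀ / a + 2 * D.k s₁ := by field_simp; ring
    rw [e] at h5
    linarith
  have h4 : 4 * D.k s₀ / a + 2 * D.k s₁ ≤ 9 / 4 * a := by
    rw [← le_sub_iff_add_le, div_le_iff₀ ha0]
    have e1 : D.k s₁ = 1 - D.k s₀ := by linarith
    rcases hmk' with h | h
    · have ha' : a = 29 / 24 := by rw [ha, h]; norm_num
      rw [h] at hmk
      rw [ha']
      linarith
    · have e2 : (1 + m) * D.k s₀ = 1 := by linarith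
      have h7 : 0 ≤ 9 / 4 * (1 + m) * a ^ 2 - 2 * m * a - 4 := two_state_bound hm0 hm1
      have h8 := mul_nonneg hk0 h7
      have e4 : D.k s₀ * (9 / 4 * (1 + m) * a ^ 2 - 2 * m * a - 4) =
          9 / 4 * ((1 + m) * D.k s₀) * a ^ 2 - 2 * (m * D.k s₀) * a - 4 * D.k s₀ := by ring
      rw [e4, e2, h] at h8
      linarith
  have h5 : (1 - M.γ) ^ 2 * (a * (E₀ + E₁)) ≤ (1 - M.γ) ^ 2 * (a * E₀ + 2 * E₁) := by
    have : a ≤ 2 := by rw [ha]; linarith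
    have := mul_le_mul_of_nonneg_right this hE1
    refine mul_le_mul_of_nonneg_left ?_ (sq_nonneg _)
    linarith
  have h6 : a * ((1 - M.γ) ^ 2 * (E₀ + E₁)) ≤ a * (3 / 2) ^ 2 := by linarith
  exact le_of_mul_le_mul_left h6 ha0

end Splitting

end

end CTD

/-! ### The second moment of the temporal difference error. -/

namespace CTD

set_option linter.unusedSectionVars false

noncomputable section

variable {S A : Type*} [Fintype S] [Fintype A]

/-- Second moment of the temporal difference error. -/
def noiseForm (M : MDP S A) (π : Policy S A) (k : S → ℝ) (b : S → A → ℝ) (x : S × A → ℝ) : ℝ :=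
  ∑ s, k s * ∑ a, b s a * ∑ s', M.P s a s' * ∑ a', π.prob s' a' *
    (x (s, a) - M.cost s a - M.γ * x (s', a')) ^ 2

/-- The second moment of `x` after one step. -/
def nextSq (M : MDP S A) (π : Policy S A) (k : S → ℝ) (b : S → A → ℝ) (x : S × A → ℝ) : ℝ :=
  ∑ s, k s * ∑ a, b s a * ∑ s', M.P s a s' * polSq π x s'

namespace Splitting

variable {M : MDP S A} {π : Policy S A} {ε : ℝ} (D : Splitting M π ε)

/-- For y = x - γx' and a cost in [0,1], (y - cost)² ≤ (11/10)y² + 11. The mean of y² is twice the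
Bellman integrand plus γ² times the next second moment minus x², so most of the noise is controlled
by the drift itself. -/
theorem noiseForm_le [Nonempty S] [Nonempty A] (x : S × A → ℝ) :
    noiseForm M π D.k (perturb π ε) x ≤
      11 / 10 * (2 * bellmanForm M π D.k (perturb π ε) x +
        (M.γ ^ 2 * nextSq M π D.k (perturb π ε) x - ∑ s, stateEnergy D.k (perturb π ε) x s)) +
      11 * (1 - D.g) := by
  have hε1 : ε ≤ 1 := D.ε_le_one.trans (by norm_num)
  have h1 : ∀ s a, ∑ s', M.P s a s' * ∑ a', π.prob s' a' *
      (x (s, a) - M.cost s a - M.γ * x (s', a')) ^ 2 ≤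
      11 / 10 * (2 * (x (s, a) ^ 2 - M.γ * (x (s, a) * nextMean M π x s a)) +
        (M.γ ^ 2 * ∑ s', M.P s a s' * polSq π x s' - x (s, a) ^ 2)) + 11 := by
    intro s a
    have e : 11 / 10 * (2 * (x (s, a) ^ 2 - M.γ * (x (s, a) * nextMean M π x s a)) +
        (M.γ ^ 2 * ∑ s', M.P s a s' * polSq π x s' - x (s, a) ^ 2)) + 11 =
        ∑ s', M.P s a s' * (11 / 10 * (x (s, a) ^ 2 - 2 * M.γ * (x (s, a) * polMean π x s') +
          M.γ ^ 2 * polSq π x s') + 11) := by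
      have : ∀ s', M.P s a s' * (11 / 10 * (x (s, a) ^ 2 - 2 * M.γ * (x (s, a) * polMean π x s') +
          M.γ ^ 2 * polSq π x s') + 11) = M.P s a s' * (11 / 10 * x (s, a) ^ 2 + 11) -
          11 / 5 * M.γ * x (s, a) * (M.P s a s' * polMean π x s') +
          11 / 10 * M.γ ^ 2 * (M.P s a s' * polSq π x s') := fun s' => by ring
      simp_rw [this, Finset.sum_add_distrib, Finset.sum_sub_distrib, ← Finset.mul_sum,
        ← Finset.sum_mul, M.P_sum, nextMean]
      ring
    rw [e]
    refine Finset.sum_le_sum fun s' _ => mul_le_mul_of_nonneg_left ?_ (M.P_nonneg s a s')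
    have e2 : 11 / 10 * (x (s, a) ^ 2 - 2 * M.γ * (x (s, a) * polMean π x s') +
          M.γ ^ 2 * polSq π x s') + 11 =
        ∑ a', π.prob s' a' * (11 / 10 * (x (s, a) - M.γ * x (s', a')) ^ 2 + 11) := by
      have : ∀ a', π.prob s' a' * (11 / 10 * (x (s, a) - M.γ * x (s', a')) ^ 2 + 11) =
          π.prob s' a' * (11 / 10 * x (s, a) ^ 2 + 11) -
          11 / 5 * M.γ * x (s, a) * (π.prob s' a' * x (s', a')) +
          11 / 10 * M.γ ^ 2 * (π.prob s' a' * x (s', a') ^ 2) := fun a' => by ring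
      simp_rw [this, Finset.sum_add_distrib, Finset.sum_sub_distrib, ← Finset.mul_sum,
        ← Finset.sum_mul, π.prob_sum]
      rw [polMean, polSq]
      ring
    rw [e2]
    refine Finset.sum_le_sum fun a' _ => mul_le_mul_of_nonneg_left ?_ (π.prob_nonneg s' a')
    have c0 := M.cost_nonneg s a
    have c1 := M.cost_le_one s a
    nlinarith [sq_nonneg (x (s, a) - M.γ * x (s', a') + 10 * M.cost s a)]
  have e3 : 11 / 10 * (2 * bellmanForm M π D.k (perturb π ε) x +
        (M.γ ^ 2 * nextSq M π D.k (perturb π ε) x - ∑ s, stateEnergy D.k (perturb π ε) x s)) +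
      11 * (1 - D.g) = ∑ s, D.k s * ∑ a, perturb π ε s a *
        (11 / 10 * (2 * (x (s, a) ^ 2 - M.γ * (x (s, a) * nextMean M π x s a)) +
        (M.γ ^ 2 * ∑ s', M.P s a s' * polSq π x s' - x (s, a) ^ 2)) + 11) := by
    have e4 : 11 * (1 - D.g) = ∑ s, D.k s * ∑ a, perturb π ε s a * 11 := by
      simp_rw [← Finset.sum_mul, sum_perturb, one_mul]
      rw [← Finset.sum_mul, D.k_sum]; ring
    rw [e4]
    simp only [bellmanForm, nextSq, stateEnergy]
    simp only [Finset.mul_sum, mul_add, mul_sub, Finset.sum_add_distrib, Finset.sum_sub_distrib]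
    simp only [mul_left_comm]
  rw [e3, noiseForm]
  exact Finset.sum_le_sum fun s _ => mul_le_mul_of_nonneg_left (Finset.sum_le_sum fun a _ =>
    mul_le_mul_of_nonneg_left (h1 s a) (perturb_nonneg π D.ε_nonneg hε1 s a)) (D.k_nonneg s)

theorem γ_mul_nextSq_le [Nonempty S] [Nonempty A] (x : S × A → ℝ) (hg1 : D.g ≤ 1) {u : ℝ}
    (hu : ∀ s, polSq π x s ≤ u) :
    M.γ * nextSq M π D.k (perturb π ε) x ≤
      (1 - ε) * ∑ s, D.k s * polSq π x s + ((1 - M.γ) * D.g + ε) * u := by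
  have hε0 := D.ε_nonneg
  have hε1 : ε ≤ 1 := D.ε_le_one.trans (by norm_num)
  have hG : 0 < 1 - M.γ := sub_pos.2 M.γ_lt_one
  have hg0 := D.g_nonneg
  have hu0 : 0 ≤ u := (polSq_nonneg π x (Classical.arbitrary S)).trans (hu _)
  have h1 : ∀ s, ∑ a, perturb π ε s a * ∑ s', M.P s a s' * polSq π x s' ≤
      (1 - ε) * ∑ s', stateMatrix M π s s' * polSq π x s' + ε * u := by
    intro s
    have e : ∑ s', stateMatrix M π s s' * polSq π x s' =
        ∑ a, π.prob s a * ∑ s', M.P s a s' * polSq π x s' := by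
      simp_rw [stateMatrix, Matrix.of_apply, Finset.sum_mul, Finset.mul_sum]
      rw [Finset.sum_comm]
      simp_rw [mul_assoc]
    have e2 : ε * u = ∑ _a : A, ε / Fintype.card A * u := by
      have : (Fintype.card A : ℝ) ≠ 0 := by exact_mod_cast Fintype.card_ne_zero
      rw [Finset.sum_const, Finset.card_univ, nsmul_eq_mul]
      field_simp
    rw [e, e2, Finset.mul_sum, ← Finset.sum_add_distrib]
    refine Finset.sum_le_sum fun a _ => ?_
    have h2 : ∑ s', M.P s a s' * polSq π x s' ≤ u := by
      calc _ ≤ ∑ s', M.P s a s' * u :=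
            Finset.sum_le_sum fun s' _ => mul_le_mul_of_nonneg_left (hu s') (M.P_nonneg s a s')
        _ = u := by rw [← Finset.sum_mul, M.P_sum, one_mul]
    have h3 := mul_le_mul_of_nonneg_left h2 (by positivity : 0 ≤ ε / Fintype.card A)
    rw [perturb]
    linarith
  have h2 : nextSq M π D.k (perturb π ε) x ≤
      (1 - ε) * ∑ s, D.k s * ∑ s', stateMatrix M π s s' * polSq π x s' + ε * u * (1 - D.g) := by
    rw [← D.k_sum, Finset.mul_sum, Finset.mul_sum, ← Finset.sum_add_distrib, nextSq]
    refine Finset.sum_le_sum fun s _ => ?_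
    have := mul_le_mul_of_nonneg_left (h1 s) (D.k_nonneg s)
    linarith
  have h3 : M.γ * ∑ s, D.k s * ∑ s', stateMatrix M π s s' * polSq π x s' ≤
      ∑ s, D.k s * polSq π x s + (1 - M.γ) * D.g * u := by
    have e : M.γ * ∑ s, D.k s * ∑ s', stateMatrix M π s s' * polSq π x s' =
        ∑ s', (D.k s' - (1 - M.γ) * D.ρ s' + (1 - M.γ) * D.g * D.ν s') * polSq π x s' := by
      simp_rw [Finset.mul_sum]
      rw [Finset.sum_comm]
      refine Finset.sum_congr rfl fun s' _ => ?_
      rw [← D.flow s', Finset.mul_sum, Finset.sum_mul]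
      exact Finset.sum_congr rfl fun s _ => by ring
    have e2 : u = ∑ s, D.ν s * u := by rw [← Finset.sum_mul, D.ν_sum, one_mul]
    rw [e, e2, Finset.mul_sum, ← Finset.sum_add_distrib]
    refine Finset.sum_le_sum fun s _ => ?_
    have a1 := polSq_nonneg π x s
    have a2 : 0 ≤ (1 - M.γ) * D.ρ s * polSq π x s :=
      mul_nonneg (mul_nonneg hG.le (D.ρ_nonneg s)) a1
    have a3 := mul_le_mul_of_nonneg_left (mul_le_mul_of_nonneg_left (hu s) (D.ν_nonneg s))
      (mul_nonneg hG.le hg0)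
    linarith
  have h4 := mul_le_mul_of_nonneg_left h2 M.γ_nonneg
  have h5 := mul_le_mul_of_nonneg_left h3 (sub_nonneg.2 hε1)
  have h6 : (1 - ε) * ((1 - M.γ) * D.g * u) ≤ 1 * ((1 - M.γ) * D.g * u) := by gcongr; linarith
  have h7 : M.γ * (ε * u * (1 - D.g)) ≤ 1 * (ε * u * 1) := by
    have := M.γ_lt_one.le
    gcongr
    linarith
  linarith

/-- By the flow identity the second moment grows in one step only through the boundary mass (1-γ)g
and the exploration ε. The first contributes at most (1-γ) times the full energy, the second at most
a third of that. -/
theorem γ_sq_mul_nextSq_sub_le [Nonempty S] [Nonempty A] (x : S × A → ℝ) (hg1 : D.g ≤ 1)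
    (hZ : D.g * ∑ s, actSq x s ≤ ∑ s, stateEnergy D.κ (perturb π ε) x s) :
    M.γ ^ 2 * nextSq M π D.k (perturb π ε) x - ∑ s, stateEnergy D.k (perturb π ε) x s ≤
      4 / 3 * (1 - M.γ) * ∑ s, stateEnergy D.κ (perturb π ε) x s := by
  have hε0 := D.ε_nonneg
  have hε4 := D.ε_le_one
  have hε1 : ε ≤ 1 := by linarith
  have hG : 0 < 1 - M.γ := sub_pos.2 M.γ_lt_one
  have hg0 := D.g_nonneg
  have hγ := M.γ_nonneg
  obtain ⟨s₀, -, hs₀⟩ := Finset.exists_max_image Finset.univ (fun s => polSq π x s)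
    Finset.univ_nonempty
  have h1 := D.γ_mul_nextSq_le x hg1 (u := polSq π x s₀) (fun s => hs₀ s (Finset.mem_univ s))
  set u := polSq π x s₀ with hu
  have hu0 : 0 ≤ u := polSq_nonneg π x s₀
  set Z := ∑ s, stateEnergy D.κ (perturb π ε) x s with hZd
  have hκ : ∀ s, 0 ≤ D.κ s := fun s => add_nonneg (D.k_nonneg s) (mul_nonneg hg0 (D.rest_nonneg s))
  have h2 : D.g * u ≤ Z := by
    refine le_trans (mul_le_mul_of_nonneg_left ?_ hg0) hZ
    exact (polSq_le_actSq π x s₀).trans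
      (Finset.single_le_sum (fun s _ => actSq_nonneg x s) (Finset.mem_univ s₀))
  have h3 : ε * u ≤ (1 - M.γ) / 3 * Z := by
    have a1 : D.κ s₀ * ((1 - ε) * u) ≤ Z :=
      (mul_le_mul_of_nonneg_left (sum_perturb_sq_ge π hε0 x s₀) (hκ s₀)).trans
        (Finset.single_le_sum (fun s _ => stateEnergy_nonneg hκ π hε0 hε1 x s)
          (Finset.mem_univ s₀))
    have a2 : D.α * ((1 - ε) * u) ≤ D.κ s₀ * ((1 - ε) * u) :=
      mul_le_mul_of_nonneg_right (D.α_le s₀) (mul_nonneg (by linarith) hu0)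
    have a3 : D.α * (3 / 4 * u) ≤ D.α * ((1 - ε) * u) := by
      have := D.α_nonneg
      gcongr
      linarith
    have a4 := mul_le_mul_of_nonneg_right D.ε_le hu0
    have a5 := mul_le_mul_of_nonneg_left (a3.trans (a2.trans a1)) hG.le
    linarith
  have h4 : (1 - ε) * ∑ s, D.k s * polSq π x s ≤ ∑ s, stateEnergy D.k (perturb π ε) x s := by
    rw [Finset.mul_sum]
    refine Finset.sum_le_sum fun s _ => ?_
    have := mul_le_mul_of_nonneg_left (sum_perturb_sq_ge π hε0 x s) (D.k_nonneg s)
    rw [stateEnergy]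
    linarith
  have h5 : 0 ≤ nextSq M π D.k (perturb π ε) x :=
    Finset.sum_nonneg fun s _ => mul_nonneg (D.k_nonneg s) (Finset.sum_nonneg fun a _ =>
      mul_nonneg (perturb_nonneg π hε0 hε1 s a) (Finset.sum_nonneg fun s' _ =>
        mul_nonneg (M.P_nonneg s a s') (polSq_nonneg π x s')))
  have h6 : M.γ ^ 2 * nextSq M π D.k (perturb π ε) x ≤ M.γ * nextSq M π D.k (perturb π ε) x := by
    have := M.γ_lt_one.le
    nlinarith [mul_nonneg hγ h5]
  have h7 := mul_le_mul_of_nonneg_left h2 hG.le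
  linarith

/-- The drift inequality that takes the noise into account. -/
def NoisyDrift (ϖ c C : ℝ) (x : S × A → ℝ) : Prop :=
  ϖ * ((1 - M.γ) * c * ∑ s, stateEnergy D.κ (perturb π ε) x s - C / (1 - M.γ)) ≤
    bellmanForm M π D.k (perturb π ε) x - costForm M D.k (perturb π ε) x -
      (1 - M.γ) / 1024 * noiseForm M π D.k (perturb π ε) x

/-- The noise uses up the fraction 22(1-γ)/10240 of the Bellman form. The drift is applied with b =
1/(y(1-γ)), where y is the remaining fraction; the decimals round y, 1/y and the other noise terms.
-/
theorem Drift.noisy [Nonempty S] [Nonempty A] {D : Splitting M π ε} {ϖ c₁ C₀ : ℝ}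
    {x : S × A → ℝ} (h : D.Drift ϖ c₁ C₀ x) (hϖ : 0 ≤ ϖ) (hc₁ : 0 ≤ c₁) (hC₀ : 0 ≤ C₀)
    (hϖg : 1 - D.g ≤ ϖ)
    (hn : M.γ ^ 2 * nextSq M π D.k (perturb π ε) x - ∑ s, stateEnergy D.k (perturb π ε) x s ≤
      4 / 3 * (1 - M.γ) * ϖ * ∑ s, stateEnergy D.κ (perturb π ε) x s) :
    D.NoisyDrift ϖ (9978 / 10000 * c₁ - 144 / 100000) (10022 / 10000 * C₀ + 108 / 10000) x := by
  have hG : 0 < 1 - M.γ := sub_pos.2 M.γ_lt_one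
  have hG1 : 1 - M.γ ≤ 1 := by linarith [M.γ_nonneg]
  have hε1 : ε ≤ 1 := D.ε_le_one.trans (by norm_num)
  have hκ : ∀ s, 0 ≤ D.κ s := fun s =>
    add_nonneg (D.k_nonneg s) (mul_nonneg D.g_nonneg (D.rest_nonneg s))
  have hZ0 : 0 ≤ ∑ s, stateEnergy D.κ (perturb π ε) x s :=
    Finset.sum_nonneg fun s _ => stateEnergy_nonneg hκ π D.ε_nonneg hε1 x s
  have hN := D.noiseForm_le x
  unfold NoisyDrift
  set G := 1 - M.γ with hGd
  set Z := ∑ s, stateEnergy D.κ (perturb π ε) x s with hZd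
  set q := bellmanForm M π D.k (perturb π ε) x with hq
  set L := costForm M D.k (perturb π ε) x with hL
  set y := 1 - 22 / 10240 * G with hy
  have hy0 : 0 < y := by rw [hy]; linarith
  have hy1 : 9978 / 10000 ≤ y := by rw [hy]; linarith
  have h1 := h (1 / (y * G))
  rw [← hGd, ← hL, ← hq, ← hZd] at h1
  have h2 : L ≤ y * q + G * ϖ * (C₀ / (y * G ^ 2) - y * c₁ * Z) := by
    have h3 := mul_le_mul_of_nonneg_left h1 (by positivity : 0 ≤ y / 2)
    have e1 : y / 2 * (2 * (1 / (y * G)) * L * G) = L := by field_simp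
    have e2 : y / 2 * (2 * q + G * ϖ * (2 * C₀ * (1 / (y * G)) ^ 2 - 2 * c₁ * Z)) =
        y * q + G * ϖ * (C₀ / (y * G ^ 2) - y * c₁ * Z) := by field_simp
    rw [e1, e2] at h3
    exact h3
  have h3 : G / 1024 * noiseForm M π D.k (perturb π ε) x ≤
      G / 1024 * (11 / 10 * (2 * q + 4 / 3 * G * ϖ * Z) + 11 * ϖ) := by
    refine mul_le_mul_of_nonneg_left (hN.trans ?_) (by positivity)
    linarith
  have h4 : G * ϖ * (C₀ / (y * G ^ 2)) ≤ ϖ * (10022 / 10000 * C₀ / G) := by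
    have e : G * ϖ * (C₀ / (y * G ^ 2)) = ϖ * (1 / y * C₀ / G) := by field_simp
    rw [e]
    have : 1 / y ≤ 10022 / 10000 := by
      rw [div_le_iff₀ hy0]; linarith
    gcongr
  have h5 : G * ϖ * (9978 / 10000 * c₁ * Z) ≤ G * ϖ * (y * c₁ * Z) := by gcongr
  have h6 : G / 1024 * (11 * ϖ) ≤ ϖ * (108 / 10000 / G) := by
    have : G ≤ 1 / G := by rw [le_div_iff₀ hG]; nlinarith
    have := mul_le_mul_of_nonneg_left this hϖ
    have e : ϖ * (108 / 10000 / G) = 108 / 10000 * (ϖ * (1 / G)) := by ring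
    rw [e]
    have : 0 ≤ ϖ * G := by positivity
    linarith
  have h7 : G / 1024 * (11 / 10 * (4 / 3 * G * ϖ * Z)) ≤ G * ϖ * (144 / 100000 * Z) := by
    have a : 0 ≤ G * ϖ * Z := by positivity
    have := mul_le_mul_of_nonneg_right hG1 a
    linarith
  have e1 : ϖ * (G * (9978 / 10000 * c₁ - 144 / 100000) * Z -
      (10022 / 10000 * C₀ + 108 / 10000) / G) = G * ϖ * (9978 / 10000 * c₁ * Z) -
      G * ϖ * (144 / 100000 * Z) - ϖ * (10022 / 10000 * C₀ / G) - ϖ * (108 / 10000 / G) := by ring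
  have e2 : y * q = q - 22 / 10240 * G * q := by rw [hy]; ring
  rw [e1]
  linarith

end Splitting

end

end CTD

/-! ### Choice of the constants according to the number of states. -/

namespace CTD

set_option linter.unusedSectionVars false

noncomputable section

variable {S A : Type*} [Fintype S] [Fintype A]

namespace Splitting

variable {M : MDP S A} {π : Policy S A} {ε : ℝ}

/-- With one state, k is the mass 1-g and everything scales with it, so the drift holds for any x
but with the rate 1-g. The dissipation is at least 15/8 and Young's inequality takes 1, leaving 2c₁
= 7/8. -/
theorem noisyDrift_of_card_eq_one [Nonempty A] (hn : Fintype.card S = 1) (D : Splitting M π ε)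
    (hg1 : D.g ≤ 1) (x : S × A → ℝ) :
    D.NoisyDrift (1 - D.g) (9978 / 10000 * (7 / 16) - 144 / 100000)
      (10022 / 10000 * (1 / 2) + 108 / 10000) x := by
  have : Nonempty S := Fintype.card_pos_iff.1 (by omega)
  have : Subsingleton S := Fintype.card_le_one_iff_subsingleton.1 hn.le
  have hG : 0 < 1 - M.γ := sub_pos.2 M.γ_lt_one
  have hε0 := D.ε_nonneg
  have hε1 : ε ≤ 1 := D.ε_le_one.trans (by norm_num)
  have hp : 0 ≤ 1 - D.g := by linarith
  obtain ⟨s₀, -, h⟩ := D.dissipation_chain hg1 x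
  have hsum : ∀ f : S → ℝ, ∑ s, f s = f s₀ := fun f => Fintype.sum_subsingleton f s₀
  have hk := D.k_sum
  have hrest := D.rest_sum
  rw [hsum] at hk hrest
  have hκ : D.κ s₀ = 1 := by rw [κ, hk, hrest]; ring
  have hα := D.α_le s₀
  rw [hk, hrest] at hα
  have hγT := D.γ_mul_le_sum_perturb_sq x s₀
  have hT0 : 0 ≤ ∑ a, perturb π ε s₀ a * x (s₀, a) ^ 2 :=
    Finset.sum_nonneg fun a _ => mul_nonneg (perturb_nonneg π hε0 hε1 s₀ a) (sq_nonneg _)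
  have hγ := M.γ_nonneg
  have hH : ∑ s, stateEnergy D.k (perturb π ε) x s =
      (1 - D.g) * ∑ a, perturb π ε s₀ a * x (s₀, a) ^ 2 := by rw [hsum, stateEnergy, hk]
  have hZ : ∑ s, stateEnergy D.κ (perturb π ε) x s =
      ∑ a, perturb π ε s₀ a * x (s₀, a) ^ 2 := by rw [hsum, stateEnergy, hκ, one_mul]
  set T := ∑ a, perturb π ε s₀ a * x (s₀, a) ^ 2 with hT
  refine Drift.noisy (D := D) (x := x) ?_ hp (by norm_num) (by norm_num) le_rfl ?_
  · intro b
    have h1 := D.two_mul_costForm_le_uniform x zero_lt_one b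
    rw [hn, hH] at h
    rw [hH] at h1
    rw [hZ]
    have h2 : D.α * (M.γ * polMean π x s₀ ^ 2) ≤ 1 * T :=
      mul_le_mul (by linarith)
        ((mul_le_mul_of_nonneg_left (polMean_sq_le π x s₀) hγ).trans hγT)
        (mul_nonneg hγ (sq_nonneg _)) zero_le_one
    have h3 := mul_le_mul_of_nonneg_left h2 (mul_nonneg hG.le hp)
    have h4 := mul_le_mul_of_nonneg_left h1 hG.le
    norm_num at h
    norm_num at h4
    linarith
  · rw [hH, hZ]
    have h1 : nextSq M π D.k (perturb π ε) x = (1 - D.g) * polSq π x s₀ := by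
      have e : ∀ a, ∑ s', M.P s₀ a s' * polSq π x s' = polSq π x s₀ := fun a => by
        have := M.P_sum s₀ a
        rw [hsum] at this ⊢
        rw [this, one_mul]
      rw [nextSq, hsum, hk]
      simp_rw [e, ← Finset.sum_mul, sum_perturb, one_mul]
    rw [h1]
    have h2 : M.γ ^ 2 * polSq π x s₀ ≤ T := by
      refine le_trans ?_ hγT
      have := polSq_nonneg π x s₀
      have := M.γ_lt_one.le
      nlinarith [mul_nonneg hγ (polSq_nonneg π x s₀)]
    have h3 := mul_le_mul_of_nonneg_left h2 hp
    have : 0 ≤ 4 / 3 * (1 - M.γ) * (1 - D.g) * T := by positivity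
    linarith

theorem noisyDrift_of_certificate [Nonempty A] (D : Splitting M π ε) (hn : 2 ≤ Fintype.card S)
    (hg0 : 0 < D.g)
    (hgn : √(Fintype.card S) * D.g ≤ 1) {x : S × A → ℝ}
    (hx : √(Fintype.card S) * D.g * ∑ s, actSq x s ≤ ∑ s, stateEnergy D.κ (perturb π ε) x s)
    {s c c₁ C₀ f σ σ' ρ₀ θ : ℝ} (hs : s ^ 2 ≤ Fintype.card S) (hc0 : 0 ≤ c)
    (hc1 : c ≤ 1) (hc : c ≤ (2 * (Fintype.card S : ℝ) - 3)⁻¹) (hc₁ : 0 ≤ c₁) (hC₀ : 0 < C₀)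
    (hf : 1 - D.g ≤ f) (hσ : σ' * D.g ≤ σ) (hρ : 1 ≤ ρ₀ * (1 - 1 / (4 * (Fintype.card S : ℝ))))
    (hθ : θ = (1 + σ) / (2 * C₀))
    (hcert : ∀ r : ℝ, 0 ≤ r → r ≤ 1 → Certificate s c c₁ f σ σ' ρ₀ (betaFn (c / (1 + c)) r)
      (phiFn r) (s * (1 + r ^ 2) - 1) θ) :
    D.NoisyDrift 1 (9978 / 10000 * c₁ - 144 / 100000) (10022 / 10000 * C₀ + 108 / 10000) x := by
  have : Nonempty S := Fintype.card_pos_iff.1 (by omega)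
  have hsn : s ≤ √(Fintype.card S) := Real.le_sqrt_of_sq_le hs
  have hn1 : 1 ≤ √(Fintype.card S : ℝ) :=
    Real.one_le_sqrt.2 (by exact_mod_cast (by omega : 1 ≤ Fintype.card S))
  have hg1 : D.g ≤ 1 := by nlinarith
  have hN : 0 ≤ D.g * ∑ s, actSq x s :=
    mul_nonneg hg0.le (Finset.sum_nonneg fun s _ => actSq_nonneg x s)
  subst hθ
  refine Drift.noisy (D.drift_of_certificate hn hg0 hg1 x hc0 hc1 hc hC₀ ?_ hf hσ hρ hcert)
    zero_le_one hc₁ hC₀.le (by linarith) ?_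
  · refine le_trans ?_ hx
    rw [mul_assoc, mul_assoc]
    gcongr
  · rw [mul_one]
    refine D.γ_sq_mul_nextSq_sub_le x hg1 (le_trans ?_ hx)
    rw [mul_assoc]
    exact le_mul_of_one_le_left hN hn1

/-- Numerical constants for which the drift is strong enough. -/
structure Constants (M : MDP S A) (π : Policy S A) (ε c C X R : ℝ) : Prop where
  c_pos : 0 < c
  c_le_one : c ≤ 1
  C_nonneg : 0 ≤ C
  X_pos : 0 < X
  R_pos : 0 < R
  C_le : C ≤ R ^ 2 * c
  add_sq_le : (R + X) ^ 2 ≤ 40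
  mul_le : R * (R + X) ≤ 800 * c
  drift : ∀ D : Splitting M π ε, 0 < D.g → √(Fintype.card S) * D.g ≤ 1 → ∀ x : S × A → ℝ,
    √(Fintype.card S) * D.g * ∑ s, actSq x s ≤ ∑ s, stateEnergy D.κ (perturb π ε) x s →
    D.NoisyDrift 1 c C x
  energy : ∀ D : Splitting M π ε, D.g = 0 → ∀ x : S × A → ℝ,
    bellmanForm M π D.k (perturb π ε) x ≤ costForm M D.k (perturb π ε) x →
    (1 - M.γ) ^ 2 * ∑ s, stateEnergy D.k (perturb π ε) x s ≤ X ^ 2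

/-- R/(1-γ) is the size allowed to the iterates and X/(1-γ) that of the solution; the tight
requirement is R + X ≤ √40. Hence the separate treatment of few states. -/
theorem exists_constants [Nonempty A] (hn : 2 ≤ Fintype.card S) :
    ∃ c C X R, Constants M π ε c C X R := by
  have : Nonempty S := Fintype.card_pos_iff.1 (by omega)
  have hX : ∀ X : ℝ, (2 / (7 / 8 + (2 * (Fintype.card S : ℝ) - 1)⁻¹)) ≤ X →
      ∀ D : Splitting M π ε, D.g = 0 → ∀ x : S × A → ℝ,
        bellmanForm M π D.k (perturb π ε) x ≤ costForm M D.k (perturb π ε) x →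
        (1 - M.γ) ^ 2 * ∑ s, stateEnergy D.k (perturb π ε) x s ≤ X ^ 2 := by
    intro X hX D hg x hx
    refine (D.energy_le_of_eq hg x hx).trans (pow_le_pow_left₀ ?_ hX 2)
    have : (1 : ℝ) ≤ Fintype.card S := by exact_mod_cast Fintype.card_pos
    have : 0 ≤ (2 * (Fintype.card S : ℝ) - 1)⁻¹ := inv_nonneg.2 (by linarith)
    positivity
  rcases hn.eq_or_lt with h2 | hn3
  · have h2' : (Fintype.card S : ℝ) = 2 := by exact_mod_cast h2.symm
    refine ⟨9978 / 10000 * (1 / 20) - 144 / 100000, 10022 / 10000 * (11 / 10) + 108 / 10000,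
      3 / 2, 24 / 5, by norm_num, by norm_num, by norm_num, by norm_num, by norm_num, by norm_num, by norm_num,
      by norm_num, fun D hg0 hgn x hx => ?_,
      fun D hg x hx => D.energy_le_of_eq_of_card_eq_two h2.symm hg x hx⟩
    have hg : D.g ≤ 7072 / 10000 := by
      have h3 : 14141 / 10000 ≤ √(Fintype.card S : ℝ) :=
        Real.le_sqrt_of_sq_le (by rw [h2']; norm_num)
      nlinarith
    have key := @noisyDrift_of_certificate S A _ _ M π ε _ D hn hg0 hgn x hx (7071 / 5000) 1
      (1 / 20) (11 / 10)
    rw [h2'] at key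
    rcases le_total D.g (11 / 50) with h3 | h3
    · exact key (by norm_num) (by norm_num) (by norm_num) (by norm_num) (by norm_num)
        (by norm_num) (by linarith) (by linarith) (by norm_num) (by norm_num)
        certificate_two_1
    rcases le_total D.g (9 / 25) with h4 | h4
    · exact key (by norm_num) (by norm_num) (by norm_num) (by norm_num) (by norm_num)
        (by norm_num) (by linarith) (by linarith) (by norm_num) (by norm_num)
        certificate_two_2
    rcases le_total D.g (1 / 2) with h5 | h5
    · exact key (by norm_num) (by norm_num) (by norm_num) (by norm_num) (by norm_num)
        (by norm_num) (by linarith) (by linarith) (by norm_num) (by norm_num)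
        certificate_two_3
    · exact key (by norm_num) (by norm_num) (by norm_num) (by norm_num) (by norm_num)
        (by norm_num) (by linarith) (by linarith) (by norm_num) (by norm_num)
        certificate_two_4
  rcases (Nat.succ_le_of_lt hn3).eq_or_lt with h3 | hn4
  · have h3' : (Fintype.card S : ℝ) = 3 := by exact_mod_cast h3.symm
    refine ⟨9978 / 10000 * (19 / 200) - 144 / 100000, 10022 / 10000 * (171 / 100) + 108 / 10000,
      80 / 43, 43 / 10, by norm_num, by norm_num, by norm_num, by norm_num, by norm_num, by norm_num,
      by norm_num, by norm_num, fun D hg0 hgn x hx => ?_, hX _ (by rw [h3']; norm_num)⟩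
    have key := @noisyDrift_of_certificate S A _ _ M π ε _ D hn hg0 hgn x hx (433 / 250) (1 / 3)
      (19 / 200) (171 / 100)
    rw [h3'] at key
    exact key (by norm_num) (by norm_num) (by norm_num) (by norm_num) (by norm_num)
      (by norm_num) (by linarith) (by linarith) (by norm_num) (by norm_num)
      certificate_three
  rcases (Nat.succ_le_of_lt hn4).eq_or_lt with h4 | hn5
  · have h4' : (Fintype.card S : ℝ) = 4 := by exact_mod_cast h4.symm
    refine ⟨9978 / 10000 * (11 / 100) - 144 / 100000, 10022 / 10000 * (341 / 200) + 108 / 10000,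
      2, 4, by norm_num, by norm_num, by norm_num, by norm_num, by norm_num, by norm_num,
      by norm_num, by norm_num, fun D hg0 hgn x hx => ?_, hX _ (by rw [h4']; norm_num)⟩
    have key := @noisyDrift_of_certificate S A _ _ M π ε _ D hn hg0 hgn x hx 2 (1 / 5)
      (11 / 100) (341 / 200)
    rw [h4'] at key
    exact key (by norm_num) (by norm_num) (by norm_num) (by norm_num) (by norm_num)
      (by norm_num) (by linarith) (by linarith) (by norm_num) (by norm_num)
      certificate_four
  have hn5' : (5 : ℝ) ≤ Fintype.card S := by exact_mod_cast hn5
  have hρ : ∀ ρ₀ N : ℝ, 0 ≤ ρ₀ → 0 < N → N ≤ Fintype.card S → 1 ≤ ρ₀ * (1 - 1 / (4 * N)) →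
      1 ≤ ρ₀ * (1 - 1 / (4 * (Fintype.card S : ℝ))) := by
    intro ρ₀ N h0 hN h1 h2
    refine h2.trans ?_
    gcongr
  rcases lt_or_ge (Fintype.card S) 7 with h6 | hn7
  · have h6' : (Fintype.card S : ℝ) ≤ 6 := by exact_mod_cast (by omega : Fintype.card S ≤ 6)
    refine ⟨9978 / 10000 * (23 / 200) - 144 / 100000, 10022 / 10000 * (667 / 400) + 108 / 10000,
      21 / 10, 4, by norm_num, by norm_num, by norm_num, by norm_num, by norm_num, by norm_num,
      by norm_num, by norm_num, fun D hg0 hgn x hx => ?_, hX _ ?_⟩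
    · exact @noisyDrift_of_certificate S A _ _ M π ε _ D hn hg0 hgn x hx (559 / 250) (1 / 9)
        (23 / 200) (667 / 400) _ _ _ _ _ (by linarith) (by norm_num) (by norm_num)
        (by rw [le_inv_comm₀ (by norm_num) (by linarith)]; linarith)
        (by norm_num) (by norm_num) (by linarith) (by linarith)
        (hρ (20 / 19) 5 (by norm_num) (by norm_num) hn5' (by norm_num)) (by norm_num)
        certificate_five
    · have : (1 / 11 : ℝ) ≤ (2 * (Fintype.card S : ℝ) - 1)⁻¹ := by
        rw [le_inv_comm₀ (by norm_num) (by linarith)]; linarith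
      rw [div_le_iff₀ (by linarith)]
      linarith
  · have hn7' : (7 : ℝ) ≤ Fintype.card S := by exact_mod_cast hn7
    have hinv : ∀ t : ℝ, t ≤ 3 → 0 ≤ (2 * (Fintype.card S : ℝ) - t)⁻¹ := fun t ht =>
      inv_nonneg.2 (by linarith)
    refine ⟨9978 / 10000 * (11 / 100) - 144 / 100000, 10022 / 10000 * (77 / 50) + 108 / 10000,
      16 / 7, 4, by norm_num, by norm_num, by norm_num, by norm_num, by norm_num, by norm_num,
      by norm_num, by norm_num, fun D hg0 hgn x hx => ?_, hX _ ?_⟩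
    · exact @noisyDrift_of_certificate S A _ _ M π ε _ D hn hg0 hgn x hx (26457 / 10000) 0
        (11 / 100) (77 / 50) _ _ _ _ _ (by linarith) (by norm_num) (by norm_num)
        (hinv 3 le_rfl)
        (by norm_num) (by norm_num) (by linarith) (by linarith)
        (hρ (28 / 27) 7 (by norm_num) (by norm_num) hn7' (by norm_num)) (by norm_num)
        certificate_seven
    · have := hinv 1 (by norm_num)
      rw [div_le_iff₀ (by linarith)]
      linarith

end Splitting

end

end CTD

/-! ### The law of the sampled pair given the past. -/

namespace CTD

set_option linter.unusedSectionVars false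

noncomputable section

theorem measureReal_eq_sum_inter {Ω ι : Type*} [MeasurableSpace Ω] (μ : Measure Ω)
    [IsFiniteMeasure μ] [Fintype ι] {f : Ω → ι} (hf : ∀ i, MeasurableSet (f ⁻¹' {i}))
    (X : Set Ω) : μ.real X = ∑ i, μ.real (X ∩ f ⁻¹' {i}) := by
  have h := sum_measureReal_preimage_singleton (μ := μ.restrict X) Finset.univ (fun i _ => hf i)
  simp only [Finset.coe_univ, Set.preimage_univ, measureReal_restrict_apply_univ] at h
  rw [← h]
  exact Finset.sum_congr rfl fun i _ => by
    rw [measureReal_restrict_apply (hf i), Set.inter_comm]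

variable {S A : Type*} [Fintype S] [Fintype A] [DecidableEq S] [DecidableEq A]

theorem sum_behavior [Nonempty A] (π : Policy S A) (p : Params S) (q : S) (k : ℕ) (s : ℕ → S)
    (i : ℕ) : ∑ a, behavior π p q k s i a = 1 := by
  unfold behavior
  split_ifs
  exacts [sum_perturb π _ _, sum_perturb π _ _, π.prob_sum _]

/-- The policy used `i` steps after the target has been hit. -/
def phasePolicy (π : Policy S A) (p : Params S) (k i : ℕ) (s : S) (a : A) : ℝ :=
  if i = k then perturb π p.εA s a else π.prob s a

theorem sum_phasePolicy [Nonempty A] (π : Policy S A) (p : Params S) (k i : ℕ) (s : S) :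
    ∑ a, phasePolicy π p k i s a = 1 := by
  unfold phasePolicy
  split_ifs
  exacts [sum_perturb π _ _, π.prob_sum _]

theorem hittingTime_eq {s : ℕ → S} {q : S} {j : ℕ} (h : ∀ i < j, s i ≠ q) (hj : s j = q) :
    hittingTime s q = j := by
  refine le_antisymm (Nat.sInf_le hj) (le_csInf ⟨j, hj⟩ fun i hi => ?_)
  by_contra hlt
  exact h i (not_le.1 hlt) hi

theorem behavior_eq_phasePolicy (π : Policy S A) (p : Params S) {q : S} (k : ℕ) {s : ℕ → S}
    {j : ℕ} (h : ∀ i < j, s i ≠ q) (hj : s j = q) (i : ℕ) (a : A) :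
    behavior π p q k s (j + i) a = phasePolicy π p k i (s (j + i)) a := by
  have h1 : ¬ ∀ l ≤ j + i, s l ≠ q := fun hn => hn j (Nat.le_add_right _ _) hj
  rw [behavior, if_neg h1, hittingTime_eq h hj, phasePolicy]
  simp only [Nat.add_left_cancel_iff]

/-- Discounted visitation distribution of the target phase, truncated at the mixing time. -/
def truncVisitation (M : MDP S A) (π : Policy S A) (p : Params S) (s : S) : ℝ :=
  ∑ k ∈ Finset.range p.m, (1 - M.γ) * M.γ ^ k * ∑ q, originLaw p q * (stateMatrix M π ^ k) q s

namespace Run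

variable {M : MDP S A} {π : Policy S A} {p : Params S}
  {Ω : Type*} [mΩ : MeasurableSpace Ω] {ℙ : Measure Ω} [IsProbabilityMeasure ℙ]
  (R : Run M π p ℙ)

theorem measurableSet_len (t k : ℕ) : MeasurableSet {ω | R.len t ω = k} :=
  R.hist.le (t + 1) _ (R.len_meas t k)

theorem measurableSet_target (t : ℕ) (q : S) : MeasurableSet {ω | R.target t ω = q} :=
  R.hist.le (t + 1) _ (R.target_meas t q)

theorem measurableSet_state (t i : ℕ) (s : S) : MeasurableSet {ω | R.state t i ω = s} :=
  R.hist.le (t + 1) _ (R.state_meas t i s)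

theorem measurableSet_action (t i : ℕ) (a : A) : MeasurableSet {ω | R.action t i ω = a} :=
  R.hist.le (t + 1) _ (R.action_meas t i a)

theorem measurableSet_pair (t i : ℕ) (z : S × A) : MeasurableSet {ω | R.pair t i ω = z} := by
  have : {ω | R.pair t i ω = z} = {ω | R.state t i ω = z.1} ∩ {ω | R.action t i ω = z.2} := by
    ext ω; simp [pair, Prod.ext_iff]
  rw [this]
  exact (R.measurableSet_state t i z.1).inter (R.measurableSet_action t i z.2)

/-- The event that the length is `k`, the target is `q`, the target is not hit before time `j`,
and, if `j ≤ n`, it is hit at time `j`. -/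
def hitEvent (t k : ℕ) (q : S) (j n : ℕ) : Set Ω :=
  {ω | R.len t ω = k ∧ R.target t ω = q ∧ (∀ i < j, R.state t i ω ≠ q) ∧
    (j ≤ n → R.state t j ω = q)}

theorem hitEvent_eq {t k : ℕ} {q : S} {j n : ℕ} (h : j ≤ n) :
    R.hitEvent t k q j n = R.hitEvent t k q j j := by
  ext ω; simp [hitEvent, h]

theorem measurableSet_hitEvent (t k : ℕ) (q : S) (j n : ℕ) :
    MeasurableSet (R.hitEvent t k q j n) := by
  have : R.hitEvent t k q j n = {ω | R.len t ω = k} ∩ ({ω | R.target t ω = q} ∩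
      ((⋂ i ∈ Set.Iio j, {ω | R.state t i ω = q}ᶜ) ∩
        (if j ≤ n then {ω | R.state t j ω = q} else Set.univ))) := by
    ext ω
    by_cases h : j ≤ n <;> simp [hitEvent, h]
  rw [this]
  refine (R.measurableSet_len t k).inter ((R.measurableSet_target t q).inter
    (MeasurableSet.inter ?_ ?_))
  · exact MeasurableSet.biInter (Set.to_countable _) fun i _ => (R.measurableSet_state t i q).compl
  · split_ifs
    exacts [R.measurableSet_state t j q, MeasurableSet.univ]

/-- The event that the length is `k`, the target is `q` and the trajectory starts with `(s, a)`. -/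
def pathEvent (t k : ℕ) (q : S) (n : ℕ) (s : ℕ → S) (a : ℕ → A) : Set Ω :=
  {ω | R.len t ω = k ∧ R.target t ω = q ∧
    ∀ i ≤ n, R.state t i ω = s i ∧ R.action t i ω = a i}

theorem path_step {t : ℕ} {B : Set Ω} (hB : MeasurableSet[R.hist t] B) {k : ℕ} (hk : k < p.m)
    {q : S} {n : ℕ} {s : ℕ → S} (a : ℕ → A) (hs : ∀ j, j + k + 1 < n + 1 → s j ≠ q) :
    ℙ.real (B ∩ R.pathEvent t k q (n + 1) s a) = ℙ.real (B ∩ R.pathEvent t k q n s a) *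
      (M.P (s n) (a n) (s (n + 1)) * behavior π p q k s (n + 1) (a (n + 1))) := by
  have h1 := R.path_law t B hB k q (n + 1) s a hk hs
  have h2 := R.path_law t B hB k q n s a hk fun j hj => hs j (by omega)
  rw [pathEvent, pathEvent, h1, h2,
    Finset.prod_range_succ (fun i => behavior π p q k s i (a i)) (n + 1),
    Finset.prod_range_succ (fun i => M.P (s i) (a i) (s (i + 1))) n]
  ring

/-- The first states and actions. -/
def initial (t n : ℕ) (ω : Ω) : Fin (n + 1) → S × A := fun i => R.pair t i ω

theorem measurableSet_initial (t n : ℕ) (v : Fin (n + 1) → S × A) :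
    MeasurableSet (R.initial t n ⁻¹' {v}) := by
  have : R.initial t n ⁻¹' {v} = ⋂ i : Fin (n + 1), {ω | R.pair t i ω = v i} := by
    ext ω
    simp only [Set.mem_preimage, Set.mem_singleton_iff, Set.mem_iInter, Set.mem_ofPred_eq,
      funext_iff, initial]
  rw [this]
  exact MeasurableSet.iInter fun i => R.measurableSet_pair t i (v i)

/-- The Markov property, obtained by summing the path law over all initial segments. For i = 0 the
step is the one that hits the target; i ≤ k+1 is exactly the range in which the path law is
prescribed. -/
theorem pair_step {t : ℕ} {B : Set Ω} (hB : MeasurableSet[R.hist t] B) {k : ℕ} (hk : k < p.m)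
    {q : S} {j n i : ℕ} (hn : n + 1 = j + i) (hik : i ≤ k + 1) (z z' : S × A)
    (hz' : i = 0 → z'.1 = q) :
    ℙ.real (B ∩ R.hitEvent t k q j n ∩ {ω | R.pair t n ω = z} ∩ {ω | R.pair t (n + 1) ω = z'}) =
      ℙ.real (B ∩ R.hitEvent t k q j n ∩ {ω | R.pair t n ω = z}) *
        (M.P z.1 z.2 z'.1 * phasePolicy π p k i z'.1 z'.2) := by
  rw [measureReal_eq_sum_inter ℙ (R.measurableSet_initial t n),
    measureReal_eq_sum_inter ℙ (R.measurableSet_initial t n)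
      (B ∩ R.hitEvent t k q j n ∩ {ω | R.pair t n ω = z}), Finset.sum_mul]
  refine Finset.sum_congr rfl fun v _ => ?_
  set s : ℕ → S := fun i => if h : i < n + 1 then (v ⟨i, h⟩).1 else z'.1 with hs
  set a : ℕ → A := fun i => if h : i < n + 1 then (v ⟨i, h⟩).2 else z'.2 with ha
  have hsn : s (n + 1) = z'.1 := by simp [hs]
  have han : a (n + 1) = z'.2 := by simp [ha]
  have hv : ∀ ω, ω ∈ R.initial t n ⁻¹' {v} ↔
      ∀ i ≤ n, R.state t i ω = s i ∧ R.action t i ω = a i := by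
    intro ω
    simp only [Set.mem_preimage, Set.mem_singleton_iff, funext_iff, initial]
    constructor
    · intro h i hi
      have := h ⟨i, by omega⟩
      simp only [hs, ha, dif_pos (show i < n + 1 by omega), ← this, pair, and_self]
    · intro h i
      have := h i (by omega)
      simp only [hs, ha, dif_pos i.2] at this
      exact Prod.ext this.1 this.2
  -- A segment incompatible with the event contributes zero to both sides.
  by_cases hc : (∀ i < j, s i ≠ q) ∧ (j ≤ n → s j = q) ∧ (s n, a n) = z
  · obtain ⟨hc1, hc2, hc3⟩ := hc
    have e1 : B ∩ R.hitEvent t k q j n ∩ {ω | R.pair t n ω = z} ∩ {ω | R.pair t (n + 1) ω = z'} ∩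
        R.initial t n ⁻¹' {v} = B ∩ R.pathEvent t k q (n + 1) s a := by
      ext ω
      constructor
      · rintro ⟨⟨⟨⟨hB', h1, h2, -⟩, -⟩, h3⟩, h4⟩
        refine ⟨hB', h1, h2, fun i hi => ?_⟩
        rcases Nat.lt_or_ge i (n + 1) with h | h
        · exact (hv ω).1 h4 i (by omega)
        · obtain rfl : i = n + 1 := by omega
          rw [hsn, han]
          exact Prod.ext_iff.1 h3
      · rintro ⟨hB', h1, h2, h3⟩
        refine ⟨⟨⟨⟨hB', h1, h2, fun i hi => ?_, fun hj => ?_⟩, ?_⟩, ?_⟩,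
          (hv ω).2 fun i hi => h3 i (by omega)⟩
        · rw [(h3 i (by omega)).1]; exact hc1 i hi
        · rw [(h3 j (by omega)).1]; exact hc2 hj
        · rw [← hc3]
          exact Prod.ext (h3 n (by omega)).1 (h3 n (by omega)).2
        · have h5 := h3 (n + 1) le_rfl
          rw [hsn, han] at h5
          exact Prod.ext h5.1 h5.2
    have e2 : B ∩ R.hitEvent t k q j n ∩ {ω | R.pair t n ω = z} ∩
        R.initial t n ⁻¹' {v} = B ∩ R.pathEvent t k q n s a := by
      ext ω
      constructor
      · rintro ⟨⟨⟨hB', h1, h2, -⟩, -⟩, h4⟩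
        exact ⟨hB', h1, h2, (hv ω).1 h4⟩
      · rintro ⟨hB', h1, h2, h3⟩
        refine ⟨⟨⟨hB', h1, h2, fun i hi => ?_, fun hj => ?_⟩, ?_⟩, (hv ω).2 h3⟩
        · rw [(h3 i (by omega)).1]; exact hc1 i hi
        · rw [(h3 j (by omega)).1]; exact hc2 hj
        · rw [← hc3]
          exact Prod.ext (h3 n (by omega)).1 (h3 n (by omega)).2
    have hsj : s j = q := by
      rcases Nat.eq_zero_or_pos i with h | h
      · have : j = n + 1 := by omega
        rw [this, hsn]; exact hz' h
      · exact hc2 (by omega)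
    rw [e1, e2, R.path_step hB hk a fun l hl => hc1 l (by omega), hn,
      behavior_eq_phasePolicy π p k hc1 hsj, ← hn, hsn, han]
    rw [← hc3]
  · have e2 : B ∩ R.hitEvent t k q j n ∩ {ω | R.pair t n ω = z} ∩
        R.initial t n ⁻¹' {v} = ∅ := by
      rw [Set.eq_empty_iff_forall_notMem]
      rintro ω ⟨⟨⟨-, -, -, h1, h2⟩, h3⟩, h4⟩
      have h5 := (hv ω).1 h4
      refine hc ⟨fun i hi => ?_, fun hj => ?_, ?_⟩
      · rw [← (h5 i (by omega)).1]; exact h1 i hi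
      · rw [← (h5 j (by omega)).1]; exact h2 hj
      · rw [← h3]
        exact Prod.ext (h5 n le_rfl).1.symm (h5 n le_rfl).2.symm
    have e1 : B ∩ R.hitEvent t k q j n ∩ {ω | R.pair t n ω = z} ∩ {ω | R.pair t (n + 1) ω = z'} ∩
        R.initial t n ⁻¹' {v} = ∅ := by
      rw [← Set.subset_empty_iff, ← e2]
      exact fun ω h => ⟨h.1.1, h.2⟩
    rw [e1, e2]
    simp

/-- It suffices that the left side is proportional to the action probability, since summing over
actions identifies the factor. Hitting at time 0 uses the path law directly, later hits use the
preceding step. -/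
theorem action_at_hit [Nonempty A] {t : ℕ} {B : Set Ω} (hB : MeasurableSet[R.hist t] B) {k : ℕ}
    (hk : k < p.m) (q : S) (j : ℕ) (b : A) :
    ℙ.real (B ∩ R.hitEvent t k q j j ∩ {ω | R.action t j ω = b}) =
      ℙ.real (B ∩ R.hitEvent t k q j j) * phasePolicy π p k 0 q b := by
  suffices ∃ C, ∀ b, ℙ.real (B ∩ R.hitEvent t k q j j ∩ {ω | R.action t j ω = b}) =
      C * phasePolicy π p k 0 q b by
    obtain ⟨C, hC⟩ := this
    rw [hC, measureReal_eq_sum_inter ℙ (f := R.action t j) (R.measurableSet_action t j)]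
    congr 1
    have : ∀ b, ℙ.real (B ∩ R.hitEvent t k q j j ∩ R.action t j ⁻¹' {b}) =
      C * phasePolicy π p k 0 q b := hC
    simp_rw [this, ← Finset.mul_sum, sum_phasePolicy, mul_one]
  cases j with
  | zero =>
    refine ⟨ℙ.real (B ∩ {ω | R.state t 0 ω = q}) * ((1 - M.γ) * M.γ ^ k) * originLaw p q,
      fun b => ?_⟩
    have h := R.path_law t B hB k q 0 (fun _ => q) (fun _ => b) hk (fun j hj => by omega)
    have e : B ∩ R.hitEvent t k q 0 0 ∩ {ω | R.action t 0 ω = b} =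
        B ∩ {ω | R.len t ω = k ∧ R.target t ω = q ∧
          ∀ i ≤ 0, R.state t i ω = q ∧ R.action t i ω = b} := by
      ext ω
      simp only [hitEvent, Set.mem_inter_iff, Set.mem_ofPred_eq]
      constructor
      · rintro ⟨⟨h1, h2, h3, -, h4⟩, h5⟩
        refine ⟨h1, h2, h3, fun i hi => ?_⟩
        obtain rfl : i = 0 := by omega
        exact ⟨h4 le_rfl, h5⟩
      · rintro ⟨h1, h2, h3, h4⟩
        exact ⟨⟨h1, h2, h3, fun i hi => by omega, fun _ => (h4 0 le_rfl).1⟩, (h4 0 le_rfl).2⟩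
    rw [e, h]
    have hb := behavior_eq_phasePolicy π p (q := q) k (s := fun _ => q) (j := 0)
      (fun i hi => by omega) rfl 0 b
    simp only [Nat.add_zero] at hb
    simp [hb]
  | succ j =>
    refine ⟨∑ z, ℙ.real (B ∩ R.hitEvent t k q (j + 1) j ∩ {ω | R.pair t j ω = z}) *
      M.P z.1 z.2 q, fun b => ?_⟩
    rw [measureReal_eq_sum_inter ℙ (f := R.pair t j) (R.measurableSet_pair t j), Finset.sum_mul]
    refine Finset.sum_congr rfl fun z _ => ?_
    rw [mul_assoc, ← R.pair_step hB hk (i := 0) (by omega) (by omega) z (q, b) fun _ => rfl]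
    congr 1
    ext ω
    simp only [hitEvent, Set.mem_inter_iff, Set.mem_ofPred_eq, Set.mem_preimage,
      Set.mem_singleton_iff, pair, Prod.mk.injEq]
    have : ¬ (j + 1 ≤ j) := by omega
    simp only [this, false_imp_iff, and_true, le_refl, true_imp_iff]
    tauto

theorem pair_after_hit [Nonempty A] {t : ℕ} {B : Set Ω} (hB : MeasurableSet[R.hist t] B) {k : ℕ}
    (hk : k < p.m) (q : S) (j : ℕ) {i : ℕ} (hi : i ≤ k) (z : S × A) :
    ℙ.real (B ∩ R.hitEvent t k q j j ∩ {ω | R.pair t (j + i) ω = z}) =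
      ℙ.real (B ∩ R.hitEvent t k q j j) * (stateMatrix M π ^ i) q z.1 *
        phasePolicy π p k i z.1 z.2 := by
  induction i generalizing z with
  | zero =>
    rw [pow_zero, Matrix.one_apply]
    split_ifs with h
    · rw [mul_one, ← h, ← R.action_at_hit hB hk]
      congr 1
      ext ω
      simp only [hitEvent, Set.mem_inter_iff, Set.mem_ofPred_eq, pair, Nat.add_zero, Prod.ext_iff]
      constructor
      · rintro ⟨h1, -, h2⟩
        exact ⟨h1, h2⟩
      · rintro ⟨h1, h2⟩
        exact ⟨h1, by rw [← h]; exact h1.2.2.2.2 le_rfl, h2⟩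
    · rw [mul_zero, zero_mul]
      convert measureReal_empty
      rw [Set.eq_empty_iff_forall_notMem]
      rintro ω ⟨⟨-, h1⟩, h2⟩
      refine h ?_
      rw [← h1.2.2.2 le_rfl]
      exact (Prod.ext_iff.1 h2).1
  | succ i ih =>
    rw [measureReal_eq_sum_inter ℙ (f := R.pair t (j + i)) (R.measurableSet_pair t (j + i))]
    have h1 : ∀ z₀, ℙ.real (B ∩ R.hitEvent t k q j j ∩ {ω | R.pair t (j + (i + 1)) ω = z} ∩
        R.pair t (j + i) ⁻¹' {z₀}) = ℙ.real (B ∩ R.hitEvent t k q j j) *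
          (stateMatrix M π ^ i) q z₀.1 * π.prob z₀.1 z₀.2 *
          (M.P z₀.1 z₀.2 z.1 * phasePolicy π p k (i + 1) z.1 z.2) := by
      intro z₀
      have h2 := ih (by omega) z₀
      have h3 := R.pair_step hB hk (q := q) (j := j) (n := j + i) (i := i + 1) (by omega)
        (by omega) z₀ z (fun h => by omega)
      rw [R.hitEvent_eq (Nat.le_add_right j i), h2, phasePolicy, if_neg (by omega)] at h3
      rw [← h3, Set.inter_right_comm]
      rfl
    simp_rw [h1]
    rw [pow_succ, Matrix.mul_apply, Fintype.sum_prod_type, Finset.mul_sum, Finset.sum_mul]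
    refine Finset.sum_congr rfl fun s _ => ?_
    rw [stateMatrix, Matrix.of_apply, Finset.mul_sum, Finset.mul_sum, Finset.sum_mul]
    exact Finset.sum_congr rfl fun a _ => by ring

theorem pairs_at_sample [Nonempty A] {t : ℕ} {B : Set Ω} (hB : MeasurableSet[R.hist t] B) {k : ℕ}
    (hk : k < p.m) (q : S) (j : ℕ) (z z' : S × A) :
    ℙ.real (B ∩ R.hitEvent t k q j j ∩ {ω | R.pair t (j + k) ω = z} ∩
        {ω | R.pair t (j + k + 1) ω = z'}) =
      ℙ.real (B ∩ R.hitEvent t k q j j) * ((stateMatrix M π ^ k) q z.1 *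
        perturb π p.εA z.1 z.2 * pairMatrix M π z z') := by
  have h1 := R.pair_after_hit hB hk q j le_rfl z
  have h2 := R.pair_step hB hk (q := q) (j := j) (n := j + k) (i := k + 1) (by omega)
    (by omega) z z' (fun h => by omega)
  rw [R.hitEvent_eq (Nat.le_add_right j k), h1, phasePolicy, if_pos rfl, phasePolicy,
    if_neg (by omega)] at h2
  rw [h2, pairMatrix, Matrix.of_apply]
  ring

theorem measureReal_len_target [Nonempty A] {t : ℕ} {B : Set Ω} (hB : MeasurableSet[R.hist t] B)
    {k : ℕ} (hk : k < p.m) (q : S) :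
    ℙ.real (B ∩ {ω | R.len t ω = k ∧ R.target t ω = q}) =
      ℙ.real B * ((1 - M.γ) * M.γ ^ k * originLaw p q) := by
  rw [measureReal_eq_sum_inter ℙ (f := R.pair t 0) (R.measurableSet_pair t 0),
    measureReal_eq_sum_inter ℙ (f := R.state t 0) (R.measurableSet_state t 0) B, Finset.sum_mul,
    Fintype.sum_prod_type]
  refine Finset.sum_congr rfl fun s _ => ?_
  have h : ∀ a, ℙ.real (B ∩ {ω | R.len t ω = k ∧ R.target t ω = q} ∩ R.pair t 0 ⁻¹' {(s, a)}) =
      ℙ.real (B ∩ {ω | R.state t 0 ω = s}) * ((1 - M.γ) * M.γ ^ k) * originLaw p q *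
        behavior π p q k (fun _ => s) 0 a := by
    intro a
    have h1 := R.path_law t B hB k q 0 (fun _ => s) (fun _ => a) hk (fun j hj => by omega)
    simp only [Nat.le_zero, forall_eq, zero_add, Finset.range_one, Finset.prod_singleton,
      Finset.range_zero, Finset.prod_empty, mul_one] at h1
    rw [← h1]
    congr 1
    ext ω
    simp only [Set.mem_inter_iff, Set.mem_ofPred_eq, Set.mem_preimage, Set.mem_singleton_iff, pair,
      Prod.mk.injEq]
    tauto
  simp_rw [h, ← Finset.mul_sum, sum_behavior, mul_one]
  rw [mul_assoc]
  rfl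

/-- For each hitting time j the conditional law of the sampled pairs is the same, so it survives
summation over j. Almost sure termination of the exploration ensures that no mass is lost. -/
theorem sampled_of_len_target [Nonempty A] {t : ℕ} {B : Set Ω} (hB : MeasurableSet[R.hist t] B)
    {k : ℕ} (hk : k < p.m) (q : S) (z z' : S × A) :
    ℙ.real (B ∩ {ω | R.pair t (R.sampleTime t ω) ω = z ∧ R.pair t (R.sampleTime t ω + 1) ω = z'} ∩
        {ω | R.len t ω = k ∧ R.target t ω = q}) =
      ℙ.real (B ∩ {ω | R.len t ω = k ∧ R.target t ω = q}) * ((stateMatrix M π ^ k) q z.1 *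
        perturb π p.εA z.1 z.2 * pairMatrix M π z z') := by
  set C := (stateMatrix M π ^ k) q z.1 * perturb π p.εA z.1 z.2 * pairMatrix M π z z' with hC
  have hBm : MeasurableSet B := R.hist.le t _ hB
  set E : Set Ω := {ω | R.len t ω = k ∧ R.target t ω = q} with hE
  set F : Set Ω :=
    {ω | R.pair t (R.sampleTime t ω) ω = z ∧ R.pair t (R.sampleTime t ω + 1) ω = z'} with hF
  set T : ℕ → Set Ω := fun j => R.hitEvent t k q j j with hT
  have hTm : ∀ j, MeasurableSet (T j) := fun j => R.measurableSet_hitEvent t k q j j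
  have hdisj : Pairwise (Function.onFun Disjoint T) := by
    intro i j hij
    rw [Function.onFun, Set.disjoint_left]
    rintro ω ⟨-, -, h1, h2⟩ ⟨-, -, h3, h4⟩
    rcases lt_or_gt_of_ne hij with h | h
    · exact h3 i h (h2 le_rfl)
    · exact h1 j h (h4 le_rfl)
  have hae : ∀ᵐ ω ∂ℙ, ω ∈ E ↔ ω ∈ ⋃ j, T j := by
    filter_upwards [R.hits t] with ω hω
    constructor
    · rintro ⟨h1, h2⟩
      have hex := hω (by rw [h1]; exact hk)
      rw [h2] at hex
      classical
      refine Set.mem_iUnion.2 ⟨Nat.find hex, h1, h2, fun i hi => Nat.find_min hex hi,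
        fun _ => Nat.find_spec hex⟩
    · intro h
      obtain ⟨j, h1, h2, -⟩ := Set.mem_iUnion.1 h
      exact ⟨h1, h2⟩
  have hsample : ∀ j, B ∩ F ∩ T j = B ∩ T j ∩ {ω | R.pair t (j + k) ω = z} ∩
      {ω | R.pair t (j + k + 1) ω = z'} := by
    intro j
    ext ω
    have key : ω ∈ T j → R.sampleTime t ω = j + k := by
      rintro ⟨h1, h2, h3, h4⟩
      rw [sampleTime, h1, h2, hittingTime_eq h3 (h4 le_rfl)]
    constructor
    · rintro ⟨⟨h1, h2, h3⟩, h4⟩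
      rw [key h4] at h2 h3
      exact ⟨⟨⟨h1, h4⟩, h2⟩, h3⟩
    · rintro ⟨⟨⟨h1, h2⟩, h3⟩, h4⟩
      refine ⟨⟨h1, ?_, ?_⟩, h2⟩ <;> rw [key h2] <;> assumption
  have hunion : ∀ X : Set Ω, (∀ j, MeasurableSet (X ∩ T j)) →
      HasSum (fun j => ℙ.real (X ∩ T j)) (ℙ.real (X ∩ E)) := by
    intro X hX
    have e : ℙ (X ∩ E) = ∑' j, ℙ (X ∩ T j) := by
      rw [← measure_iUnion (fun i j hij => (hdisj hij).mono Set.inter_subset_right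
        Set.inter_subset_right) hX]
      refine measure_congr ?_
      filter_upwards [hae] with ω hω
      refine propext ?_
      change (ω ∈ X ∧ ω ∈ E) ↔ ω ∈ ⋃ j, X ∩ T j
      rw [hω, ← Set.inter_iUnion]
      rfl
    have hne : ∑' j, ℙ (X ∩ T j) ≠ ⊤ := by rw [← e]; exact measure_ne_top _ _
    have h2 := ENNReal.summable_toReal hne
    have h3 : (∑' j, ℙ (X ∩ T j)).toReal = ∑' j, (ℙ (X ∩ T j)).toReal :=
      ENNReal.tsum_toReal_eq fun j => measure_ne_top _ _
    rw [Measure.real, e, h3]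
    exact h2.hasSum
  have h1 := hunion B fun j => hBm.inter (hTm j)
  have h2 := hunion (B ∩ F) fun j => by
    rw [hsample]
    exact ((hBm.inter (hTm j)).inter (R.measurableSet_pair t _ z)).inter
      (R.measurableSet_pair t _ z')
  have h3 : ∀ j, ℙ.real (B ∩ F ∩ T j) = ℙ.real (B ∩ T j) * C := fun j => by
    rw [hsample, R.pairs_at_sample hB hk]
  simp_rw [h3] at h2
  exact h2.unique (h1.mul_right C)

theorem measureReal_sampled [Nonempty A] {t : ℕ} {B : Set Ω} (hB : MeasurableSet[R.hist t] B)
    (z z' : S × A) :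
    ℙ.real (B ∩ {ω | R.len t ω < p.m ∧ R.pair t (R.sampleTime t ω) ω = z ∧
        R.pair t (R.sampleTime t ω + 1) ω = z'}) =
      ℙ.real B * (truncVisitation M π p z.1 * perturb π p.εA z.1 z.2 * pairMatrix M π z z') := by
  set F : Set Ω :=
    {ω | R.pair t (R.sampleTime t ω) ω = z ∧ R.pair t (R.sampleTime t ω + 1) ω = z'} with hF
  have h1 := sum_measureReal_preimage_singleton (μ := ℙ.restrict (B ∩ F)) (f := R.len t)
    (Finset.range p.m) (fun k _ => R.measurableSet_len t k)
  have hm : MeasurableSet (R.len t ⁻¹' (Finset.range p.m : Set ℕ)) := by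
    have : R.len t ⁻¹' (Finset.range p.m : Set ℕ) =
        ⋃ k ∈ Finset.range p.m, {ω | R.len t ω = k} := by
      ext ω; simp
    rw [this]
    exact Finset.measurableSet_biUnion _ fun k _ => R.measurableSet_len t k
  rw [measureReal_restrict_apply hm] at h1
  have e : B ∩ {ω | R.len t ω < p.m ∧ R.pair t (R.sampleTime t ω) ω = z ∧
        R.pair t (R.sampleTime t ω + 1) ω = z'} =
      R.len t ⁻¹' (Finset.range p.m : Set ℕ) ∩ (B ∩ F) := by
    ext ω
    simp only [hF, Set.mem_inter_iff, Set.mem_ofPred_eq, Set.mem_preimage, Finset.coe_range,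
      Set.mem_Iio]
    tauto
  rw [e, ← h1, truncVisitation, Finset.sum_mul, Finset.sum_mul, Finset.mul_sum]
  refine Finset.sum_congr rfl fun k hk => ?_
  have hk' : k < p.m := Finset.mem_range.1 hk
  rw [measureReal_restrict_apply
      (show MeasurableSet (R.len t ⁻¹' {k}) from R.measurableSet_len t k),
    measureReal_eq_sum_inter ℙ (f := R.target t) (R.measurableSet_target t), Finset.mul_sum,
    Finset.sum_mul, Finset.sum_mul, Finset.mul_sum]
  refine Finset.sum_congr rfl fun q _ => ?_
  have e2 : R.len t ⁻¹' {k} ∩ (B ∩ F) ∩ R.target t ⁻¹' {q} =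
      B ∩ F ∩ {ω | R.len t ω = k ∧ R.target t ω = q} := by
    ext ω
    simp only [Set.mem_inter_iff, Set.mem_ofPred_eq, Set.mem_preimage, Set.mem_singleton_iff]
    tauto
  rw [e2, R.sampled_of_len_target hB hk', R.measureReal_len_target hB hk']
  ring

end Run

end

end CTD

/-! ### Visitation distributions and their flow identities. -/

namespace CTD

set_option linter.unusedSectionVars false

noncomputable section

variable {S A : Type*} [Fintype S] [Fintype A] [DecidableEq S] [DecidableEq A]
  {M : MDP S A} {π : Policy S A} {p : Params S}

theorem stateMatrix_pow_nonneg (M : MDP S A) (π : Policy S A) (t : ℕ) (s s' : S) :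
    0 ≤ (stateMatrix M π ^ t) s s' := by
  induction t generalizing s' with
  | zero => rw [pow_zero, Matrix.one_apply]; split_ifs <;> norm_num
  | succ t ih =>
    rw [pow_succ, Matrix.mul_apply]
    exact Finset.sum_nonneg fun q _ => mul_nonneg (ih q) (Finset.sum_nonneg fun a _ =>
      mul_nonneg (π.prob_nonneg _ _) (M.P_nonneg _ _ _))

theorem sum_stateMatrix (M : MDP S A) (π : Policy S A) (s : S) :
    ∑ s', stateMatrix M π s s' = 1 := by
  simp only [stateMatrix, Matrix.of_apply]
  rw [Finset.sum_comm]
  simp_rw [← Finset.mul_sum, M.P_sum, mul_one, π.prob_sum]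

theorem sum_stateMatrix_pow (M : MDP S A) (π : Policy S A) (t : ℕ) (s : S) :
    ∑ s', (stateMatrix M π ^ t) s s' = 1 := by
  induction t with
  | zero => simp [Matrix.one_apply]
  | succ t ih =>
    simp_rw [pow_succ, Matrix.mul_apply]
    rw [Finset.sum_comm]
    simp_rw [← Finset.mul_sum, sum_stateMatrix, mul_one, ih]

theorem stateMatrix_pow_le_one (M : MDP S A) (π : Policy S A) (t : ℕ) (s s' : S) :
    (stateMatrix M π ^ t) s s' ≤ 1 := by
  rw [← sum_stateMatrix_pow M π t s]
  exact Finset.single_le_sum (fun q _ => stateMatrix_pow_nonneg M π t s q) (Finset.mem_univ s')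

theorem summable_visitation (M : MDP S A) (π : Policy S A) (q s : S) :
    Summable fun t : ℕ => M.γ ^ t * (stateMatrix M π ^ t) q s :=
  (summable_geometric_of_lt_one M.γ_nonneg M.γ_lt_one).of_nonneg_of_le
    (fun t => mul_nonneg (pow_nonneg M.γ_nonneg t) (stateMatrix_pow_nonneg M π t q s))
    fun t => mul_le_of_le_one_right (pow_nonneg M.γ_nonneg t) (stateMatrix_pow_le_one M π t q s)

theorem visitation_nonneg (M : MDP S A) (π : Policy S A) (q s : S) : 0 ≤ visitation M π q s :=
  mul_nonneg (by linarith [M.γ_lt_one]) (tsum_nonneg fun t =>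
    mul_nonneg (pow_nonneg M.γ_nonneg t) (stateMatrix_pow_nonneg M π t q s))

theorem sum_visitation (M : MDP S A) (π : Policy S A) (q : S) : ∑ s, visitation M π q s = 1 := by
  simp only [visitation]
  rw [← Finset.mul_sum, ← Summable.tsum_finsetSum fun s _ => summable_visitation M π q s]
  simp_rw [← Finset.mul_sum, sum_stateMatrix_pow, mul_one]
  rw [tsum_geometric_of_lt_one M.γ_nonneg M.γ_lt_one]
  exact mul_inv_cancel₀ (by linarith [M.γ_lt_one])

/-- The Markov property at time m: the tail of the discounted series is a visitation distribution
restarted from the law at time m. -/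
theorem visitation_eq_add (M : MDP S A) (π : Policy S A) (m : ℕ) (q s : S) :
    visitation M π q s =
      ∑ k ∈ Finset.range m, (1 - M.γ) * M.γ ^ k * (stateMatrix M π ^ k) q s +
        M.γ ^ m * ∑ q', (stateMatrix M π ^ m) q q' * visitation M π q' s := by
  have h : ∑' t : ℕ, M.γ ^ (t + m) * (stateMatrix M π ^ (t + m)) q s =
      M.γ ^ m * ∑ q', (stateMatrix M π ^ m) q q' *
        ∑' t : ℕ, M.γ ^ t * (stateMatrix M π ^ t) q' s := by
    simp_rw [← tsum_mul_left]
    rw [← Summable.tsum_finsetSum fun q' _ => (summable_visitation M π q' s).mul_left _,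
      ← tsum_mul_left]
    refine tsum_congr fun t => ?_
    rw [add_comm t m, pow_add (stateMatrix M π), Matrix.mul_apply, pow_add, mul_assoc]
    congr 1
    rw [Finset.mul_sum]
    exact Finset.sum_congr rfl fun q' _ => by ring
  rw [visitation, ← (summable_visitation M π q s).sum_add_tsum_nat_add m, h, mul_add,
    Finset.mul_sum]
  congr 1
  · exact Finset.sum_congr rfl fun k _ => by ring
  · simp only [visitation]
    rw [mul_left_comm, Finset.mul_sum]
    congr 1
    exact Finset.sum_congr rfl fun k _ => by ring

theorem visitation_flow (M : MDP S A) (π : Policy S A) (q s' : S) :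
    M.γ * ∑ s, visitation M π q s * stateMatrix M π s s' =
      visitation M π q s' - (1 - M.γ) * (if q = s' then 1 else 0) := by
  have h := (summable_visitation M π q s').sum_add_tsum_nat_add 1
  have h1 : ∑' t : ℕ, M.γ ^ (t + 1) * (stateMatrix M π ^ (t + 1)) q s' =
      M.γ * ∑ s, (∑' t : ℕ, M.γ ^ t * (stateMatrix M π ^ t) q s) * stateMatrix M π s s' := by
    simp_rw [← tsum_mul_right]
    rw [← Summable.tsum_finsetSum fun s _ => (summable_visitation M π q s).mul_right _,
      ← tsum_mul_left]
    refine tsum_congr fun t => ?_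
    rw [pow_succ (stateMatrix M π), Matrix.mul_apply, pow_succ', mul_assoc]
    congr 1
    rw [Finset.mul_sum]
    exact Finset.sum_congr rfl fun q' _ => by ring
  rw [h1] at h
  simp only [Finset.range_one, Finset.sum_singleton, pow_zero, one_mul, Matrix.one_apply] at h
  simp only [visitation]
  rw [← h]
  simp_rw [mul_assoc (1 - M.γ), ← Finset.mul_sum]
  ring

theorem originLaw_nonneg (hf : p.f ∈ Set.Icc (0 : ℝ) 1) (q : S) : 0 ≤ originLaw p q := by
  unfold originLaw
  have h1 := hf.1
  have h2 := hf.2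
  refine add_nonneg (mul_nonneg (by linarith) (by split_ifs <;> norm_num)) (by positivity)

theorem sum_originLaw (p : Params S) : ∑ q, originLaw p q = 1 := by
  have : Nonempty S := ⟨p.origin⟩
  have h : (Fintype.card S : ℝ) ≠ 0 := by exact_mod_cast Fintype.card_ne_zero
  simp only [originLaw, Finset.sum_add_distrib, ← Finset.mul_sum, Finset.sum_ite_eq',
    Finset.mem_univ, if_true, Finset.sum_const, Finset.card_univ, nsmul_eq_mul]
  field_simp
  ring

theorem mixedVisitation_eq_sum (M : MDP S A) (π : Policy S A) (p : Params S) (s : S) :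
    mixedVisitation M π p s = ∑ q, originLaw p q * visitation M π q s := by
  simp only [mixedVisitation, originLaw, add_mul, Finset.sum_add_distrib]
  congr 1
  · simp
  · rw [Finset.mul_sum]
    exact Finset.sum_congr rfl fun q _ => by ring

theorem mixedVisitation_nonneg (hf : p.f ∈ Set.Icc (0 : ℝ) 1) (s : S) :
    0 ≤ mixedVisitation M π p s := by
  rw [mixedVisitation_eq_sum]
  exact Finset.sum_nonneg fun q _ => mul_nonneg (originLaw_nonneg hf q) (visitation_nonneg M π q s)

theorem sum_mixedVisitation (M : MDP S A) (π : Policy S A) (p : Params S) :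
    ∑ s, mixedVisitation M π p s = 1 := by
  simp_rw [mixedVisitation_eq_sum]
  rw [Finset.sum_comm]
  simp_rw [← Finset.mul_sum, sum_visitation, mul_one, sum_originLaw]

/-- The law of the state at the mixing time, when the origin state is random. -/
def mixedLaw (M : MDP S A) (π : Policy S A) (p : Params S) (s : S) : ℝ :=
  ∑ q, originLaw p q * (stateMatrix M π ^ p.m) q s

theorem mixedLaw_nonneg (hf : p.f ∈ Set.Icc (0 : ℝ) 1) (s : S) : 0 ≤ mixedLaw M π p s :=
  Finset.sum_nonneg fun q _ => mul_nonneg (originLaw_nonneg hf q) (stateMatrix_pow_nonneg M π _ q s)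

theorem sum_mixedLaw (M : MDP S A) (π : Policy S A) (p : Params S) :
    ∑ s, mixedLaw M π p s = 1 := by
  simp only [mixedLaw]
  rw [Finset.sum_comm]
  simp_rw [← Finset.mul_sum, sum_stateMatrix_pow, mul_one, sum_originLaw]

/-- Discounted visitation distribution started from the law at the mixing time. -/
def restVisitation (M : MDP S A) (π : Policy S A) (p : Params S) (s : S) : ℝ :=
  ∑ q, mixedLaw M π p q * visitation M π q s

theorem mixedVisitation_eq_add (M : MDP S A) (π : Policy S A) (p : Params S) (s : S) :
    mixedVisitation M π p s = truncVisitation M π p s + M.γ ^ p.m * restVisitation M π p s := by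
  rw [mixedVisitation_eq_sum]
  rw [Finset.sum_congr rfl fun q _ => congrArg (originLaw p q * ·) (visitation_eq_add M π p.m q s)]
  simp_rw [mul_add, Finset.sum_add_distrib]
  congr 1
  · simp_rw [Finset.mul_sum]
    rw [Finset.sum_comm, truncVisitation]
    refine Finset.sum_congr rfl fun k _ => ?_
    rw [Finset.mul_sum]
    exact Finset.sum_congr rfl fun q _ => by ring
  · simp only [restVisitation, mixedLaw, Finset.sum_mul, Finset.mul_sum]
    rw [Finset.sum_comm]
    exact Finset.sum_congr rfl fun q _ => Finset.sum_congr rfl fun q' _ => by ring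

/-- A discounted step shifts the summation index by one, so the sum telescopes, leaving the initial
law and the law at time m. -/
theorem truncVisitation_flow (M : MDP S A) (π : Policy S A) (p : Params S) :
    Flow M π (truncVisitation M π p) (originLaw p) (mixedLaw M π p) (M.γ ^ p.m) := by
  intro s'
  set a : ℕ → ℝ := fun k =>
    (1 - M.γ) * M.γ ^ k * ∑ q, originLaw p q * (stateMatrix M π ^ k) q s' with ha
  have h1 : truncVisitation M π p s' = ∑ k ∈ Finset.range p.m, a k := rfl
  have h2 : M.γ * ∑ s, truncVisitation M π p s * stateMatrix M π s s' =
      ∑ k ∈ Finset.range p.m, a (k + 1) := by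
    simp only [truncVisitation, Finset.sum_mul]
    rw [Finset.sum_comm, Finset.mul_sum]
    refine Finset.sum_congr rfl fun k _ => ?_
    simp only [ha, pow_succ (stateMatrix M π), Matrix.mul_apply, Finset.mul_sum, Finset.sum_mul]
    rw [Finset.sum_comm]
    exact Finset.sum_congr rfl fun q _ => Finset.sum_congr rfl fun q' _ => by ring
  have h3 := Finset.sum_range_sub a p.m
  rw [Finset.sum_sub_distrib] at h3
  have h4 : a 0 = (1 - M.γ) * originLaw p s' := by
    simp [ha, Matrix.one_apply]
  have h5 : a p.m = (1 - M.γ) * M.γ ^ p.m * mixedLaw M π p s' := rfl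
  rw [h2, h1]
  linarith

theorem mixedVisitation_flow (M : MDP S A) (π : Policy S A) (p : Params S) (ν : S → ℝ) :
    Flow M π (mixedVisitation M π p) (originLaw p) ν 0 := by
  intro s'
  simp_rw [mixedVisitation_eq_sum, Finset.sum_mul]
  rw [Finset.sum_comm, Finset.mul_sum]
  have h : ∀ q, M.γ * ∑ s, originLaw p q * visitation M π q s * stateMatrix M π s s' =
      originLaw p q * visitation M π q s' -
        (1 - M.γ) * (originLaw p q * if q = s' then 1 else 0) := by
    intro q
    have := visitation_flow M π q s'
    simp_rw [mul_assoc, ← Finset.mul_sum]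
    rw [mul_left_comm, this]
    ring
  simp_rw [h, Finset.sum_sub_distrib, ← Finset.mul_sum]
  simp

/-- The splitting of the weighting distribution at the mixing time. -/
def mixingSplitting (M : MDP S A) (π : Policy S A) (p : Params S)
    (hf : p.f ∈ Set.Icc (0 : ℝ) 1) (h0 : 0 ≤ p.εA)
    (hε : p.εA ≤ (1 - M.γ) * (⨅ s, mixedVisitation M π p s) / 4) : Splitting M π p.εA where
  k := truncVisitation M π p
  ρ := originLaw p
  ν := mixedLaw M π p
  rest := restVisitation M π p
  g := M.γ ^ p.m
  α := ⨅ s, mixedVisitation M π p s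
  k_nonneg s := Finset.sum_nonneg fun k _ => mul_nonneg
    (mul_nonneg (by linarith [M.γ_lt_one]) (pow_nonneg M.γ_nonneg k))
    (Finset.sum_nonneg fun q _ => mul_nonneg (originLaw_nonneg hf q)
      (stateMatrix_pow_nonneg M π k q s))
  ρ_nonneg := originLaw_nonneg hf
  ν_nonneg := mixedLaw_nonneg hf
  rest_nonneg s := Finset.sum_nonneg fun q _ => mul_nonneg (mixedLaw_nonneg hf q)
    (visitation_nonneg M π q s)
  k_sum := by
    have h1 := sum_mixedVisitation M π p
    simp_rw [mixedVisitation_eq_add, Finset.sum_add_distrib, ← Finset.mul_sum] at h1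
    have h2 : ∑ s, restVisitation M π p s = 1 := by
      simp only [restVisitation]
      rw [Finset.sum_comm]
      simp_rw [← Finset.mul_sum, sum_visitation, mul_one, sum_mixedLaw]
    rw [h2] at h1
    linarith
  ν_sum := sum_mixedLaw M π p
  rest_sum := by
    simp only [restVisitation]
    rw [Finset.sum_comm]
    simp_rw [← Finset.mul_sum, sum_visitation, mul_one, sum_mixedLaw]
  flow := truncVisitation_flow M π p
  g_nonneg := pow_nonneg M.γ_nonneg _
  α_le s := by
    rw [← mixedVisitation_eq_add]
    exact ciInf_le (Set.finite_range _).bddBelow s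
  ε_nonneg := h0
  ε_le := hε

/-- The weighting distribution, with nothing split off. -/
def fullSplitting (M : MDP S A) (π : Policy S A) (p : Params S)
    (hf : p.f ∈ Set.Icc (0 : ℝ) 1) (h0 : 0 ≤ p.εA)
    (hε : p.εA ≤ (1 - M.γ) * (⨅ s, mixedVisitation M π p s) / 4) : Splitting M π p.εA where
  k := mixedVisitation M π p
  ρ := originLaw p
  ν := originLaw p
  rest := originLaw p
  g := 0
  α := ⨅ s, mixedVisitation M π p s
  k_nonneg := mixedVisitation_nonneg hf
  ρ_nonneg := originLaw_nonneg hf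
  ν_nonneg := originLaw_nonneg hf
  rest_nonneg := originLaw_nonneg hf
  k_sum := by rw [sum_mixedVisitation, sub_zero]
  ν_sum := sum_originLaw p
  rest_sum := sum_originLaw p
  flow := mixedVisitation_flow M π p _
  g_nonneg := le_rfl
  α_le s := by
    rw [zero_mul, add_zero]
    exact ciInf_le (Set.finite_range _).bddBelow s
  ε_nonneg := h0
  ε_le := hε

theorem mixingSplitting_κ (hf : p.f ∈ Set.Icc (0 : ℝ) 1) (h0 : 0 ≤ p.εA)
    (hε : p.εA ≤ (1 - M.γ) * (⨅ s, mixedVisitation M π p s) / 4) :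
    (mixingSplitting M π p hf h0 hε).κ = mixedVisitation M π p :=
  funext fun s => (mixedVisitation_eq_add M π p s).symm

theorem normSqW_eq_sum_stateEnergy (M : MDP S A) (π : Policy S A) (p : Params S)
    (x : S × A → ℝ) :
    normSqW M π p x = ∑ s, stateEnergy (mixedVisitation M π p) (perturb π p.εA) x s := by
  simp only [normSqW, weight, stateEnergy, Fintype.sum_prod_type, Finset.mul_sum, mul_assoc]

end

end CTD

/-! ### Linear algebra of the features, and the projected Bellman equation. -/

namespace CTD

set_option linter.unusedSectionVars false

noncomputable section

open scoped Matrix.Norms.L2Operator in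
theorem dotProduct_mulVec_self_le {m n : Type*} [Fintype m] [Fintype n] [DecidableEq n]
    (B : Matrix m n ℝ) (v : n → ℝ) :
    (B.mulVec v) ⬝ᵥ (B.mulVec v) ≤ ‖B‖ ^ 2 * (v ⬝ᵥ v) := by
  have h := B.l2_opNorm_mulVec (WithLp.toLp 2 v)
  have h2 := pow_le_pow_left₀ (norm_nonneg _) h 2
  rw [mul_pow, EuclideanSpace.real_norm_sq_eq, EuclideanSpace.real_norm_sq_eq] at h2
  simp only [dotProduct, ← sq]
  exact h2

/-- The Rayleigh bound, by expanding in an orthonormal eigenbasis. -/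
theorem _root_.Matrix.IsHermitian.iInf_eigenvalues_mul_le {n : Type*} [Fintype n] [DecidableEq n]
    {B : Matrix n n ℝ} (hB : B.IsHermitian) (v : n → ℝ) :
    (⨅ i, hB.eigenvalues i) * (v ⬝ᵥ v) ≤ v ⬝ᵥ B.mulVec v := by
  set b := hB.eigenvectorBasis
  set x : EuclideanSpace ℝ n := WithLp.toLp 2 v
  set y : EuclideanSpace ℝ n := WithLp.toLp 2 (B.mulVec v)
  have h1 : inner ℝ x x = v ⬝ᵥ v := by
    rw [EuclideanSpace.inner_eq_star_dotProduct, star_trivial]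
  have h2 : inner ℝ x y = v ⬝ᵥ B.mulVec v := by
    simp [x, y, EuclideanSpace.inner_eq_star_dotProduct, dotProduct_comm]
  have h3 : ∀ i, inner ℝ (b i) y = hB.eigenvalues i * inner ℝ (b i) x := by
    intro i
    have h4 := hB.mulVec_eigenvectorBasis i
    have hs : B.transpose = B := by
      rw [← Matrix.conjTranspose_eq_transpose_of_trivial]; exact hB
    simp only [EuclideanSpace.inner_eq_star_dotProduct, star_trivial, x, y]
    rw [dotProduct_comm, Matrix.dotProduct_mulVec, ← Matrix.mulVec_transpose, hs, h4,
      smul_dotProduct, smul_eq_mul, dotProduct_comm]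
  rw [← h1, ← h2, ← b.sum_inner_mul_inner x x, ← b.sum_inner_mul_inner x y, Finset.mul_sum]
  refine Finset.sum_le_sum fun i _ => ?_
  rw [h3, real_inner_comm x (b i)]
  have h5 : (⨅ i, hB.eigenvalues i) ≤ hB.eigenvalues i := ciInf_le (Set.finite_range _).bddBelow i
  nlinarith [mul_le_mul_of_nonneg_right h5 (mul_self_nonneg (inner ℝ (b i) x))]

variable {S A : Type*} [Fintype S] [Fintype A] [DecidableEq S] [DecidableEq A] {d : ℕ}
  {M : MDP S A} {π : Policy S A} {p : Params S} {Φ : Matrix (S × A) (Fin d) ℝ}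

theorem mulVec_dotProduct_self_le (Φ : Matrix (S × A) (Fin d) ℝ) (θ : Fin d → ℝ) :
    (Φ.mulVec θ) ⬝ᵥ (Φ.mulVec θ) ≤ featureNorm Φ ^ 2 * (θ ⬝ᵥ θ) :=
  dotProduct_mulVec_self_le Φ θ

theorem row_dotProduct_self_le (Φ : Matrix (S × A) (Fin d) ℝ) (z : S × A) :
    Φ z ⬝ᵥ Φ z ≤ featureNorm Φ ^ 2 := by
  have h := dotProduct_mulVec_self_le Φ.transpose (Pi.single z 1)
  rw [← Matrix.conjTranspose_eq_transpose_of_trivial, Matrix.l2_opNorm_conjTranspose,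
    Matrix.conjTranspose_eq_transpose_of_trivial] at h
  rw [Matrix.mulVec_single_one, dotProduct_single, Pi.single_eq_same, one_mul, mul_one] at h
  exact h

theorem normSqW_mulVec (M : MDP S A) (π : Policy S A) (p : Params S)
    (Φ : Matrix (S × A) (Fin d) ℝ) (θ : Fin d → ℝ) :
    normSqW M π p (Φ.mulVec θ) = θ ⬝ᵥ (weightedGram M π p Φ).mulVec θ := by
  rw [weightedGram, ← Matrix.mulVec_mulVec, ← Matrix.mulVec_mulVec, Matrix.dotProduct_mulVec,
    Matrix.vecMul_transpose, normSqW, dotProduct]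
  refine Finset.sum_congr rfl fun z _ => ?_
  rw [Matrix.mulVec_diagonal]
  ring

theorem mu_mul_le (M : MDP S A) (π : Policy S A) (p : Params S)
    (Φ : Matrix (S × A) (Fin d) ℝ) (θ : Fin d → ℝ) :
    mu M π p Φ * (θ ⬝ᵥ θ) ≤ normSqW M π p (Φ.mulVec θ) := by
  rw [normSqW_mulVec]
  exact Matrix.IsHermitian.iInf_eigenvalues_mul_le _ _

theorem Policy.nonempty_action [Nonempty S] (π : Policy S A) : Nonempty A := by
  by_contra h
  rw [not_nonempty_iff] at h
  have := π.prob_sum (Classical.arbitrary S)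
  simp at this

theorem weight_pos [Nonempty A] (hκ : ∀ s, 0 < mixedVisitation M π p s) (h0 : 0 < p.εA)
    (h1 : p.εA ≤ 1) (z : S × A) : 0 < weight M π p z := by
  refine mul_pos (hκ _) ?_
  unfold perturb
  have h2 : (0 : ℝ) < Fintype.card A := by exact_mod_cast Fintype.card_pos
  exact add_pos_of_nonneg_of_pos (mul_nonneg (by linarith) (π.prob_nonneg _ _)) (div_pos h0 h2)

theorem normSqW_pos (hw : ∀ z, 0 < weight M π p z) {x : S × A → ℝ} (hx : x ≠ 0) :
    0 < normSqW M π p x := by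
  obtain ⟨z, hz⟩ := Function.ne_iff.1 hx
  refine Finset.sum_pos' (fun z _ => mul_nonneg (hw z).le (sq_nonneg _)) ⟨z, Finset.mem_univ z, ?_⟩
  exact mul_pos (hw z) (sq_pos_of_ne_zero hz)

theorem mulVec_ne_zero (hΦ : LinearIndependent ℝ Φ.col) {θ : Fin d → ℝ} (hθ : θ ≠ 0) :
    Φ.mulVec θ ≠ 0 := fun h =>
  hθ (Matrix.mulVec_injective_iff.2 hΦ (by rw [h, Matrix.mulVec_zero]))

theorem mu_pos (hd : 0 < d) (hΦ : LinearIndependent ℝ Φ.col) (hw : ∀ z, 0 < weight M π p z) :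
    0 < mu M π p Φ := by
  have : Nonempty (Fin d) := ⟨⟨0, hd⟩⟩
  obtain ⟨i, hi⟩ := exists_eq_ciInf_of_finite
    (f := fun i => (weightedGram_isHermitian M π p Φ).eigenvalues i)
  rw [mu, ← hi]
  refine (weightedGram_isHermitian M π p Φ).posDef_iff_eigenvalues_pos.1
    (Matrix.PosDef.of_dotProduct_mulVec_pos (weightedGram_isHermitian M π p Φ) fun θ hθ => ?_) i
  rw [star_trivial, ← normSqW_mulVec]
  exact normSqW_pos hw (mulVec_ne_zero hΦ hθ)

theorem isUnit_weightedGram (hΦ : LinearIndependent ℝ Φ.col) (hw : ∀ z, 0 < weight M π p z) :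
    IsUnit (weightedGram M π p Φ) :=
  (Matrix.PosDef.of_dotProduct_mulVec_pos (weightedGram_isHermitian M π p Φ) fun θ hθ => by
    rw [star_trivial, ← normSqW_mulVec]
    exact normSqW_pos hw (mulVec_ne_zero hΦ hθ)).isUnit

/-- The matrix of the projected Bellman equation. -/
def bellmanGram (M : MDP S A) (π : Policy S A) (p : Params S)
    (Φ : Matrix (S × A) (Fin d) ℝ) : Matrix (Fin d) (Fin d) ℝ :=
  Φ.transpose * Matrix.diagonal (weight M π p) * (1 - M.γ • pairMatrix M π) * Φ

/-- A solution lies in the range of Φ, and multiplying by the Gram matrix gives the normal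
equations, whose matrix has the Bellman form as quadratic form. -/
theorem projectedBellman_iff (hu : IsUnit (weightedGram M π p Φ)) (Q : S × A → ℝ) :
    ProjectedBellman M π p Φ Q ↔ ∃ θ, Q = Φ.mulVec θ ∧ (bellmanGram M π p Φ).mulVec θ =
      (Φ.transpose * Matrix.diagonal (weight M π p)).mulVec fun z => M.cost z.1 z.2 := by
  have hdet : IsUnit (weightedGram M π p Φ).det := (Matrix.isUnit_iff_isUnit_det _).1 hu
  set Y := Φ.transpose * Matrix.diagonal (weight M π p) with hY
  have hG : ∀ θ, (weightedGram M π p Φ).mulVec θ = Y.mulVec (Φ.mulVec θ) := fun θ => by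
    rw [Matrix.mulVec_mulVec]; rfl
  have hB : ∀ θ, (bellmanGram M π p Φ).mulVec θ = Y.mulVec (Φ.mulVec θ) -
      Y.mulVec (M.γ • (pairMatrix M π).mulVec (Φ.mulVec θ)) := fun θ => by
    rw [bellmanGram, ← hY, ← Matrix.mulVec_mulVec, ← Matrix.mulVec_mulVec, Matrix.sub_mulVec,
      Matrix.one_mulVec, Matrix.smul_mulVec, Matrix.mulVec_sub]
  have hP : ∀ Q, ProjectedBellman M π p Φ Q ↔ Q = Φ.mulVec ((weightedGram M π p Φ)⁻¹.mulVec
      (Y.mulVec (M.γ • (pairMatrix M π).mulVec Q + fun z => M.cost z.1 z.2))) := fun Q => by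
    rw [ProjectedBellman, Matrix.mul_assoc _ Φ.transpose, ← hY, ← Matrix.mulVec_mulVec,
      ← Matrix.mulVec_mulVec]
  rw [hP]
  constructor
  · intro h
    refine ⟨_, h, ?_⟩
    rw [hB, ← h, sub_eq_iff_eq_add, ← Matrix.mulVec_add, add_comm (fun z : S × A => M.cost z.1 z.2)]
    conv_lhs => rw [h]
    rw [← hG, Matrix.mulVec_mulVec, Matrix.mul_nonsing_inv _ hdet, Matrix.one_mulVec]
  · rintro ⟨θ, rfl, h⟩
    rw [hB, sub_eq_iff_eq_add, ← Matrix.mulVec_add, ← hG, add_comm (fun z : S × A => M.cost z.1 z.2)] at h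
    rw [← h, Matrix.mulVec_mulVec θ, Matrix.nonsing_inv_mul _ hdet, Matrix.one_mulVec]

theorem sum_pairMatrix_mul (M : MDP S A) (π : Policy S A) (x : S × A → ℝ) (z : S × A) :
    (pairMatrix M π).mulVec x z = nextMean M π x z.1 z.2 := by
  simp only [Matrix.mulVec, dotProduct, pairMatrix, Matrix.of_apply, Fintype.sum_prod_type,
    nextMean, polMean, Finset.mul_sum, mul_assoc]

theorem dotProduct_bellmanGram (M : MDP S A) (π : Policy S A) (p : Params S)
    (Φ : Matrix (S × A) (Fin d) ℝ) (θ : Fin d → ℝ) :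
    θ ⬝ᵥ (bellmanGram M π p Φ).mulVec θ =
      bellmanForm M π (mixedVisitation M π p) (perturb π p.εA) (Φ.mulVec θ) := by
  rw [bellmanGram, ← Matrix.mulVec_mulVec, ← Matrix.mulVec_mulVec, ← Matrix.mulVec_mulVec,
    Matrix.dotProduct_mulVec, Matrix.vecMul_transpose, dotProduct, bellmanForm,
    Fintype.sum_prod_type]
  refine Finset.sum_congr rfl fun s _ => ?_
  rw [Finset.mul_sum]
  refine Finset.sum_congr rfl fun a _ => ?_
  rw [Matrix.mulVec_diagonal, Matrix.sub_mulVec, Matrix.one_mulVec, Matrix.smul_mulVec,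
    Pi.sub_apply, Pi.smul_apply, sum_pairMatrix_mul, weight, smul_eq_mul]
  ring

theorem dotProduct_cost (M : MDP S A) (π : Policy S A) (p : Params S)
    (Φ : Matrix (S × A) (Fin d) ℝ) (θ : Fin d → ℝ) :
    (θ ⬝ᵥ (Φ.transpose * Matrix.diagonal (weight M π p)).mulVec fun z => M.cost z.1 z.2) =
      costForm M (mixedVisitation M π p) (perturb π p.εA) (Φ.mulVec θ) := by
  rw [← Matrix.mulVec_mulVec, Matrix.dotProduct_mulVec, Matrix.vecMul_transpose, dotProduct,
    costForm, Fintype.sum_prod_type]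
  refine Finset.sum_congr rfl fun s _ => ?_
  rw [Finset.mul_sum]
  refine Finset.sum_congr rfl fun a _ => ?_
  rw [Matrix.mulVec_diagonal, weight]
  ring

namespace Splitting

theorem mul_sum_stateEnergy_le_of_eq {ε : ℝ} [Nonempty A] [Nonempty S] (D : Splitting M π ε)
    (hg : D.g = 0) (x : S × A → ℝ) :
    (1 - M.γ) * (7 / 8 + (2 * (Fintype.card S : ℝ) - 1)⁻¹) *
      ∑ s, stateEnergy D.k (perturb π ε) x s ≤ 2 * bellmanForm M π D.k (perturb π ε) x := by
  have hε0 := D.ε_nonneg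
  have hε1 : ε ≤ 1 := D.ε_le_one.trans (by norm_num)
  have hG : 0 < 1 - M.γ := sub_pos.2 M.γ_lt_one
  obtain ⟨s₀, hmax, h⟩ := D.dissipation_chain (by rw [hg]; norm_num) x
  have hE := stateEnergy_nonneg D.k_nonneg π hε0 hε1 x
  have hW := Finset.single_le_sum (fun s _ => hE s) (Finset.mem_univ s₀)
  have h1 : D.α * (M.γ * polMean π x s₀ ^ 2) ≤ ∑ s, stateEnergy D.k (perturb π ε) x s := by
    refine le_trans ?_ hW
    have h2 := D.α_le s₀
    rw [hg, zero_mul, add_zero] at h2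
    have h3 := (mul_le_mul_of_nonneg_left (polMean_sq_le π x s₀) M.γ_nonneg).trans
      (D.γ_mul_le_sum_perturb_sq x s₀)
    exact mul_le_mul h2 h3 (mul_nonneg M.γ_nonneg (sq_nonneg _)) (D.k_nonneg s₀)
  rw [hg] at h
  have := mul_le_mul_of_nonneg_left h1 hG.le
  linarith

end Splitting

/-- A kernel vector would have vanishing Bellman form, contrary to the dissipation with g = 0. -/
theorem bellmanGram_injective [Nonempty S] [Nonempty A] (hΦ : LinearIndependent ℝ Φ.col)
    (hf : p.f ∈ Set.Icc (0 : ℝ) 1)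
    (h0 : 0 ≤ p.εA) (hε : p.εA ≤ (1 - M.γ) * (⨅ s, mixedVisitation M π p s) / 4)
    (hw : ∀ z, 0 < weight M π p z) : Function.Injective (bellmanGram M π p Φ).mulVec := by
  refine (injective_iff_map_eq_zero (bellmanGram M π p Φ).mulVecLin).2 fun θ hθ => ?_
  by_contra hne
  have h1 := normSqW_pos hw (mulVec_ne_zero hΦ hne)
  have h2 := (fullSplitting M π p hf h0 hε).mul_sum_stateEnergy_le_of_eq rfl (Φ.mulVec θ)
  have h3 := dotProduct_bellmanGram M π p Φ θ
  rw [Matrix.mulVecLin_apply] at hθ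
  rw [hθ, dotProduct_zero] at h3
  rw [normSqW_eq_sum_stateEnergy] at h1
  have hn : (1 : ℝ) ≤ Fintype.card S := by exact_mod_cast Fintype.card_pos
  have hc : 0 ≤ (2 * (Fintype.card S : ℝ) - 1)⁻¹ := inv_nonneg.2 (by linarith)
  have hG : 0 < 1 - M.γ := sub_pos.2 M.γ_lt_one
  have h4 : 0 < (1 - M.γ) * (7 / 8 + (2 * (Fintype.card S : ℝ) - 1)⁻¹) *
      ∑ s, stateEnergy (mixedVisitation M π p) (perturb π p.εA) (Φ.mulVec θ) s := by positivity
  have h5 := h4.trans_le h2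
  change 0 < 2 * bellmanForm M π (mixedVisitation M π p) _ _ at h5
  rw [← h3] at h5
  norm_num at h5

theorem existsUnique_projectedBellman [Nonempty S] [Nonempty A] (hΦ : LinearIndependent ℝ Φ.col)
    (hf : p.f ∈ Set.Icc (0 : ℝ) 1)
    (h0 : 0 ≤ p.εA) (hε : p.εA ≤ (1 - M.γ) * (⨅ s, mixedVisitation M π p s) / 4)
    (hw : ∀ z, 0 < weight M π p z) : ∃! Q, ProjectedBellman M π p Φ Q := by
  have hinj := bellmanGram_injective hΦ hf h0 hε hw
  have hsurj : Function.Surjective (bellmanGram M π p Φ).mulVec :=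
    LinearMap.surjective_of_injective (f := (bellmanGram M π p Φ).mulVecLin) hinj
  simp_rw [projectedBellman_iff (isUnit_weightedGram hΦ hw)]
  obtain ⟨θ, hθ⟩ := hsurj
    ((Φ.transpose * Matrix.diagonal (weight M π p)).mulVec fun z => M.cost z.1 z.2)
  refine ⟨Φ.mulVec θ, ⟨θ, rfl, hθ⟩, ?_⟩
  rintro Q ⟨θ', rfl, h⟩
  rw [hinj (h.trans hθ.symm)]

theorem ProjectedBellman.bellmanForm_eq (hu : IsUnit (weightedGram M π p Φ)) {Q : S × A → ℝ}
    (h : ProjectedBellman M π p Φ Q) :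
    bellmanForm M π (mixedVisitation M π p) (perturb π p.εA) Q =
      costForm M (mixedVisitation M π p) (perturb π p.εA) Q := by
  obtain ⟨θ, rfl, hθ⟩ := (projectedBellman_iff hu Q).1 h
  rw [← dotProduct_bellmanGram, hθ, dotProduct_cost]

end

end CTD

/-! ### The iterates and the expected increment of |θ|². -/

namespace CTD

set_option linter.unusedSectionVars false

noncomputable section

theorem integral_comp_eq_sum {Ω ι : Type*} [MeasurableSpace Ω] (μ : Measure Ω)
    [IsFiniteMeasure μ] [DecidableEq ι] {f : Ω → ι} (F : Finset ι) (hF : ∀ ω, f ω ∈ F)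
    (hf : ∀ i, MeasurableSet (f ⁻¹' {i})) (h : ι → ℝ) :
    Integrable (fun ω => h (f ω)) μ ∧ ∫ ω, h (f ω) ∂μ = ∑ i ∈ F, μ.real (f ⁻¹' {i}) * h i := by
  have e : (fun ω => h (f ω)) = fun ω => ∑ i ∈ F, (f ⁻¹' {i}).indicator (fun _ => h i) ω := by
    funext ω
    rw [Finset.sum_eq_single (f ω)]
    · simp
    · intro i _ hi
      simp [hi.symm]
    · exact fun hn => absurd (hF ω) hn
  have hi : ∀ i ∈ F, Integrable ((f ⁻¹' {i}).indicator fun _ => h i) μ := fun i _ =>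
    (integrable_const _).indicator (hf i)
  rw [e]
  refine ⟨integrable_finsetSum F hi, ?_⟩
  rw [integral_finsetSum F hi]
  exact Finset.sum_congr rfl fun i _ => by rw [integral_indicator_const _ (hf i), smul_eq_mul]

variable {S A : Type*} [Fintype S] [Fintype A] [DecidableEq S] [DecidableEq A] {d : ℕ}
  {M : MDP S A} {π : Policy S A} {p : Params S}

namespace Run

variable {Ω : Type*} [mΩ : MeasurableSpace Ω] {ℙ : Measure Ω} (R : Run M π p ℙ)
  (Φ : Matrix (S × A) (Fin d) ℝ)

/-- The pair of consecutive state-action pairs sampled in an iteration, if there is one. -/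
def outcome (t : ℕ) (ω : Ω) : Option ((S × A) × (S × A)) :=
  if R.len t ω < p.m then
    some (R.pair t (R.sampleTime t ω) ω, R.pair t (R.sampleTime t ω + 1) ω)
  else none

/-- The update of the iterate. -/
def update (M : MDP S A) (p : Params S) (Φ : Matrix (S × A) (Fin d) ℝ) (θ : Fin d → ℝ) :
    Option ((S × A) × (S × A)) → Fin d → ℝ
  | some w => θ - p.ι • tdOperator M Φ w.1 w.2 θ
  | none => θ

theorem theta_succ (t : ℕ) (ω : Ω) :
    R.theta Φ (t + 1) ω = update M p Φ (R.theta Φ t ω) (R.outcome t ω) := by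
  rw [theta, stochOperator, outcome]
  split_ifs <;> simp [update]

theorem measurableSet_hittingTime (t : ℕ) (q : S) (j : ℕ) :
    MeasurableSet[R.hist (t + 1)] {ω | hittingTime (fun n => R.state t n ω) q = j} := by
  have hm := R.state_meas t
  rcases Nat.eq_zero_or_pos j with rfl | hj
  -- The infimum of the empty set is 0, so the value 0 also occurs when the target is never hit.
  · have : {ω | hittingTime (fun n => R.state t n ω) q = 0} =
        {ω | R.state t 0 ω = q} ∪ ⋂ n, {ω | R.state t n ω = q}ᶜ := by
      ext ω
      simp [hittingTime, Nat.sInf_eq_zero, Set.eq_empty_iff_forall_notMem]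
    rw [this]
    exact (hm 0 q).union (MeasurableSet.iInter fun n => (hm n q).compl)
  · have : {ω | hittingTime (fun n => R.state t n ω) q = j} =
        {ω | R.state t j ω = q} ∩ ⋂ n ∈ Set.Iio j, {ω | R.state t n ω = q}ᶜ := by
      ext ω
      simp only [Set.mem_ofPred_eq, Set.mem_inter_iff, Set.mem_iInter, Set.mem_Iio,
        Set.mem_compl_iff]
      constructor
      · intro h
        have h1 := Nat.sInf_mem (Nat.nonempty_of_pos_sInf (s := {n | R.state t n ω = q}) (by
          change 0 < hittingTime (fun n => R.state t n ω) q
          omega))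
        refine ⟨?_, fun i hi hq => ?_⟩
        · rw [← h]; exact h1
        · have : hittingTime (fun n => R.state t n ω) q ≤ i := Nat.sInf_le hq
          omega
      · rintro ⟨h1, h2⟩
        exact hittingTime_eq h2 h1
    rw [this]
    exact (hm j q).inter (MeasurableSet.biInter (Set.to_countable _) fun n _ => (hm n q).compl)

theorem measurableSet_sampled (t : ℕ) (z z' : S × A) :
    MeasurableSet[R.hist (t + 1)] {ω | R.len t ω < p.m ∧ R.pair t (R.sampleTime t ω) ω = z ∧
      R.pair t (R.sampleTime t ω + 1) ω = z'} := by
  have hp : ∀ i z, MeasurableSet[R.hist (t + 1)] {ω | R.pair t i ω = z} := by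
    intro i z
    have : {ω | R.pair t i ω = z} = {ω | R.state t i ω = z.1} ∩ {ω | R.action t i ω = z.2} := by
      ext ω; simp [pair, Prod.ext_iff]
    rw [this]
    exact (R.state_meas t i z.1).inter (R.action_meas t i z.2)
  have : {ω | R.len t ω < p.m ∧ R.pair t (R.sampleTime t ω) ω = z ∧
      R.pair t (R.sampleTime t ω + 1) ω = z'} = ⋃ k ∈ Set.Iio p.m, ⋃ q, ⋃ j,
        {ω | R.len t ω = k} ∩ {ω | R.target t ω = q} ∩
        {ω | hittingTime (fun n => R.state t n ω) q = j} ∩ {ω | R.pair t (j + k) ω = z} ∩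
        {ω | R.pair t (j + k + 1) ω = z'} := by
    ext ω
    simp only [Set.mem_ofPred_eq, Set.mem_iUnion, Set.mem_inter_iff, Set.mem_Iio, exists_prop]
    constructor
    · rintro ⟨h1, h2, h3⟩
      exact ⟨_, h1, _, _, ⟨⟨⟨rfl, rfl⟩, rfl⟩, h2⟩, h3⟩
    · rintro ⟨k, h1, q, j, ⟨⟨⟨rfl, rfl⟩, rfl⟩, h2⟩, h3⟩
      exact ⟨h1, h2, h3⟩
  rw [this]
  exact MeasurableSet.biUnion (Set.to_countable _) fun k _ => MeasurableSet.iUnion fun q =>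
    MeasurableSet.iUnion fun j => ((((R.len_meas t k).inter (R.target_meas t q)).inter
      (R.measurableSet_hittingTime t q j)).inter (hp _ z)).inter (hp _ z')

theorem outcome_eq_some (t : ℕ) (w : (S × A) × (S × A)) :
    {ω | R.outcome t ω = some w} = {ω | R.len t ω < p.m ∧
      R.pair t (R.sampleTime t ω) ω = w.1 ∧ R.pair t (R.sampleTime t ω + 1) ω = w.2} := by
  ext ω
  simp only [outcome, Set.mem_ofPred_eq]
  split_ifs with h <;> simp [h, Prod.ext_iff]

theorem measurableSet_outcome (t : ℕ) (o : Option ((S × A) × (S × A))) :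
    MeasurableSet[R.hist (t + 1)] {ω | R.outcome t ω = o} := by
  cases o with
  | some w =>
    rw [outcome_eq_some]
    exact R.measurableSet_sampled t w.1 w.2
  | none =>
    have : {ω | R.outcome t ω = none} = ⋂ w, {ω | R.outcome t ω = some w}ᶜ := by
      ext ω
      simp only [Set.mem_ofPred_eq, Set.mem_iInter, Set.mem_compl_iff]
      exact Option.eq_none_iff_forall_ne_some
    rw [this]
    refine MeasurableSet.iInter fun w => MeasurableSet.compl ?_
    rw [outcome_eq_some]
    exact R.measurableSet_sampled t w.1 w.2

open Classical in
/-- The possible values of the iterates. -/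
def values (M : MDP S A) (p : Params S) (Φ : Matrix (S × A) (Fin d) ℝ) : ℕ → Finset (Fin d → ℝ)
  | 0 => {0}
  | t + 1 => (values M p Φ t ×ˢ Finset.univ).image fun u => update M p Φ u.1 u.2

theorem theta_mem_values (t : ℕ) (ω : Ω) : R.theta Φ t ω ∈ values M p Φ t := by
  induction t with
  | zero => simp [values, theta]
  | succ t ih =>
    rw [theta_succ, values]
    exact Finset.mem_image.2 ⟨(_, _), Finset.mem_product.2 ⟨ih, Finset.mem_univ _⟩, rfl⟩

theorem measurableSet_theta (t : ℕ) (v : Fin d → ℝ) :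
    MeasurableSet[R.hist t] {ω | R.theta Φ t ω = v} := by
  induction t generalizing v with
  | zero => simp only [theta]; exact MeasurableSet.const _
  | succ t ih =>
    have : {ω | R.theta Φ (t + 1) ω = v} = ⋃ u ∈ (values M p Φ t : Set (Fin d → ℝ)),
        ⋃ o, ⋃ _ : update M p Φ u o = v, {ω | R.theta Φ t ω = u} ∩ {ω | R.outcome t ω = o} := by
      ext ω
      simp only [Set.mem_ofPred_eq, Set.mem_iUnion, Set.mem_inter_iff, exists_prop]
      constructor
      · intro h
        exact ⟨_, R.theta_mem_values Φ t ω, _, by rw [← h, theta_succ], rfl, rfl⟩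
      · rintro ⟨u, -, o, h, rfl, rfl⟩
        rw [theta_succ, h]
    rw [this]
    exact MeasurableSet.biUnion (Finset.countable_toSet _) fun u _ => MeasurableSet.iUnion fun o =>
      MeasurableSet.iUnion fun _ => (R.hist.mono t.le_succ _ (ih u)).inter
        (R.measurableSet_outcome t o)

/-- Each iterate takes finitely many values, because an iteration has finitely many outcomes; all
expectations are finite sums. -/
theorem integrable_comp_theta [IsFiniteMeasure ℙ] (t : ℕ) (h : (Fin d → ℝ) → ℝ) :
    Integrable (fun ω => h (R.theta Φ t ω)) ℙ := by
  classical
  exact (integral_comp_eq_sum ℙ (values M p Φ t) (R.theta_mem_values Φ t)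
    (fun v => R.hist.le t _ (R.measurableSet_theta Φ t v)) h).1

/-- The expected increment of the squared norm of an iterate, when squared features are bounded
by `b`. -/
def drift (M : MDP S A) (π : Policy S A) (p : Params S) (b : ℝ) (x : S × A → ℝ) : ℝ :=
  -2 * p.ι * (bellmanForm M π (truncVisitation M π p) (perturb π p.εA) x -
    costForm M (truncVisitation M π p) (perturb π p.εA) x) +
  p.ι ^ 2 * b * noiseForm M π (truncVisitation M π p) (perturb π p.εA) x

/-- Bound on the increment of the squared norm for given samples. -/
def increment (M : MDP S A) (p : Params S) (b : ℝ) (x : S × A → ℝ) (w : (S × A) × (S × A)) : ℝ :=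
  -2 * p.ι * ((x w.1 - M.cost w.1.1 w.1.2 - M.γ * x w.2) * x w.1) +
    p.ι ^ 2 * b * (x w.1 - M.cost w.1.1 w.1.2 - M.γ * x w.2) ^ 2

theorem sum_increment (M : MDP S A) (π : Policy S A) (p : Params S) (b : ℝ) (x : S × A → ℝ) :
    ∑ w : (S × A) × (S × A), truncVisitation M π p w.1.1 * perturb π p.εA w.1.1 w.1.2 *
      pairMatrix M π w.1 w.2 * increment M p b x w = drift M π p b x := by
  have h : ∀ s a, ∑ s', M.P s a s' * ∑ a', π.prob s' a' *
      ((x (s, a) - M.cost s a - M.γ * x (s', a')) * x (s, a)) =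
      x (s, a) ^ 2 - M.γ * (x (s, a) * nextMean M π x s a) - M.cost s a * x (s, a) := by
    intro s a
    have h1 : ∀ s', ∑ a', π.prob s' a' * ((x (s, a) - M.cost s a - M.γ * x (s', a')) * x (s, a)) =
        (x (s, a) - M.cost s a) * x (s, a) - M.γ * x (s, a) * polMean π x s' := by
      intro s'
      have : ∀ a', π.prob s' a' * ((x (s, a) - M.cost s a - M.γ * x (s', a')) * x (s, a)) =
          π.prob s' a' * ((x (s, a) - M.cost s a) * x (s, a)) -
            M.γ * x (s, a) * (π.prob s' a' * x (s', a')) := fun a' => by ring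
      simp_rw [this, Finset.sum_sub_distrib, ← Finset.sum_mul, ← Finset.mul_sum, π.prob_sum,
        one_mul, polMean]
    have h2 : ∀ s', M.P s a s' * ((x (s, a) - M.cost s a) * x (s, a) -
        M.γ * x (s, a) * polMean π x s') = M.P s a s' * ((x (s, a) - M.cost s a) * x (s, a)) -
        M.γ * x (s, a) * (M.P s a s' * polMean π x s') := fun s' => by ring
    simp_rw [h1, h2, Finset.sum_sub_distrib, ← Finset.sum_mul, ← Finset.mul_sum, M.P_sum, nextMean]
    ring
  have hL : bellmanForm M π (truncVisitation M π p) (perturb π p.εA) x -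
      costForm M (truncVisitation M π p) (perturb π p.εA) x =
      ∑ s, truncVisitation M π p s * ∑ a, perturb π p.εA s a * ∑ s', M.P s a s' *
        ∑ a', π.prob s' a' * ((x (s, a) - M.cost s a - M.γ * x (s', a')) * x (s, a)) := by
    rw [bellmanForm, costForm, ← Finset.sum_sub_distrib]
    refine Finset.sum_congr rfl fun s _ => ?_
    rw [← mul_sub, ← Finset.sum_sub_distrib]
    congr 1
    exact Finset.sum_congr rfl fun a _ => by rw [h]; ring
  rw [drift, hL, noiseForm]
  simp only [Fintype.sum_prod_type, Finset.mul_sum, ← Finset.sum_add_distrib, pairMatrix,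
    Matrix.of_apply, increment]
  refine Finset.sum_congr rfl fun s _ => Finset.sum_congr rfl fun a _ =>
    Finset.sum_congr rfl fun s' _ => Finset.sum_congr rfl fun a' _ => ?_
  ring

theorem dotProduct_update_le (v : Fin d → ℝ) (w : (S × A) × (S × A)) :
    update M p Φ v (some w) ⬝ᵥ update M p Φ v (some w) ≤
      v ⬝ᵥ v + increment M p (featureNorm Φ ^ 2) (Φ.mulVec v) w := by
  have h := row_dotProduct_self_le Φ w.1
  have hx : ∀ z, Φ.mulVec v z = Φ z ⬝ᵥ v := fun z => rfl
  simp only [update, tdOperator, increment, hx]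
  set δ := Φ w.1 ⬝ᵥ v - M.cost w.1.1 w.1.2 - M.γ * Φ w.2 ⬝ᵥ v
  rw [sub_dotProduct, dotProduct_sub, dotProduct_sub, smul_dotProduct, smul_dotProduct,
    smul_dotProduct, dotProduct_smul, dotProduct_smul, smul_dotProduct, dotProduct_smul,
    dotProduct_smul, dotProduct_comm v (Φ w.1)]
  simp only [smul_eq_mul]
  nlinarith [mul_le_mul_of_nonneg_left h (mul_nonneg (sq_nonneg p.ι) (sq_nonneg δ))]

/-- Condition on the value of θ_t, which belongs to the past, and average the increments over the
outcomes; an iteration without trajectory changes nothing. -/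
theorem integral_dotProduct_theta_succ_le [IsProbabilityMeasure ℙ] [Nonempty A] (t : ℕ) :
    ∫ ω, R.theta Φ (t + 1) ω ⬝ᵥ R.theta Φ (t + 1) ω ∂ℙ ≤
      ∫ ω, (R.theta Φ t ω ⬝ᵥ R.theta Φ t ω) +
        drift M π p (featureNorm Φ ^ 2) (Φ.mulVec (R.theta Φ t ω)) ∂ℙ := by
  classical
  have hθ := fun v => R.hist.le t _ (R.measurableSet_theta Φ t v)
  have ho := fun o => R.hist.le (t + 1) _ (R.measurableSet_outcome t o)
  rw [(integral_comp_eq_sum ℙ (values M p Φ t) (R.theta_mem_values Φ t) hθ fun v =>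
    v ⬝ᵥ v + drift M π p (featureNorm Φ ^ 2) (Φ.mulVec v)).2]
  have hj : ∀ u : (Fin d → ℝ) × Option ((S × A) × (S × A)),
      (fun ω => (R.theta Φ t ω, R.outcome t ω)) ⁻¹' {u} =
        {ω | R.theta Φ t ω = u.1} ∩ {ω | R.outcome t ω = u.2} := by
    intro u; ext ω; simp [Prod.ext_iff]
  have h1 := (integral_comp_eq_sum ℙ (f := fun ω => (R.theta Φ t ω, R.outcome t ω))
    (values M p Φ t ×ˢ Finset.univ)
    (fun ω => Finset.mem_product.2 ⟨R.theta_mem_values Φ t ω, Finset.mem_univ _⟩)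
    (fun u => by rw [hj]; exact (hθ _).inter (ho _))
    (fun u => update M p Φ u.1 u.2 ⬝ᵥ update M p Φ u.1 u.2)).2
  simp_rw [R.theta_succ Φ t]
  rw [h1, Finset.sum_product]
  refine Finset.sum_le_sum fun v _ => ?_
  have h2 : ℙ.real (R.theta Φ t ⁻¹' {v}) =
      ∑ o, ℙ.real ({ω | R.theta Φ t ω = v} ∩ {ω | R.outcome t ω = o}) :=
    measureReal_eq_sum_inter ℙ (f := R.outcome t) ho _
  rw [mul_add, h2, Finset.sum_mul, ← sum_increment, Finset.mul_sum, Fintype.sum_option,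
    Fintype.sum_option, add_assoc, ← Finset.sum_add_distrib]
  simp_rw [hj]
  refine add_le_add le_rfl (Finset.sum_le_sum fun w _ => ?_)
  have h3 := R.measureReal_sampled (R.measurableSet_theta Φ t v) w.1 w.2
  rw [← outcome_eq_some] at h3
  rw [← h2, ← mul_assoc]
  change _ ≤ _ + ℙ.real {ω | R.theta Φ t ω = v} * _ * _
  rw [← h3, ← mul_add]
  exact mul_le_mul_of_nonneg_left (dotProduct_update_le Φ v w) measureReal_nonneg

end Run

end

end CTD

/-! ### Summation of the drift. -/

namespace CTD

set_option linter.unusedSectionVars false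

noncomputable section

/-- The recursion gives a(n+1) ≤ (1-hμ)a(n) + hK, which preserves the bound K/μ from the start a(0)
= 0. -/
theorem le_div_of_drift {a z : ℕ → ℝ} {h μ K : ℝ} (hh : 0 ≤ h) (hμ : 0 ≤ μ) (hhμ : h * μ ≤ 1)
    (h0 : a 0 = 0) (hK : 0 ≤ K) (hstep : ∀ n, a (n + 1) ≤ a n - h * (z n - K))
    (hz : ∀ n, μ * a n ≤ z n) (n : ℕ) : μ * a n ≤ K := by
  induction n with
  | zero => rw [h0, mul_zero]; exact hK
  | succ n ih =>
    have h1 := mul_le_mul_of_nonneg_left (hstep n) hμ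
    have h2 := mul_le_mul_of_nonneg_left (hz n) hh
    have h3 := mul_le_mul_of_nonneg_left ih (sub_nonneg.2 hhμ)
    have h4 := mul_le_mul_of_nonneg_left h2 hμ
    linarith

theorem mul_sum_le_of_drift {a z : ℕ → ℝ} {h K : ℝ} (ha : ∀ n, 0 ≤ a n)
    (hstep : ∀ n, a (n + 1) ≤ a n - h * (z n - K)) (N t : ℕ) :
    h * ∑ i ∈ Finset.range t, z (N + i) ≤ a N + t * (h * K) := by
  have : ∀ t : ℕ, h * ∑ i ∈ Finset.range t, z (N + i) + a (N + t) ≤ a N + t * (h * K) := by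
    intro t
    induction t with
    | zero => simp
    | succ t ih =>
      have h1 := hstep (N + t)
      rw [Finset.sum_range_succ, ← add_assoc]
      push_cast
      linarith
  linarith [this t, ha (N + t)]

variable {S A : Type*} [Fintype S] [Fintype A] [DecidableEq S] [DecidableEq A] {d : ℕ}
  {M : MDP S A} {π : Policy S A} {p : Params S} {Φ : Matrix (S × A) (Fin d) ℝ}

theorem perturb_le_one [Nonempty A] (π : Policy S A) {ε : ℝ} (h0 : 0 ≤ ε) (h1 : ε ≤ 1) (s : S)
    (a : A) : perturb π ε s a ≤ 1 := by
  rw [← sum_perturb π ε s]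
  exact Finset.single_le_sum (fun a _ => perturb_nonneg π h0 h1 s a) (Finset.mem_univ a)

theorem normSqW_le_dotProduct [Nonempty A] (hf : p.f ∈ Set.Icc (0 : ℝ) 1) (h0 : 0 ≤ p.εA)
    (h1 : p.εA ≤ 1) (x : S × A → ℝ) : normSqW M π p x ≤ x ⬝ᵥ x := by
  refine Finset.sum_le_sum fun _ _ => ?_
  rw [← sq]
  refine mul_le_of_le_one_left (sq_nonneg _) (mul_le_one₀ ?_ (perturb_nonneg π h0 h1 _ _)
    (perturb_le_one π h0 h1 _ _))
  rw [← sum_mixedVisitation M π p]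
  exact Finset.single_le_sum (fun s _ => mixedVisitation_nonneg hf s) (Finset.mem_univ _)

theorem mu_le_sq_featureNorm [Nonempty A] (hd : 0 < d) (hf : p.f ∈ Set.Icc (0 : ℝ) 1)
    (h0 : 0 ≤ p.εA) (h1 : p.εA ≤ 1) : mu M π p Φ ≤ featureNorm Φ ^ 2 := by
  have h2 := (mu_mul_le M π p Φ (Pi.single ⟨0, hd⟩ 1)).trans
    ((normSqW_le_dotProduct hf h0 h1 _).trans (mulVec_dotProduct_self_le Φ _))
  simpa using h2

theorem normSqW_nonneg (hf : p.f ∈ Set.Icc (0 : ℝ) 1) (h0 : 0 ≤ p.εA) (h1 : p.εA ≤ 1)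
    (x : S × A → ℝ) : 0 ≤ normSqW M π p x :=
  Finset.sum_nonneg fun _ _ => mul_nonneg (mul_nonneg (mixedVisitation_nonneg hf _)
    (perturb_nonneg π h0 h1 _ _)) (sq_nonneg _)

theorem normSqW_sub_le (hf : p.f ∈ Set.Icc (0 : ℝ) 1) (h0 : 0 ≤ p.εA) (h1 : p.εA ≤ 1) {η : ℝ}
    (hη : 0 < η) (x y : S × A → ℝ) :
    normSqW M π p (x - y) ≤ (1 + η) * normSqW M π p x + (1 + η⁻¹) * normSqW M π p y := by
  simp only [normSqW, Finset.mul_sum, ← Finset.sum_add_distrib, Pi.sub_apply]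
  refine Finset.sum_le_sum fun z _ => ?_
  have hw : 0 ≤ weight M π p z :=
    mul_nonneg (mixedVisitation_nonneg hf _) (perturb_nonneg π h0 h1 _ _)
  have h2 : (x z - y z) ^ 2 ≤ (1 + η) * x z ^ 2 + (1 + η⁻¹) * y z ^ 2 := by
    have : (1 + η) * x z ^ 2 + (1 + η⁻¹) * y z ^ 2 - (x z - y z) ^ 2 =
        η⁻¹ * (η * x z + y z) ^ 2 := by field_simp; ring
    have : 0 ≤ η⁻¹ * (η * x z + y z) ^ 2 := by positivity
    linarith
  calc weight M π p z * (x z - y z) ^ 2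
      ≤ weight M π p z * ((1 + η) * x z ^ 2 + (1 + η⁻¹) * y z ^ 2) :=
        mul_le_mul_of_nonneg_left h2 hw
    _ = _ := by ring

theorem pow_mul_le_mu [Nonempty S] (hγ : 0 < M.γ) (hμ : 0 < mu M π p Φ)
    (hm : Real.logb (1 / M.γ) ((featureNorm Φ ^ 2 + 1) * √(Fintype.card S) / mu M π p Φ) ≤ p.m) :
    M.γ ^ p.m * ((featureNorm Φ ^ 2 + 1) * √(Fintype.card S)) ≤ mu M π p Φ := by
  have hs : 0 < √(Fintype.card S : ℝ) := Real.sqrt_pos.2 (by exact_mod_cast Fintype.card_pos)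
  rw [Real.logb_le_iff_le_rpow (by rw [lt_div_iff₀ hγ, one_mul]; exact M.γ_lt_one)
    (by positivity), Real.rpow_natCast, one_div, inv_pow, div_le_iff₀ hμ, inv_mul_eq_div,
    le_div_iff₀ (by positivity)] at hm
  linarith

theorem C2_le [Nonempty S] (hμ : 0 < mu M π p Φ) (hι : 0 ≤ p.ι)
    (hιΩ : p.ι * featureNorm Φ ^ 2 ≤ (1 - M.γ) / 512)
    (hg : √(Fintype.card S) * M.γ ^ p.m ≤ 1) :
    C2 M π p Φ ≤ 3 * (1 - M.γ) * √(Fintype.card S) * M.γ ^ p.m / (128 * mu M π p Φ) := by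
  have hγ := M.γ_nonneg
  have hw0 : 0 ≤ √(Fintype.card S : ℝ) * M.γ ^ p.m := by positivity
  have hu0 : 0 ≤ p.ι * featureNorm Φ ^ 2 := by positivity
  have e : C2 M π p Φ = 6 * (p.ι * featureNorm Φ ^ 2) *
      (√(Fintype.card S : ℝ) * M.γ ^ p.m / mu M π p Φ) *
      (1 + 2 * ((p.ι * featureNorm Φ ^ 2) * (√(Fintype.card S : ℝ) * M.γ ^ p.m))) := by
    rw [C2]; ring
  have e2 : 3 * (1 - M.γ) * √(Fintype.card S) * M.γ ^ p.m / (128 * mu M π p Φ) =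
      6 * ((1 - M.γ) / 512) * (√(Fintype.card S : ℝ) * M.γ ^ p.m / mu M π p Φ) * 2 := by
    field_simp
    ring
  rw [e, e2]
  have h1 : (p.ι * featureNorm Φ ^ 2) * (√(Fintype.card S : ℝ) * M.γ ^ p.m) ≤ 1 / 512 * 1 :=
    mul_le_mul (by linarith) hg hw0 (by norm_num)
  have hG : 0 < 1 - M.γ := sub_pos.2 M.γ_lt_one
  gcongr
  linarith

namespace Run

variable {Ω : Type*} [mΩ : MeasurableSpace Ω] {ℙ : Measure Ω} [IsProbabilityMeasure ℙ]
  (R : Run M π p ℙ)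

/-- Expected squared norm of an iterate. -/
def thetaSq (Φ : Matrix (S × A) (Fin d) ℝ) (n : ℕ) : ℝ :=
  ∫ ω, R.theta Φ n ω ⬝ᵥ R.theta Φ n ω ∂ℙ

/-- Expected squared weighted norm of an iterate. -/
def energy (Φ : Matrix (S × A) (Fin d) ℝ) (n : ℕ) : ℝ := ∫ ω, normSqW M π p (R.Q Φ n ω) ∂ℙ

theorem thetaSq_zero : R.thetaSq Φ 0 = 0 := by simp [thetaSq, theta]

theorem thetaSq_nonneg (n : ℕ) : 0 ≤ R.thetaSq Φ n :=
  integral_nonneg fun _ => Finset.sum_nonneg fun _ _ => mul_self_nonneg _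

theorem integrable_normSqW (y : S × A → ℝ) (n : ℕ) :
    Integrable (fun ω => normSqW M π p (R.Q Φ n ω - y)) ℙ :=
  R.integrable_comp_theta Φ n fun v => normSqW M π p (Φ.mulVec v - y)

theorem mu_mul_thetaSq_le (n : ℕ) : mu M π p Φ * R.thetaSq Φ n ≤ R.energy Φ n := by
  rw [thetaSq, ← integral_const_mul]
  exact integral_mono (R.integrable_comp_theta Φ n fun v => mu M π p Φ * (v ⬝ᵥ v))
    (R.integrable_comp_theta Φ n fun v => normSqW M π p (Φ.mulVec v))
    fun ω => mu_mul_le M π p Φ _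

theorem energy_le_mul_thetaSq {K : ℝ}
    (h : ∀ θ : Fin d → ℝ, normSqW M π p (Φ.mulVec θ) ≤ K * (θ ⬝ᵥ θ)) (n : ℕ) :
    R.energy Φ n ≤ K * R.thetaSq Φ n := by
  rw [thetaSq, ← integral_const_mul]
  exact integral_mono (R.integrable_comp_theta Φ n fun v => normSqW M π p (Φ.mulVec v))
    (R.integrable_comp_theta Φ n fun v => K * (v ⬝ᵥ v)) fun ω => h _

/-- The stepsize condition bounds ι²Ω² by 2ι(1-γ)/1024, which is the share of the noise that
`NoisyDrift` already absorbs. -/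
theorem thetaSq_succ_le [Nonempty S] [Nonempty A] (hf : p.f ∈ Set.Icc (0 : ℝ) 1) (h0 : 0 ≤ p.εA)
    (hε : p.εA ≤ (1 - M.γ) * (⨅ s, mixedVisitation M π p s) / 4) (hι : 0 ≤ p.ι)
    (hιΩ : p.ι * featureNorm Φ ^ 2 ≤ (1 - M.γ) / 512) {ϖ c C : ℝ}
    (hD : ∀ θ : Fin d → ℝ, (mixingSplitting M π p hf h0 hε).NoisyDrift ϖ c C (Φ.mulVec θ))
    (hc : 0 < c) (n : ℕ) :
    R.thetaSq Φ (n + 1) ≤ R.thetaSq Φ n - 2 * p.ι * ϖ * (1 - M.γ) * c *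
      (R.energy Φ n - C / (c * (1 - M.γ) ^ 2)) := by
  have hG : 0 < 1 - M.γ := sub_pos.2 M.γ_lt_one
  have hε1 : p.εA ≤ 1 := (mixingSplitting M π p hf h0 hε).ε_le_one.trans (by norm_num)
  have hk := (mixingSplitting M π p hf h0 hε).k_nonneg
  have hpoint : ∀ θ : Fin d → ℝ, drift M π p (featureNorm Φ ^ 2) (Φ.mulVec θ) ≤
      -(2 * p.ι * ϖ * (1 - M.γ) * c) * (normSqW M π p (Φ.mulVec θ) -
        C / (c * (1 - M.γ) ^ 2)) := by
    intro θ
    have h1 := hD θ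
    rw [Splitting.NoisyDrift, mixingSplitting_κ, ← normSqW_eq_sum_stateEnergy] at h1
    change _ ≤ bellmanForm M π (truncVisitation M π p) _ _ -
      costForm M (truncVisitation M π p) _ _ -
      _ * noiseForm M π (truncVisitation M π p) _ _ at h1
    have hN : 0 ≤ noiseForm M π (truncVisitation M π p) (perturb π p.εA) (Φ.mulVec θ) :=
      Finset.sum_nonneg fun s _ => mul_nonneg (hk s) (Finset.sum_nonneg fun a _ =>
        mul_nonneg (perturb_nonneg π h0 hε1 s a) (Finset.sum_nonneg fun s' _ =>
          mul_nonneg (M.P_nonneg _ _ _) (Finset.sum_nonneg fun a' _ =>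
            mul_nonneg (π.prob_nonneg _ _) (sq_nonneg _))))
    have h2 := mul_le_mul_of_nonneg_left (mul_le_mul_of_nonneg_right hιΩ hN) hι
    have h3 := mul_le_mul_of_nonneg_left h1 (mul_nonneg zero_le_two hι)
    have e : ϖ * ((1 - M.γ) * c * normSqW M π p (Φ.mulVec θ) - C / (1 - M.γ)) =
        ϖ * (1 - M.γ) * c * (normSqW M π p (Φ.mulVec θ) - C / (c * (1 - M.γ) ^ 2)) := by
      field_simp
    rw [e] at h3
    rw [drift]
    linarith
  have h4 := R.integral_dotProduct_theta_succ_le Φ n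
  refine h4.trans ?_
  have h5 : R.thetaSq Φ n - 2 * p.ι * ϖ * (1 - M.γ) * c *
      (R.energy Φ n - C / (c * (1 - M.γ) ^ 2)) = ∫ ω, (R.theta Φ n ω ⬝ᵥ R.theta Φ n ω) +
      -(2 * p.ι * ϖ * (1 - M.γ) * c) * (normSqW M π p (Φ.mulVec (R.theta Φ n ω)) -
        C / (c * (1 - M.γ) ^ 2)) ∂ℙ := by
    have hi := R.integrable_comp_theta Φ n fun v => normSqW M π p (Φ.mulVec v)
    rw [integral_add (R.integrable_comp_theta Φ n fun v => v ⬝ᵥ v)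
      (R.integrable_comp_theta Φ n fun v => -(2 * p.ι * ϖ * (1 - M.γ) * c) *
        (normSqW M π p (Φ.mulVec v) - C / (c * (1 - M.γ) ^ 2))), integral_const_mul,
      integral_sub hi (integrable_const _), integral_const, probReal_univ, one_smul, thetaSq,
      energy]
    simp only [Q]
    ring
  rw [h5]
  exact integral_mono (R.integrable_comp_theta Φ n fun v => (v ⬝ᵥ v) +
      drift M π p (featureNorm Φ ^ 2) (Φ.mulVec v))
    (R.integrable_comp_theta Φ n fun v => (v ⬝ᵥ v) + -(2 * p.ι * ϖ * (1 - M.γ) * c) *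
      (normSqW M π p (Φ.mulVec v) - C / (c * (1 - M.γ) ^ 2)))
    fun ω => add_le_add_right (hpoint _) _

/-- Young's inequality with the ratio X/r turns the bounds r² and X² into (r+X)². The thresholds 40
and 50 are the factors of t and T in the claim. -/
theorem sum_integral_le_of_energy (hf : p.f ∈ Set.Icc (0 : ℝ) 1) (h0 : 0 ≤ p.εA) (h1 : p.εA ≤ 1)
    {X r L T : ℝ} (hX : 0 < X) (hr : 0 < r) (hT : 0 ≤ T) (hrX : (r + X) ^ 2 ≤ 40)
    (hL : (1 + X / r) * L ≤ 50)
    {y : S × A → ℝ} (hy : (1 - M.γ) ^ 2 * normSqW M π p y ≤ X ^ 2) {N t : ℕ}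
    (hE : (1 - M.γ) ^ 2 * ∑ i ∈ Finset.range t, R.energy Φ (N + i) ≤ t * r ^ 2 + T * L) :
    ∑ i ∈ Finset.range t, ∫ ω, normSqW M π p (R.Q Φ (N + i) ω - y) ∂ℙ ≤
      10 * (5 * T + 4 * t) / (1 - M.γ) ^ 2 := by
  have hG : 0 < 1 - M.γ := sub_pos.2 M.γ_lt_one
  have hη : 0 < X / r := div_pos hX hr
  have hstep : ∀ n, ∫ ω, normSqW M π p (R.Q Φ n ω - y) ∂ℙ ≤
      (1 + X / r) * R.energy Φ n + (1 + (X / r)⁻¹) * normSqW M π p y := by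
    intro n
    have hi := R.integrable_comp_theta Φ n fun v => normSqW M π p (Φ.mulVec v)
    have e : (1 + X / r) * R.energy Φ n + (1 + (X / r)⁻¹) * normSqW M π p y =
        ∫ ω, (1 + X / r) * normSqW M π p (Φ.mulVec (R.theta Φ n ω)) +
          (1 + (X / r)⁻¹) * normSqW M π p y ∂ℙ := by
      rw [integral_add (hi.const_mul _) (integrable_const _), integral_const_mul, integral_const,
        probReal_univ, one_smul]
      rfl
    rw [e]
    exact integral_mono (R.integrable_normSqW y n) ((hi.const_mul _).add (integrable_const _))
      fun ω => normSqW_sub_le hf h0 h1 hη _ _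
  refine (Finset.sum_le_sum fun i _ => hstep (N + i)).trans ?_
  rw [le_div_iff₀ (by positivity), Finset.sum_add_distrib, ← Finset.mul_sum, Finset.sum_const,
    Finset.card_range, nsmul_eq_mul]
  have h2 := mul_le_mul_of_nonneg_left hE (by positivity : 0 ≤ 1 + X / r)
  have h3 := mul_le_mul_of_nonneg_left hy (by positivity : 0 ≤ t * (1 + (X / r)⁻¹))
  have h4 := mul_le_mul_of_nonneg_left hrX (Nat.cast_nonneg (α := ℝ) t)
  have h5 := mul_le_mul_of_nonneg_left hL hT
  have e : (1 + X / r) * r ^ 2 + (1 + (X / r)⁻¹) * X ^ 2 = (r + X) ^ 2 := by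
    field_simp
    ring
  have e2 := congrArg ((t : ℝ) * ·) e
  linarith

/-- Bounds on the energy from a drift that holds for all features. -/
theorem energy_bounds [Nonempty S] [Nonempty A] (hd : 0 < d) (hf : p.f ∈ Set.Icc (0 : ℝ) 1) (h0 : 0 ≤ p.εA)
    (hε : p.εA ≤ (1 - M.γ) * (⨅ s, mixedVisitation M π p s) / 4) (hι : 0 < p.ι)
    (hιΩ : p.ι * featureNorm Φ ^ 2 ≤ (1 - M.γ) / 512) (hμ : 0 < mu M π p Φ) {ϖ c C : ℝ}
    (hϖ0 : 0 ≤ ϖ) (hϖ1 : ϖ ≤ 1) (hc0 : 0 < c) (hc1 : c ≤ 1) (hC : 0 ≤ C)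
    (hD : ∀ θ : Fin d → ℝ, (mixingSplitting M π p hf h0 hε).NoisyDrift ϖ c C (Φ.mulVec θ)) :
    (∀ n, mu M π p Φ * R.thetaSq Φ n ≤ C / (c * (1 - M.γ) ^ 2)) ∧
    ∀ N t : ℕ, 0 < ϖ → (1 - M.γ) ^ 2 * ∑ i ∈ Finset.range t, R.energy Φ (N + i) ≤
      t * (C / c) + epochLength M π p Φ * (C / (16 * c ^ 2 * ϖ)) := by
  have hG : 0 < 1 - M.γ := sub_pos.2 M.γ_lt_one
  have hG1 : 1 - M.γ ≤ 1 := by linarith [M.γ_nonneg]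
  have hε1 : p.εA ≤ 1 := (mixingSplitting M π p hf h0 hε).ε_le_one.trans (by norm_num)
  have hstep := R.thetaSq_succ_le hf h0 hε hι.le hιΩ hD hc0
  have hμΩ : mu M π p Φ ≤ featureNorm Φ ^ 2 := mu_le_sq_featureNorm hd hf h0 hε1
  have hK : 0 ≤ C / (c * (1 - M.γ) ^ 2) := by positivity
  have hfac : 2 * p.ι * ϖ * (1 - M.γ) * c * mu M π p Φ ≤ 1 := by
    have h1 : p.ι * mu M π p Φ ≤ 1 / 512 :=
      (mul_le_mul_of_nonneg_left hμΩ hι.le).trans (by linarith)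
    have h2 : ϖ * ((1 - M.γ) * c) ≤ 1 := mul_le_one₀ hϖ1 (by positivity)
      (mul_le_one₀ hG1 hc0.le hc1)
    have h3 := mul_le_mul h2 h1 (by positivity) zero_le_one
    linarith
  have hbound := le_div_of_drift (by positivity) hμ.le hfac R.thetaSq_zero hK hstep
    R.mu_mul_thetaSq_le
  refine ⟨hbound, fun N t hϖ => ?_⟩
  have h1 := mul_sum_le_of_drift R.thetaSq_nonneg hstep N t
  have h2 : 8 / ((1 - M.γ) * p.ι * mu M π p Φ) ≤ epochLength M π p Φ := Nat.le_ceil _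
  have h3 := hbound N
  set E := ∑ i ∈ Finset.range t, R.energy Φ (N + i) with hE
  have h4 : R.thetaSq Φ N ≤ C / (c * (1 - M.γ) ^ 2) / mu M π p Φ := by
    rw [le_div_iff₀ hμ]; linarith
  have h5 : E ≤ (C / (c * (1 - M.γ) ^ 2) / mu M π p Φ +
      t * (2 * p.ι * ϖ * (1 - M.γ) * c * (C / (c * (1 - M.γ) ^ 2)))) /
      (2 * p.ι * ϖ * (1 - M.γ) * c) := by
    rw [le_div_iff₀ (by positivity)]
    linarith
  calc (1 - M.γ) ^ 2 * E ≤ (1 - M.γ) ^ 2 * ((C / (c * (1 - M.γ) ^ 2) / mu M π p Φ +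
      t * (2 * p.ι * ϖ * (1 - M.γ) * c * (C / (c * (1 - M.γ) ^ 2)))) /
      (2 * p.ι * ϖ * (1 - M.γ) * c)) := mul_le_mul_of_nonneg_left h5 (by positivity)
    -- The bound on E|θ_N|², divided by the step factor 2ιϖ(1-γ)c, is rewritten in units of the
    -- epoch length.
    _ = t * (C / c) + 8 / ((1 - M.γ) * p.ι * mu M π p Φ) * (C / (16 * c ^ 2 * ϖ)) := by
      field_simp
      ring
    _ ≤ _ := by gcongr

/-- Bound on the sum of the expected squared errors. -/
theorem sum_integral_le [Nonempty S] [Nonempty A] (hd : 0 < d) (hγ : 0 < M.γ)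
    (hf : p.f ∈ Set.Icc (0 : ℝ) 1) (h0 : 0 ≤ p.εA)
    (hε : p.εA ≤ (1 - M.γ) * (⨅ s, mixedVisitation M π p s) / 4) (hι : 0 < p.ι)
    (hιΩ : p.ι * featureNorm Φ ^ 2 ≤ (1 - M.γ) / 512) (hμ : 0 < mu M π p Φ)
    (hm : M.γ ^ p.m * ((featureNorm Φ ^ 2 + 1) * √(Fintype.card S)) ≤ mu M π p Φ)
    (hgn : √(Fintype.card S) * M.γ ^ p.m ≤ 1) {y : S × A → ℝ}
    (hy : bellmanForm M π (mixedVisitation M π p) (perturb π p.εA) y =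
      costForm M (mixedVisitation M π p) (perturb π p.εA) y) (N t : ℕ) :
    ∑ i ∈ Finset.range t, ∫ ω, normSqW M π p (R.Q Φ (N + i) ω - y) ∂ℙ ≤
      10 * (5 * epochLength M π p Φ + 4 * t) / (1 - M.γ) ^ 2 := by
  have hG : 0 < 1 - M.γ := sub_pos.2 M.γ_lt_one
  have hε1 : p.εA ≤ 1 := (mixingSplitting M π p hf h0 hε).ε_le_one.trans (by norm_num)
  have hg0 : 0 < M.γ ^ p.m := pow_pos hγ _
  -- The mixing time yields the comparison of g|x|² with μ|θ|², hence with ‖x‖_W².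
  have hsq : ∀ θ : Fin d → ℝ, √(Fintype.card S) * M.γ ^ p.m * ((Φ.mulVec θ) ⬝ᵥ (Φ.mulVec θ)) ≤
      mu M π p Φ * (θ ⬝ᵥ θ) := by
    intro θ
    have hθ : 0 ≤ θ ⬝ᵥ θ := Finset.sum_nonneg fun i _ => mul_self_nonneg _
    have hs : 0 ≤ √(Fintype.card S : ℝ) * M.γ ^ p.m := by positivity
    have h1 := mul_le_mul_of_nonneg_left (mulVec_dotProduct_self_le Φ θ) hs
    have h2 := mul_le_mul_of_nonneg_right hm hθ
    have h3 := mul_nonneg hs hθ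
    linarith
  rcases (Nat.one_le_iff_ne_zero.2 (Fintype.card_ne_zero (α := S))).eq_or_lt with hn | hn
  · have hn' : (Fintype.card S : ℝ) = 1 := by exact_mod_cast hn.symm
    simp only [hn', Real.sqrt_one, one_mul] at hgn hsq
    have hy' : (1 - M.γ) ^ 2 * normSqW M π p y ≤ (16 / 15) ^ 2 := by
      have := (fullSplitting M π p hf h0 hε).energy_le_of_eq rfl y hy.le
      rw [hn'] at this
      rw [normSqW_eq_sum_stateEnergy]
      norm_num at this ⊢
      exact this
    have hb := R.energy_bounds hd hf h0 hε hι hιΩ hμ (ϖ := 1 - M.γ ^ p.m)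
      (c := 9978 / 10000 * (7 / 16) - 144 / 100000) (C := 10022 / 10000 * (1 / 2) + 108 / 10000)
      (by linarith) (by linarith) (by norm_num) (by norm_num) (by norm_num)
      (fun θ => (mixingSplitting M π p hf h0 hε).noisyDrift_of_card_eq_one hn.symm hgn _)
    rcases le_total (M.γ ^ p.m) (1 / 2) with hg | hg
    · have hϖ : 0 < 1 - M.γ ^ p.m := by linarith
      refine R.sum_integral_le_of_energy hf h0 hε1 (X := 16 / 15) (r := 109 / 100)
        (L := 1) (by norm_num) (by norm_num) (Nat.cast_nonneg _) (by norm_num) (by norm_num) hy' ?_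
      refine (hb.2 N t hϖ).trans ?_
      gcongr
      · norm_num
      · rw [div_le_one (by positivity)]
        norm_num
        linarith
    -- For g near 1 the drift rate 1-g degenerates. But g ≥ 1/2 gives ‖x‖_W² ≤ |x|² ≤ 2μ|θ|², and
    -- μE|θ_n|² is bounded without dividing by the rate, so no start-up term is needed.
    · refine R.sum_integral_le_of_energy hf h0 hε1 (X := 16 / 15) (r := 16 / 10)
        (L := 0) (by norm_num) (by norm_num) (Nat.cast_nonneg _) (by norm_num) (by norm_num) hy' ?_
      have h1 : ∀ n, R.energy Φ n ≤ 2 * ((10022 / 10000 * (1 / 2) + 108 / 10000) /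
          ((9978 / 10000 * (7 / 16) - 144 / 100000) * (1 - M.γ) ^ 2)) := by
        intro n
        refine (R.energy_le_mul_thetaSq (K := 2 * mu M π p Φ) (fun θ => ?_) n).trans ?_
        · have h2 := hsq θ
          have h3 := normSqW_le_dotProduct (M := M) (π := π) hf h0 hε1 (Φ.mulVec θ)
          have h4 : 0 ≤ (Φ.mulVec θ) ⬝ᵥ (Φ.mulVec θ) :=
            Finset.sum_nonneg fun i _ => mul_self_nonneg _
          have h5 := mul_le_mul_of_nonneg_right hg h4
          linarith
        · linarith [hb.1 n]
      have h2 := Finset.sum_le_sum fun i (_ : i ∈ Finset.range t) => h1 (N + i)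
      rw [Finset.sum_const, Finset.card_range, nsmul_eq_mul] at h2
      refine (mul_le_mul_of_nonneg_left h2 (sq_nonneg (1 - M.γ))).trans ?_
      rw [mul_left_comm, mul_zero, add_zero]
      refine mul_le_mul_of_nonneg_left ?_ (Nat.cast_nonneg t)
      have e : ∀ C c : ℝ, (1 - M.γ) ^ 2 * (2 * (C / (c * (1 - M.γ) ^ 2))) = 2 * (C / c) := by
        intro C c
        have := hG.ne'
        rw [mul_comm c, ← div_div]
        field_simp
      rw [e]
      norm_num
  · obtain ⟨c, C, X, r, h⟩ := Splitting.exists_constants (M := M) (π := π) (ε := p.εA) hn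
    have hy' : (1 - M.γ) ^ 2 * normSqW M π p y ≤ X ^ 2 := by
      rw [normSqW_eq_sum_stateEnergy]
      exact h.energy (fullSplitting M π p hf h0 hε) rfl y hy.le
    have hD : ∀ θ : Fin d → ℝ,
        (mixingSplitting M π p hf h0 hε).NoisyDrift 1 c C (Φ.mulVec θ) := by
      intro θ
      refine h.drift _ hg0 hgn _ ?_
      rw [mixingSplitting_κ, ← normSqW_eq_sum_stateEnergy]
      refine le_trans (le_of_eq ?_) ((hsq θ).trans (mu_mul_le M π p Φ θ))
      simp only [actSq, dotProduct, Fintype.sum_prod_type, sq]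
      rfl
    have hb := (R.energy_bounds hd hf h0 hε hι hιΩ hμ zero_le_one le_rfl h.c_pos h.c_le_one
      h.C_nonneg hD).2 N t zero_lt_one
    have hc := h.c_pos
    have hr := h.R_pos
    have hCr : C / c ≤ r ^ 2 := by rw [div_le_iff₀ hc]; exact h.C_le
    refine R.sum_integral_le_of_energy hf h0 hε1 h.X_pos hr (Nat.cast_nonneg _) h.add_sq_le
      (L := r ^ 2 / (16 * c)) ?_ hy' (hb.trans ?_)
    · have e : (1 + X / r) * (r ^ 2 / (16 * c)) = r * (r + X) / (16 * c) := by
        field_simp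
      rw [e, div_le_iff₀ (by positivity)]
      linarith [h.mul_le]
    · have e : C / (16 * c ^ 2 * 1) = C / c / (16 * c) := by
        field_simp
      rw [e]
      gcongr

end Run

end

end CTD

theorem mainTheorem9 {S A : Type*} [Fintype S] [Fintype A] [DecidableEq S] [DecidableEq A]
    {d : ℕ} (hd : 0 < d) (M : CTD.MDP S A) (hγ : 0 < M.γ) (π : CTD.Policy S A)
    (Φ : Matrix (S × A) (Fin d) ℝ) (hΦ : LinearIndependent ℝ Φ.col) (p : CTD.Params S)
    (hf : p.f ∈ Set.Icc (0 : ℝ) 1) (hεS : p.εS ∈ Set.Icc (0 : ℝ) 1)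
    (hκ : 0 < ⨅ s, CTD.mixedVisitation M π p s)
    (hεA_pos : 0 < p.εA) (hεA_le : p.εA ≤ (1 - M.γ) * (⨅ s, CTD.mixedVisitation M π p s) / 4)
    (hm : Real.logb (1 / M.γ)
      ((CTD.featureNorm Φ ^ 2 + 1) * √(Fintype.card S) / CTD.mu M π p Φ) ≤ p.m)
    (hι_pos : 0 < p.ι) (hι_le : p.ι ≤ (1 - M.γ) / (512 * CTD.featureNorm Φ ^ 2)) :
    (∃! Qbar : S × A → ℝ, CTD.ProjectedBellman M π p Φ Qbar) ∧
    (∀ Qbar : S × A → ℝ, CTD.ProjectedBellman M π p Φ Qbar →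
      ∀ {Ω : Type*} [MeasurableSpace Ω] (ℙ : MeasureTheory.Measure Ω)
        [MeasureTheory.IsProbabilityMeasure ℙ] (R : CTD.Run M π p ℙ),
      (∀ n : ℕ, MeasureTheory.Integrable
        (fun ω => CTD.normSqW M π p (R.Q Φ n ω - Qbar)) ℙ) ∧
      ∀ ℓ t : ℕ, 1 ≤ t →
        ∑ i ∈ Finset.range t,
            ∫ ω, CTD.normSqW M π p (R.Q Φ (ℓ * CTD.epochLength M π p Φ + i) ω - Qbar) ∂ℙ ≤
          CTD.epochLength M π p Φ * (2 : ℝ)⁻¹ ^ (ℓ + 1) *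
              CTD.normSqW M π p (Φ.mulVec 0 - Qbar) +
            10 * (5 * CTD.epochLength M π p Φ + 4 * t) / (1 - M.γ) ^ 2) ∧
    CTD.C2 M π p Φ ≤
      3 * (1 - M.γ) * √(Fintype.card S) * M.γ ^ p.m / (128 * CTD.mu M π p Φ) := by
  have hG : 0 < 1 - M.γ := sub_pos.2 M.γ_lt_one
  have : Nonempty S := ⟨p.origin⟩
  have : Nonempty A := π.nonempty_action
  have hκ' : ∀ s, 0 < CTD.mixedVisitation M π p s := fun s =>
    hκ.trans_le (ciInf_le (Set.finite_range _).bddBelow s)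
  have hε1 : p.εA ≤ 1 := (CTD.mixingSplitting M π p hf hεA_pos.le hεA_le).ε_le_one.trans
    (by norm_num)
  have hw := CTD.weight_pos (M := M) (π := π) hκ' hεA_pos hε1
  have hμ : 0 < CTD.mu M π p Φ := CTD.mu_pos hd hΦ hw
  have hμΩ : CTD.mu M π p Φ ≤ CTD.featureNorm Φ ^ 2 :=
    CTD.mu_le_sq_featureNorm hd hf hεA_pos.le hε1
  have hΩ : 0 < CTD.featureNorm Φ ^ 2 := hμ.trans_le hμΩ
  have hιΩ : p.ι * CTD.featureNorm Φ ^ 2 ≤ (1 - M.γ) / 512 := by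
    rw [le_div_iff₀ (by positivity)] at hι_le
    linarith
  have hm' := CTD.pow_mul_le_mu hγ hμ hm
  -- Because μ ≤ Ω² < Ω² + 1.
  have hgn : √(Fintype.card S) * M.γ ^ p.m ≤ 1 := by
    by_contra! h
    have := mul_lt_mul_of_pos_right h (by linarith : 0 < CTD.featureNorm Φ ^ 2 + 1)
    linarith
  refine ⟨CTD.existsUnique_projectedBellman hΦ hf hεA_pos.le hεA_le hw,
    fun Qbar hQ Ω _ ℙ _ R => ⟨R.integrable_normSqW Qbar, fun ℓ t _ => ?_⟩,
    CTD.C2_le hμ hι_pos.le hιΩ hgn⟩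
  -- The last term of the bound suffices, from any starting index; the geometric term is only
  -- nonnegative.
  refine (R.sum_integral_le hd hγ hf hεA_pos.le hεA_le hι_pos hιΩ hμ hm' hgn
    (hQ.bellmanForm_eq (CTD.isUnit_weightedGram hΦ hw)) _ t).trans (le_add_of_nonneg_left ?_)
  exact mul_nonneg (by positivity) (CTD.normSqW_nonneg hf hεA_pos.le hε1 _)
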